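/- Let $\mathrm dU$ be the Haar measure of total mass $1$ on $\mathrm U(N)$. For $N\ge 1$, $z\in\mathbb C$, $a=(a_1,\dots,a_N)$, $b=(b_1,\dots,b_N)\in\mathbb C^N$, $A=\mathrm{diag}(a)$, $B=\mathrm{diag}(b)$, put $$I_N^{(1)}=\int_{\mathrm U(N)}e^{\sqrt z\,N\,\mathrm{Tr}(AU+U^{-1})}\,\mathrm dU,\qquad I_N^{(2)}=\int_{\mathrm U(N)}e^{zN\,\mathrm{Tr}(AUBU^{-1})}\,\mathrm dU$$ (the first integral is even in $\sqrt z$, so the branch of the root is irrelevant), and $$I_N^{(0)}=1+\sum_{d=1}^\infty z^dN^{2d}\sum_{\lambda\vdash d,\ \ell(\lambda)\le N}\ \prod_{\Box\in\lambda}\frac1{h(\Box)^2\,(1+c(\Box)/N)},$$ where $h$ and $c$ denote hook length and content. Thus $I_N^{(m)}$ is a function of $z$ and of a point of $\mathbb C^{mN}$. It equals $1$ at $z=0$; at each point of $\mathbb C^{mN}$ the free energy $F_N^{(m)}=\log I_N^{(m)}$ (principal branch) is analytic in $z$ near $0$, and $F_N^{(m)d}$ denotes the coefficient of $z^d/d!$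 in its Maclaurin series in $z$, a function on $\mathbb C^{mN}$. For $\alpha,\beta\vdash d$ and $g\ge 0$, the connected monotone double Hurwitz number $\vec H_g(\alpha,\beta)$ is the number of tuples $(\sigma,\tau_1,\dots,\tau_r)$ with $r=2g-2+\ell(\alpha)+\ell(\beta)$, where $\sigma\in \mathrm S(d)$ has cycle type $\alpha$, each $\tau_i=(s_i\ t_i)$ with $s_i<t_i$ is a transposition, $t_1\le\dots\le t_r$, the product $\sigma\tau_1\cdots\tau_r$ has cycle type $\beta$, and $\sigma,\tau_1,\dots,\tau_r$ generate a transitive subgroup of $\mathrm S(d)$. Put $\vec H_g(\alpha)=\vec H_g(\alpha,1^d)$ and $\vec H_g^d=\vec H_g(1^d)$. With $p_\alpha(x)=\prod_{i=1}^{\ell(\alpha)}\sum_{j=1}^N x_j^{\alpha_i}$, define $$F_{Ng}^{(0)d}=\vec H_g^d,\qquad F_{Ng}^{(1)d}=\sum_{\alpha\vdash d}\frac{p_\alpha(a)}{N^{\ell(\alpha)}}(-1)^{\ell(\alpha)+d}\,\vec H_g(\alpha),$$ $$F_{Ng}^{(2)d}=\sum_{\alpha,\beta\vdash d}\frac{p_\alpha(a)}{N^{\ell(\alpha)}}\frac{p_\beta(b)}{N^{\ell(\beta)}}(-1)^{\ell(\alpha)+\ell(\beta)}\,\vec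 H_g(\alpha,\beta).$$ Let $\|\cdot\|$ be the sup norm over the closed unit polydisc of $\mathbb C^{mN}$. **Theorem.** Let $m\in\{0,1,2\}$ and let $d\ge 1$ be an integer. 1. For all $N\ge d$ one has $\sum_{g\ge0}\|N^{2-2g}F_{Ng}^{(m)d}\|<\infty$ and, at every point of $\mathbb C^{mN}$, the absolutely convergent expansion $F_N^{(m)d}=\sum_{g=0}^\infty N^{2-2g}F_{Ng}^{(m)d}$. 2. For every integer $k\ge0$, $$\lim_{N\to\infty}N^{2k-2}\Big\|F_N^{(m)d}-\sum_{g=0}^kN^{2-2g}F_{Ng}^{(m)d}\Big\|=0 .$$ -/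

import Mathlib

open scoped BigOperators

namespace StrongCoupling

noncomputable section

/-! ### Unit mass Haar measure on the unitary group -/

theorem isCompact_unitaryGroup (N : ℕ) :
    IsCompact (Matrix.unitaryGroup (Fin N) ℂ : Set (Matrix (Fin N) (Fin N) ℂ)) := by
  have hK : IsCompact (Set.univ.pi fun _ : Fin N => Set.univ.pi fun _ : Fin N =>
      Metric.closedBall (0 : ℂ) 1) :=
    isCompact_univ_pi fun _ => isCompact_univ_pi fun _ => isCompact_closedBall 0 1
  have hc : IsClosed (Matrix.unitaryGroup (Fin N) ℂ : Set (Matrix (Fin N) (Fin N) ℂ)) := by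
    have he : (Matrix.unitaryGroup (Fin N) ℂ : Set (Matrix (Fin N) (Fin N) ℂ)) =
        {U : Matrix (Fin N) (Fin N) ℂ | U * star U = 1} := by
      ext U
      exact Matrix.mem_unitaryGroup_iff
    rw [he]
    exact isClosed_eq (continuous_id.mul continuous_star) continuous_const
  refine IsCompact.of_isClosed_subset hK hc ?_
  intro U hU i _ j _
  simpa using entry_norm_bound_of_unitary hU i j

instance compactSpaceUnitaryGroup (N : ℕ) : CompactSpace (Matrix.unitaryGroup (Fin N) ℂ) :=
  isCompact_iff_compactSpace.mp (isCompact_unitaryGroup N)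

instance measurableSpaceUnitaryGroup (N : ℕ) : MeasurableSpace (Matrix.unitaryGroup (Fin N) ℂ) :=
  borel _

instance borelSpaceUnitaryGroup (N : ℕ) : BorelSpace (Matrix.unitaryGroup (Fin N) ℂ) := ⟨rfl⟩

/-- The Haar measure on `U(N)` of total mass `1`. -/
def haarUnitary (N : ℕ) : MeasureTheory.Measure (Matrix.unitaryGroup (Fin N) ℂ) :=
  MeasureTheory.Measure.haarMeasure ⊤

/-! ### The matrix integrals -/

/-- The Bars-Green / Brézin-Gross-Witten / Wadia integral
`∫ exp (√z N Tr (A U + B U⁻¹)) dU` over `U(N)`. The integral is an even function of `√z`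
(replace `U` by `-U`), so the choice of the branch of the square root is immaterial. -/
def bgwIntegral (N : ℕ) (A B : Matrix (Fin N) (Fin N) ℂ) (z : ℂ) : ℂ :=
  ∫ U : Matrix.unitaryGroup (Fin N) ℂ,
    Complex.exp (z ^ (1 / 2 : ℂ) * N * Matrix.trace
      (A * (U : Matrix (Fin N) (Fin N) ℂ) +
        B * ((U⁻¹ : Matrix.unitaryGroup (Fin N) ℂ) : Matrix (Fin N) (Fin N) ℂ))) ∂haarUnitary N

/-- The Harish-Chandra / Itzykson-Zuber integral `∫ exp (z N Tr (A U B U⁻¹)) dU` over `U(N)`. -/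
def hcizIntegral (N : ℕ) (A B : Matrix (Fin N) (Fin N) ℂ) (z : ℂ) : ℂ :=
  ∫ U : Matrix.unitaryGroup (Fin N) ℂ,
    Complex.exp (z * N * Matrix.trace
      (A * (U : Matrix (Fin N) (Fin N) ℂ) * B *
        ((U⁻¹ : Matrix.unitaryGroup (Fin N) ℂ) : Matrix (Fin N) (Fin N) ℂ))) ∂haarUnitary N

/-! ### The fieldless series `I_N^{(0)}` -/

/-- The Young diagram whose row lengths are the parts of the partition `p`. -/
def diagram {d : ℕ} (p : Nat.Partition d) : YoungDiagram :=
  YoungDiagram.ofRowLens (p.parts.sort (· ≥ ·)) (p.parts.pairwise_sort (· ≥ ·)).sortedGE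

/-- The hook length (arm length + leg length + 1) of the cell `c = (row, column)`,
with rows and columns numbered from `0`. -/
def hookLength (Y : YoungDiagram) (c : ℕ × ℕ) : ℕ :=
  (Y.rowLen c.1 - (c.2 + 1)) + (Y.colLen c.2 - (c.1 + 1)) + 1

/-- The content (column index minus row index) of the cell `c = (row, column)`. -/
def content (c : ℕ × ℕ) : ℤ := (c.2 : ℤ) - (c.1 : ℤ)

/-- The coefficient of `z ^ d / d!` in the fieldless series: the sum
`d! N^{2d} ∑_λ ∏_{□ ∈ λ} 1 / (h(□)² (1 + c(□) / N))` over the Young diagrams `λ` with `d` cells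
and at most `N` rows. -/
def fieldlessCoeff (N d : ℕ) : ℂ :=
  (d.factorial : ℂ) * (N : ℂ) ^ (2 * d) *
    ∑ p : Nat.Partition d with p.parts.card ≤ N,
      ∏ c ∈ (diagram p).cells,
        1 / ((hookLength (diagram p) c : ℂ) ^ 2 * (1 + (content c : ℂ) / (N : ℂ)))

/-- The entire function `I_N^{(0)}(z) = 1 + ∑_{d ≥ 1} (z ^ d / d!) I_N^{(0)d}`. -/
def fieldlessSeries (N : ℕ) (z : ℂ) : ℂ :=
  1 + ∑' d : ℕ, z ^ (d + 1) / ((d + 1).factorial : ℂ) * fieldlessCoeff N (d + 1)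

/-! ### Partition functions, free energies, strong coupling coefficients -/

/-- The eigenvalue phase space `ℂ^{mN}`. A point `x` consists of `m` vectors in `ℂ^N`. -/
abbrev PhaseSpace (m : Fin 3) (N : ℕ) : Type := Fin (m : ℕ) → Fin N → ℂ

/-- The partition functions `I_N^{(m)}`, `m = 0, 1, 2`, as functions of the coupling `z` and of
the eigenvalues of the external fields: the fieldless series, the BGW integral with
`A = diag a` and `B = 1`, and the HCIZ integral with `A = diag a` and `B = diag b`. -/
def partitionFunction (N : ℕ) : (m : Fin 3) → PhaseSpace m N → ℂ → ℂ
  | 0, _, z => fieldlessSeries N z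
  | 1, x, z => bgwIntegral N (Matrix.diagonal (x ⟨0, by decide⟩)) 1 z
  | 2, x, z => hcizIntegral N (Matrix.diagonal (x ⟨0, by decide⟩))
      (Matrix.diagonal (x ⟨1, by decide⟩)) z

/-- The free energy `F_N = log I_N`. Since `I_N = 1` at `z = 0`, the principal logarithm is the
branch that is analytic near `z = 0` and vanishes there. -/
def freeEnergy (N : ℕ) (m : Fin 3) (x : PhaseSpace m N) (z : ℂ) : ℂ :=
  Complex.log (partitionFunction N m x z)

/-- The strong coupling coefficient `F_N^d`: the coefficient of `z ^ d / d!` in the Maclaurin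
series of `F_N` in `z`, a function on the eigenvalue phase space. -/
def strongCouplingCoeff (N d : ℕ) (m : Fin 3) (x : PhaseSpace m N) : ℂ :=
  iteratedDeriv d (freeEnergy N m x) 0

/-! ### Connected monotone Hurwitz numbers -/

/-- A monotone walk with `r` steps on the Cayley graph of `S(d)` generated by the transpositions:
a starting permutation and a sequence of transpositions `(s t)`, `s < t`, whose larger entries
`t` are weakly increasing. -/
structure MonotoneWalk (d r : ℕ) where
  start : Equiv.Perm (Fin d)
  small : Fin r → Fin d
  large : Fin r → Fin d
  small_lt_large : ∀ i, small i < large i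
  monotone_large : Monotone large

namespace MonotoneWalk

variable {d r : ℕ}

/-- The transposition crossed in the `i`-th step. -/
def step (w : MonotoneWalk d r) (i : Fin r) : Equiv.Perm (Fin d) :=
  Equiv.swap (w.small i) (w.large i)

/-- The permutation at which the walk ends. -/
def finish (w : MonotoneWalk d r) : Equiv.Perm (Fin d) :=
  w.start * (List.ofFn w.step).prod

/-- A walk is connected if its starting permutation and its steps generate a transitive subgroup
of `S(d)`, that is, if the corresponding branched cover of the sphere is connected. -/
def Connected (w : MonotoneWalk d r) : Prop :=
  MulAction.IsPretransitive (Subgroup.closure (insert w.start (Set.range w.step))) (Fin d)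

end MonotoneWalk

/-- The permutation `σ` of `d` points belongs to the conjugacy class indexed by `α`
(fixed points count as parts equal to `1`). -/
def HasCycleType {d : ℕ} (σ : Equiv.Perm (Fin d)) (α : Nat.Partition d) : Prop :=
  σ.partition.parts = α.parts

/-- The number of connected monotone walks with `r` steps from the conjugacy class of `α` to the
conjugacy class of `β`. -/
def connectedWalkCount {d : ℕ} (r : ℕ) (α β : Nat.Partition d) : ℕ :=
  Nat.card {w : MonotoneWalk d r //
    HasCycleType w.start α ∧ HasCycleType w.finish β ∧ w.Connected}

/-- The partition `1^d`. -/
def onesPartition (d : ℕ) : Nat.Partition d where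
  parts := Multiset.replicate d 1
  parts_pos := fun h => by simp [Multiset.eq_of_mem_replicate h]
  parts_sum := by simp

/-- The connected monotone double Hurwitz number of genus `g`; the number of steps is given by
the Riemann-Hurwitz formula `r = 2g - 2 + ℓ(α) + ℓ(β)`, which is nonnegative for `d ≥ 1`. -/
def hurwitzDouble {d : ℕ} (g : ℕ) (α β : Nat.Partition d) : ℕ :=
  connectedWalkCount (2 * g + α.parts.card + β.parts.card - 2) α β

/-- The connected monotone single Hurwitz number. -/
def hurwitzSingle {d : ℕ} (g : ℕ) (α : Nat.Partition d) : ℕ :=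
  hurwitzDouble g α (onesPartition d)

/-- The connected monotone simple Hurwitz number. -/
def hurwitzSimple (g d : ℕ) : ℕ := hurwitzSingle g (onesPartition d)

/-! ### The coefficients of the genus expansion -/

/-- The Newton symmetric polynomial `p_α(x_1, …, x_N) = ∏_i ∑_j x_j ^ {α_i}`. -/
def newton {d N : ℕ} (α : Nat.Partition d) (x : Fin N → ℂ) : ℂ :=
  (α.parts.map fun k => ∑ j, x j ^ k).prod

/-- The genus `g` polynomials `F_{Ng}^{(m)d}`. -/
def genusCoeff (N g d : ℕ) : (m : Fin 3) → PhaseSpace m N → ℂ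
  | 0, _ => (hurwitzSimple g d : ℂ)
  | 1, x => ∑ α : Nat.Partition d,
      newton α (x ⟨0, by decide⟩) / (N : ℂ) ^ α.parts.card *
        (-1) ^ (α.parts.card + d) * (hurwitzSingle g α : ℂ)
  | 2, x => ∑ α : Nat.Partition d, ∑ β : Nat.Partition d,
      newton α (x ⟨0, by decide⟩) / (N : ℂ) ^ α.parts.card *
        (newton β (x ⟨1, by decide⟩) / (N : ℂ) ^ β.parts.card) *
        (-1) ^ (α.parts.card + β.parts.card) * (hurwitzDouble g α β : ℂ)

/-- The sup norm over the closed unit polydisc in the eigenvalue phase space, with values in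
`[0, ∞]`. -/
def polydiscNorm {m : Fin 3} {N : ℕ} (f : PhaseSpace m N → ℂ) : ENNReal :=
  ⨆ x : {x : PhaseSpace m N // ∀ i j, ‖x i j‖ ≤ 1}, ‖f x‖ₑ

end

end StrongCoupling

open StrongCoupling

namespace StrongCoupling
open MeasureTheory

instance isMulLeftInvariant_haarUnitary (N : ℕ) : (haarUnitary N).IsMulLeftInvariant := by
  unfold haarUnitary; infer_instance

instance isProbabilityMeasure_haarUnitary (N : ℕ) : IsProbabilityMeasure (haarUnitary N) :=
  ⟨by simpa [haarUnitary] using Measure.haarMeasure_self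
        (K₀ := (⊤ : TopologicalSpace.PositiveCompacts (Matrix.unitaryGroup (Fin N) ℂ)))⟩

theorem integrable_of_continuous {N : ℕ} {E : Type*} [NormedAddCommGroup E]
    {f : Matrix.unitaryGroup (Fin N) ℂ → E} (hf : Continuous f) : Integrable f (haarUnitary N) :=
  hf.integrable_of_hasCompactSupport (HasCompactSupport.of_compactSpace f)

theorem exists_norm_le_of_continuous {N : ℕ} {E : Type*} [NormedAddCommGroup E]
    {f : Matrix.unitaryGroup (Fin N) ℂ → E} (hf : Continuous f) : ∃ C, ∀ U, ‖f U‖ ≤ C := by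
  obtain ⟨C, hC⟩ := (isCompact_range hf.norm).bddAbove
  exact ⟨C, fun U => hC ⟨U, rfl⟩⟩

theorem exp_smul_mem_unitaryGroup {N : ℕ} {X : Matrix (Fin N) (Fin N) ℂ} (hX : X.conjTranspose = -X)
    (t : ℝ) : NormedSpace.exp (t • X) ∈ Matrix.unitaryGroup (Fin N) ℂ := by
  rw [Matrix.mem_unitaryGroup_iff, Matrix.star_eq_conjTranspose, ← Matrix.exp_conjTranspose,
    Matrix.conjTranspose_smul, hX, star_trivial, smul_neg, ← Matrix.exp_add_of_commute]
  · simp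
  · exact (Commute.refl _).neg_right

open scoped Matrix.Norms.Operator in
theorem hasDerivAt_exp_smul_apply {N : ℕ} (X U : Matrix (Fin N) (Fin N) ℂ) (t : ℝ) (a b : Fin N) :
    HasDerivAt (fun t : ℝ => (NormedSpace.exp (t • X) * U) a b)
      ((X * (NormedSpace.exp (t • X) * U)) a b) t := by
  have h := (hasDerivAt_exp_smul_const' (𝕂 := ℝ) X t).mul_const U
  rw [mul_assoc] at h
  exact ((Matrix.entryLinearMap ℝ ℂ a b).toContinuousLinearMap.hasFDerivAt.comp_hasDerivAt t h)

/-- If `f'` is the derivative of `f` along left translates by a curve `V`, then `f'` has mean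
zero. -/
theorem integral_eq_zero_of_hasDerivAt {N : ℕ} (V : ℝ → Matrix.unitaryGroup (Fin N) ℂ)
    {f f' : Matrix.unitaryGroup (Fin N) ℂ → ℂ} (hf : Continuous f)
    (hf' : Continuous f')
    (h : ∀ U t, HasDerivAt (fun t : ℝ => f (V t * U)) (f' (V t * U)) t) :
    ∫ U, f' U ∂haarUnitary N = 0 := by
  obtain ⟨C, hC⟩ := exists_norm_le_of_continuous hf'
  have hm : ∀ {g : Matrix.unitaryGroup (Fin N) ℂ → ℂ}, Continuous g → ∀ t,
      Integrable (fun U => g (V t * U)) (haarUnitary N) := fun hg t =>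
    integrable_of_continuous (hg.comp (continuous_const_mul _))
  have key := (hasDerivAt_integral_of_dominated_loc_of_deriv_le (μ := haarUnitary N)
    (F := fun (t : ℝ) U => f (V t * U)) (F' := fun (t : ℝ) U => f' (V t * U))
    (x₀ := 0) (s := Set.univ) (bound := fun _ => C) Filter.univ_mem
    (Filter.Eventually.of_forall fun t => (hm hf t).aestronglyMeasurable)
    (hm hf 0) (hm hf' 0).aestronglyMeasurable
    (Filter.Eventually.of_forall fun U t _ => hC _) (integrable_const C)
    (Filter.Eventually.of_forall fun U t _ => h U t)).2
  simp only [integral_mul_left_eq_self] at key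
  exact key.unique (hasDerivAt_const _ _)

variable {κ : Type*} {N : ℕ}

/-- The monomial `∏_{k ∈ S} U (i k) (j k) ∏_{k ∈ S'} conj (U (i' k) (j' k))`. -/
noncomputable def entryMonomial (S S' : Finset κ) (i j i' j' : κ → Fin N)
    (U : Matrix (Fin N) (Fin N) ℂ) : ℂ :=
  (∏ k ∈ S, U (i k) (j k)) * ∏ k ∈ S', star (U (i' k) (j' k))

/-- The derivative of `entryMonomial` in the direction `X U`, made complex linear in `X`. -/
noncomputable def entryMonomialDeriv [DecidableEq κ] (S S' : Finset κ) (i j i' j' : κ → Fin N)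
    (X U : Matrix (Fin N) (Fin N) ℂ) : ℂ :=
  (∑ k ∈ S, (∏ l ∈ S.erase k, U (i l) (j l)) * (X * U) (i k) (j k)) *
      (∏ k ∈ S', star (U (i' k) (j' k))) -
    (∏ k ∈ S, U (i k) (j k)) * ∑ k ∈ S', (∏ l ∈ S'.erase k, star (U (i' l) (j' l))) *
      (X.transpose * U.map star) (i' k) (j' k)

theorem continuous_unitaryGroup_apply (a b : Fin N) :
    Continuous fun U : Matrix.unitaryGroup (Fin N) ℂ => (U : Matrix (Fin N) (Fin N) ℂ) a b :=
  (continuous_apply b).comp ((continuous_apply a).comp continuous_subtype_val)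

theorem continuous_entryMonomial (S S' : Finset κ) (i j i' j' : κ → Fin N) :
    Continuous fun U : Matrix.unitaryGroup (Fin N) ℂ => entryMonomial S S' i j i' j' U :=
  (continuous_finsetProd _ fun _ _ => continuous_unitaryGroup_apply _ _).mul
    (continuous_finsetProd _ fun _ _ => (continuous_unitaryGroup_apply _ _).star)

theorem continuous_entryMonomialDeriv [DecidableEq κ] (S S' : Finset κ) (i j i' j' : κ → Fin N)
    (X : Matrix (Fin N) (Fin N) ℂ) :
    Continuous fun U : Matrix.unitaryGroup (Fin N) ℂ => entryMonomialDeriv S S' i j i' j' X U := by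
  have h := fun a b => continuous_unitaryGroup_apply (N := N) a b
  have h' := fun a b => (continuous_unitaryGroup_apply (N := N) a b).star
  refine Continuous.sub (Continuous.mul ?_ ?_) (Continuous.mul ?_ ?_)
  · refine continuous_finsetSum _ fun k _ => Continuous.mul ?_ ?_
    · exact continuous_finsetProd _ fun _ _ => h _ _
    · simp only [Matrix.mul_apply]
      exact continuous_finsetSum _ fun _ _ => continuous_const.mul (h _ _)
  · exact continuous_finsetProd _ fun _ _ => h' _ _
  · exact continuous_finsetProd _ fun _ _ => h _ _
  · refine continuous_finsetSum _ fun k _ => Continuous.mul ?_ ?_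
    · exact continuous_finsetProd _ fun _ _ => h' _ _
    · simp only [Matrix.mul_apply]
      exact continuous_finsetSum _ fun _ _ => continuous_const.mul (h' _ _)

theorem integral_entryMonomialDeriv_of_skew [DecidableEq κ] (S S' : Finset κ) (i j i' j' : κ → Fin N)
    {X : Matrix (Fin N) (Fin N) ℂ} (hX : X.conjTranspose = -X) :
    ∫ U, entryMonomialDeriv S S' i j i' j' X (U : Matrix (Fin N) (Fin N) ℂ) ∂haarUnitary N = 0 := by
  refine integral_eq_zero_of_hasDerivAt (fun t => ⟨_, exp_smul_mem_unitaryGroup hX t⟩)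
    (continuous_entryMonomial S S' i j i' j')
    (continuous_entryMonomialDeriv S S' i j i' j' X) fun U t => ?_
  have h1 := HasDerivAt.fun_finsetProd (u := S) fun k _ =>
    hasDerivAt_exp_smul_apply X (U : Matrix (Fin N) (Fin N) ℂ) t (i k) (j k)
  have h2 := HasDerivAt.fun_finsetProd (u := S') fun k _ =>
    (hasDerivAt_exp_smul_apply X (U : Matrix (Fin N) (Fin N) ℂ) t (i' k) (j' k)).star
  refine (h1.mul h2).congr_deriv (Eq.symm ?_)
  rw [entryMonomialDeriv, sub_eq_add_neg]
  congr 1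
  rw [← mul_neg, ← Finset.sum_neg_distrib]
  congr 1
  refine Finset.sum_congr rfl fun k _ => ?_
  rw [smul_eq_mul, ← mul_neg]
  congr 1
  simp only [Matrix.mul_apply, star_sum, star_mul', Matrix.transpose_apply, Matrix.map_apply,
    ← Finset.sum_neg_distrib]
  refine Finset.sum_congr rfl fun c _ => ?_
  have := congrFun (congrFun hX c) (i' k)
  simp only [Matrix.conjTranspose_apply, Matrix.neg_apply] at this
  rw [this]
  simp [Matrix.mul_apply]

theorem entryMonomialDeriv_add_smul [DecidableEq κ] (S S' : Finset κ) (i j i' j' : κ → Fin N)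
    (X Y U : Matrix (Fin N) (Fin N) ℂ) (c : ℂ) :
    entryMonomialDeriv S S' i j i' j' (X + c • Y) U =
      entryMonomialDeriv S S' i j i' j' X U + c * entryMonomialDeriv S S' i j i' j' Y U := by
  simp only [entryMonomialDeriv, Matrix.add_mul, Matrix.transpose_add, Matrix.transpose_smul,
    Matrix.smul_mul, Matrix.add_apply, Matrix.smul_apply, smul_eq_mul, mul_add,
    Finset.sum_add_distrib, mul_left_comm _ c, ← Finset.mul_sum]
  ring

theorem integral_entryMonomialDeriv [DecidableEq κ] (S S' : Finset κ) (i j i' j' : κ → Fin N)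
    (X : Matrix (Fin N) (Fin N) ℂ) :
    ∫ U, entryMonomialDeriv S S' i j i' j' X (U : Matrix (Fin N) (Fin N) ℂ) ∂haarUnitary N = 0 := by
  have hX : X = (1 / 2 : ℂ) • (X - X.conjTranspose) +
      Complex.I • ((-Complex.I / 2 : ℂ) • (X + X.conjTranspose)) := by
    rw [smul_smul, show Complex.I * (-Complex.I / 2) = (1 / 2 : ℂ) by
      rw [mul_div_assoc', mul_neg, Complex.I_mul_I]; norm_num]
    rw [← smul_add]
    ext a b; simp; ring
  rw [hX]
  simp only [entryMonomialDeriv_add_smul]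
  rw [integral_add, integral_const_mul, integral_entryMonomialDeriv_of_skew,
    integral_entryMonomialDeriv_of_skew]
  · simp
  · ext a b; simp; ring
  · ext a b; simp; ring
  · exact integrable_of_continuous (continuous_entryMonomialDeriv _ _ _ _ _ _ _)
  · exact (integrable_of_continuous (continuous_entryMonomialDeriv _ _ _ _ _ _ _)).const_mul _

end StrongCoupling

namespace StrongCoupling
open MeasureTheory

theorem integrable_entryMonomial {κ : Type*} {N : ℕ} (S S' : Finset κ) (i j i' j' : κ → Fin N) :
    Integrable (fun U : Matrix.unitaryGroup (Fin N) ℂ =>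
      entryMonomial S S' i j i' j' (U : Matrix (Fin N) (Fin N) ℂ)) (haarUnitary N) :=
  integrable_of_continuous (continuous_entryMonomial S S' i j i' j')

variable {κ : Type*} [DecidableEq κ] {N : ℕ}

/-- The mixed moments of the entries of a Haar distributed unitary matrix. -/
noncomputable def moment {κ : Type*} {N : ℕ} (S S' : Finset κ) (i j i' j' : κ → Fin N) : ℂ :=
  ∫ U, entryMonomial S S' i j i' j' (U : Matrix (Fin N) (Fin N) ℂ) ∂haarUnitary N

theorem sum_apply_mul_star_apply {U : Matrix (Fin N) (Fin N) ℂ}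
    (hU : U ∈ Matrix.unitaryGroup (Fin N) ℂ) (a b : Fin N) :
    ∑ p, U p a * star (U p b) = if a = b then 1 else 0 := by
  have h := congrFun (congrFun (Matrix.mem_unitaryGroup_iff'.mp hU) b) a
  simp only [Matrix.mul_apply, Matrix.star_apply, Matrix.one_apply] at h
  simp only [eq_comm (a := a), ← h]
  exact Finset.sum_congr rfl fun p _ => mul_comm _ _

theorem single_mul_apply_eq_ite (p q a b : Fin N) (U : Matrix (Fin N) (Fin N) ℂ) :
    (Matrix.single p q (1 : ℂ) * U) a b = if a = p then U q b else 0 := by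
  split_ifs with h
  · subst h; simp
  · simp [h]

theorem sum_entryMonomialDeriv_single {S S' : Finset κ} {t : κ} (ht : t ∈ S)
    (i j i' j' : κ → Fin N) {U : Matrix (Fin N) (Fin N) ℂ}
    (hU : U ∈ Matrix.unitaryGroup (Fin N) ℂ) :
    ∑ p, entryMonomialDeriv S S' (Function.update i t p) j i' j' (Matrix.single p (i t) 1) U =
      (N * entryMonomial S S' i j i' j' U +
        ∑ k ∈ S.erase t, entryMonomial S S' i (j ∘ Equiv.swap k t) i' j' U) -
      ∑ k ∈ S', (if i t = i' k ∧ j t = j' k then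
        entryMonomial (S.erase t) (S'.erase k) i j i' j' U else 0) := by
  have e1 : ∀ p, ∀ l ∈ S.erase t, U (Function.update i t p l) (j l) = U (i l) (j l) := by
    intro p l hl
    rw [Function.update_of_ne (Finset.ne_of_mem_erase hl)]
  simp only [entryMonomialDeriv, Matrix.transpose_single, single_mul_apply_eq_ite, Matrix.map_apply,
    Finset.sum_sub_distrib, ← Finset.sum_mul]
  congr 1
  · rw [Finset.sum_comm, ← Finset.add_sum_erase S _ ht, add_mul, Finset.sum_mul]
    congr 1
    · simp only [Finset.prod_congr rfl (e1 _), Function.update_self, if_true, Finset.sum_const,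
        Finset.card_univ, Fintype.card_fin, Finset.prod_erase_mul _ _ ht, nsmul_eq_mul,
        entryMonomial]
    · rw [Finset.sum_mul]
      refine Finset.sum_congr rfl fun k hk => ?_
      have hkt : k ≠ t := Finset.ne_of_mem_erase hk
      have hkS : k ∈ S := Finset.mem_of_mem_erase hk
      have htk : t ∈ S.erase k := Finset.mem_erase.mpr ⟨hkt.symm, ht⟩
      rw [entryMonomial]
      congr 1
      simp only [Function.update_of_ne hkt, mul_ite, mul_zero, Finset.sum_ite_eq, Finset.mem_univ,
        if_true]
      rw [← Finset.mul_prod_erase _ _ htk, ← Finset.mul_prod_erase S _ hkS,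
        ← Finset.mul_prod_erase _ _ htk]
      have e2 : ∀ l ∈ (S.erase k).erase t, U (Function.update i t (i k) l) (j l) =
          U (i l) ((j ∘ Equiv.swap k t) l) := by
        intro l hl
        rw [Finset.mem_erase, Finset.mem_erase] at hl
        rw [Function.update_of_ne hl.1, Function.comp_apply,
          Equiv.swap_apply_of_ne_of_ne hl.2.1 hl.1]
      rw [Finset.prod_congr rfl e2]
      simp
      ring
  · simp only [Finset.mul_sum]
    rw [Finset.sum_comm]
    refine Finset.sum_congr rfl fun k hk => ?_
    have : ∀ p, (∏ l ∈ S, U (Function.update i t p l) (j l)) *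
        ((∏ l ∈ S'.erase k, star (U (i' l) (j' l))) * if i' k = i t then star (U p (j' k)) else 0) =
        (if i t = i' k then entryMonomial (S.erase t) (S'.erase k) i j i' j' U else 0) *
          (U p (j t) * star (U p (j' k))) := by
      intro p
      rw [← Finset.mul_prod_erase _ _ ht, Finset.prod_congr rfl (e1 _), Function.update_self,
        entryMonomial]
      by_cases h : i t = i' k
      · rw [if_pos h, if_pos h.symm]; ring
      · rw [if_neg h, if_neg (Ne.symm h)]; simp
    rw [Finset.sum_congr rfl fun p _ => this p, ← Finset.mul_sum, sum_apply_mul_star_apply hU]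
    by_cases h : i t = i' k <;> by_cases h' : j t = j' k <;> simp [h, h']

/-- The Schwinger–Dyson recursion for the moments of Haar unitary matrices. -/
theorem moment_recursion {S S' : Finset κ} {t : κ} (ht : t ∈ S) (i j i' j' : κ → Fin N) :
    N * moment S S' i j i' j' + ∑ k ∈ S.erase t, moment S S' i (j ∘ Equiv.swap k t) i' j' =
      ∑ k ∈ S', (if i t = i' k ∧ j t = j' k then moment (S.erase t) (S'.erase k) i j i' j'
        else 0) := by
  have h : ∫ U : Matrix.unitaryGroup (Fin N) ℂ, ∑ p, entryMonomialDeriv S S' (Function.update i t p)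
      j i' j' (Matrix.single p (i t) 1) (U : Matrix (Fin N) (Fin N) ℂ) ∂haarUnitary N = 0 := by
    rw [integral_finsetSum]
    · exact Finset.sum_eq_zero fun p _ => integral_entryMonomialDeriv _ _ _ _ _ _ _
    · exact fun p _ => integrable_of_continuous (continuous_entryMonomialDeriv _ _ _ _ _ _ _)
  have h' := fun U : Matrix.unitaryGroup (Fin N) ℂ =>
    sum_entryMonomialDeriv_single (S' := S') ht i j i' j' U.2
  have hi : ∀ k, Integrable (fun U : Matrix.unitaryGroup (Fin N) ℂ =>
      if i t = i' k ∧ j t = j' k then entryMonomial (S.erase t) (S'.erase k) i j i' j'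
        (U : Matrix (Fin N) (Fin N) ℂ) else 0) (haarUnitary N) := by
    intro k
    split_ifs
    · exact integrable_entryMonomial _ _ _ _ _ _
    · exact integrable_zero _ _ _
  simp only [h'] at h
  rw [integral_sub, integral_add, integral_const_mul, integral_finsetSum, integral_finsetSum,
    sub_eq_zero] at h
  · refine h.trans (Finset.sum_congr rfl fun k _ => ?_)
    split_ifs
    · rfl
    · simp
  · exact fun k _ => hi k
  · exact fun k _ => integrable_entryMonomial _ _ _ _ _ _
  · exact (integrable_entryMonomial _ _ _ _ _ _).const_mul _
  · exact integrable_finsetSum _ fun k _ => integrable_entryMonomial _ _ _ _ _ _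
  · exact ((integrable_entryMonomial _ _ _ _ _ _).const_mul _).add
      (integrable_finsetSum _ fun k _ => integrable_entryMonomial _ _ _ _ _ _)
  · exact integrable_finsetSum _ fun k _ => hi k

theorem moment_erase_erase {S : Finset κ} {k t : κ} (hk : k ∈ S) (ht : t ∈ S)
    (i j i' j' : κ → Fin N) :
    moment (S.erase t) (S.erase k) i j i' j' =
      moment (S.erase t) (S.erase t) i j (i' ∘ Equiv.swap k t) (j' ∘ Equiv.swap k t) := by
  unfold moment entryMonomial
  congr 1
  funext U
  congr 1
  refine Finset.prod_nbij' (Equiv.swap k t) (Equiv.swap k t) ?_ ?_ (by simp) (by simp) (by simp)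
  · intro l hl
    rw [Finset.mem_erase] at hl ⊢
    rcases eq_or_ne l t with rfl | hlt
    · simpa using ⟨Ne.symm hl.1, hk⟩
    · rw [Equiv.swap_apply_of_ne_of_ne hl.1 hlt]; exact ⟨hlt, hl.2⟩
  · intro l hl
    rw [Finset.mem_erase] at hl ⊢
    rcases eq_or_ne l k with rfl | hlt
    · simpa using ⟨Ne.symm hl.1, ht⟩
    · rw [Equiv.swap_apply_of_ne_of_ne hlt hl.1]; exact ⟨hlt, hl.2⟩

end StrongCoupling

namespace StrongCoupling

/-! ### Sums over lists -/

theorem summable_pow_length {α : Type*} [Fintype α] {r : ℝ} (hr : 0 ≤ r)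
    (h : Fintype.card α * r < 1) : Summable fun l : List α => r ^ l.length := by
  rw [← List.equivSigmaTuple.symm.summable_iff, summable_sigma_of_nonneg fun p => by
    exact pow_nonneg hr _]
  refine ⟨fun n => Summable.of_finite, ?_⟩
  have : ∀ n, ∑' y : Fin n → α, ((fun l : List α => r ^ l.length) ∘ List.equivSigmaTuple.symm)
      (⟨n, y⟩ : Σ n, Fin n → α) = (Fintype.card α * r) ^ n := by
    intro n
    simp [List.equivSigmaTuple, mul_pow]
  simp only [this]
  exact summable_geometric_of_lt_one (by positivity) h

theorem tsum_list {α : Type*} [Fintype α] {f : List α → ℂ} (hf : Summable f) :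
    ∑' l, f l = f [] + ∑ a, ∑' l, f (a :: l) := by
  classical
  rw [hf.tsum_eq_add_tsum_ite []]
  congr 1
  have hinj : Function.Injective fun p : α × List α => p.1 :: p.2 := by
    rintro ⟨a, l⟩ ⟨b, m⟩ h
    simpa using h
  have hsupp : Function.support (fun l : List α => if l = [] then 0 else f l) ⊆
      Set.range fun p : α × List α => p.1 :: p.2 := by
    intro l hl
    cases l with
    | nil => simp at hl
    | cons a l => exact ⟨(a, l), rfl⟩
  rw [← hinj.tsum_eq hsupp, Summable.tsum_prod (by simpa using! hf.comp_injective hinj),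
    tsum_fintype]
  simp

theorem summable_pow_length_mul {α : Type*} [Fintype α] {x : ℂ} (h : Fintype.card α * ‖x‖ < 1)
    {g : List α → ℂ} {C : ℝ} (hg : ∀ l, ‖g l‖ ≤ C) : Summable fun l => x ^ l.length * g l := by
  refine Summable.of_norm_bounded ((summable_pow_length (norm_nonneg x) h).mul_right C) fun l => ?_
  rw [norm_mul, norm_pow]
  gcongr
  exact hg l

/-- The Neumann series for the inverse of a perturbation of a scalar by right multiplications
in a finite group. -/
theorem eq_tsum_list_of_recursion {α G : Type*} [Fintype α] [Finite G] [Group G] (s : α → G)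
    {c : ℂ} (hc : c ≠ 0) (h : Fintype.card α * ‖-1 / c‖ < 1) {φ γ : G → ℂ}
    (hφ : ∀ g, c * φ g + ∑ a, φ (g * s a) = γ g) (g : G) :
    φ g = c⁻¹ * ∑' l : List α, (-1 / c) ^ l.length * γ (g * (l.map s).prod) := by
  set x : ℂ := -1 / c with hx
  obtain ⟨C, hC⟩ : ∃ C, ∀ g, ‖γ g‖ ≤ C := by
    obtain ⟨C, hC⟩ := (Set.finite_range fun g => ‖γ g‖).bddAbove
    exact ⟨C, fun g => hC ⟨g, rfl⟩⟩
  set ψ : G → ℂ := fun g => c⁻¹ * ∑' l : List α, x ^ l.length * γ (g * (l.map s).prod) with hψ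
  have hψrec : ∀ g, ψ g = c⁻¹ * γ g + x * ∑ a, ψ (g * s a) := by
    intro g
    simp only [hψ]
    rw [tsum_list (summable_pow_length_mul h fun l => hC _)]
    simp only [List.length_nil, pow_zero, List.map_nil, List.prod_nil, mul_one, one_mul,
      List.length_cons, List.map_cons, List.prod_cons, mul_add, Finset.mul_sum, mul_assoc]
    congr 1
    refine Finset.sum_congr rfl fun a _ => ?_
    rw [mul_left_comm, ← tsum_mul_left (a := x)]
    congr 2
    funext l
    ring
  have hφrec : ∀ g, φ g = c⁻¹ * γ g + x * ∑ a, φ (g * s a) := by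
    intro g
    rw [← hφ g, hx]
    field_simp
    ring
  have hfin : (Set.range fun g => ‖φ g - ψ g‖).Finite := Set.finite_range _
  obtain ⟨_, ⟨g₀, rfl⟩, hmax⟩ := hfin.exists_maximal ⟨_, ⟨1, rfl⟩⟩
  have hmax' : ∀ g, ‖φ g - ψ g‖ ≤ ‖φ g₀ - ψ g₀‖ := fun g =>
    (le_total _ _).elim id fun hle => hmax ⟨g, rfl⟩ hle
  have h0 : ‖φ g₀ - ψ g₀‖ ≤ (Fintype.card α * ‖x‖) * ‖φ g₀ - ψ g₀‖ := by
    have : φ g₀ - ψ g₀ = x * ∑ a, (φ (g₀ * s a) - ψ (g₀ * s a)) := by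
      rw [hφrec g₀, hψrec g₀, Finset.sum_sub_distrib]; ring
    calc ‖φ g₀ - ψ g₀‖ = ‖x‖ * ‖∑ a, (φ (g₀ * s a) - ψ (g₀ * s a))‖ := by rw [this, norm_mul]
      _ ≤ ‖x‖ * ∑ a : α, ‖φ g₀ - ψ g₀‖ := by
        gcongr
        exact (norm_sum_le _ _).trans (Finset.sum_le_sum fun a _ => hmax' _)
      _ = _ := by rw [Finset.sum_const, Finset.card_univ, nsmul_eq_mul]; ring
  have h1 : ‖φ g₀ - ψ g₀‖ ≤ 0 := by
    by_contra! hpos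
    nlinarith
  exact sub_eq_zero.mp (norm_le_zero_iff.mp ((hmax' g).trans h1))

/-! ### Words -/

variable {d : ℕ}

/-- The product of the transpositions `(s t)`, with `s` running over the list `l`. -/
def wordStep (t : Fin d) (l : List (Fin d)) : Equiv.Perm (Fin d) :=
  (l.map fun s => Equiv.swap s t).prod

/-- The product of the transpositions `(s t)`, first in the order of increasing `t`, then in the
order of the list `L t`. -/
def wordProd (L : Fin d → List (Fin d)) : Equiv.Perm (Fin d) :=
  ((List.finRange d).map fun t => wordStep t (L t)).prod

def wordLength (L : Fin d → List (Fin d)) : ℕ := ∑ t, (L t).length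

/-- The words in the transpositions `(s t)` with `s < t` in `S`, weakly increasing in `t`. -/
def Admissible (S : Finset (Fin d)) (L : Fin d → List (Fin d)) : Prop :=
  ∀ t, ∀ s ∈ L t, t ∈ S ∧ s ∈ S ∧ s < t

abbrev Word (S : Finset (Fin d)) : Type := {L : Fin d → List (Fin d) // Admissible S L}

theorem Admissible.eq_nil {S : Finset (Fin d)} {L : Fin d → List (Fin d)} (h : Admissible S L)
    {t : Fin d} (ht : t ∉ S) : L t = [] :=
  List.eq_nil_iff_forall_not_mem.mpr fun s hs => ht (h t s hs).1

theorem Admissible.mono {S T : Finset (Fin d)} (hST : S ⊆ T) {L : Fin d → List (Fin d)}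
    (h : Admissible S L) : Admissible T L :=
  fun t s hs => ⟨hST (h t s hs).1, hST (h t s hs).2.1, (h t s hs).2.2⟩

theorem wordStep_nil (t : Fin d) : wordStep t [] = 1 := rfl

theorem prod_map_eq_mul_of_pairwise {G : Type*} [Monoid G] {m : List (Fin d)}
    (hm : m.Pairwise (· < ·)) {f f' : Fin d → G} {t : Fin d} (ht : t ∈ m) (hf : ∀ u, t ≤ u → f u = 1)
    (hff' : ∀ u, u ≠ t → f' u = f u) : (m.map f').prod = (m.map f).prod * f' t := by
  induction m with
  | nil => simp at ht
  | cons a m ih =>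
    rw [List.pairwise_cons] at hm
    rw [List.map_cons, List.prod_cons, List.map_cons, List.prod_cons]
    rcases List.mem_cons.mp ht with rfl | ht
    · have h1 : (m.map f).prod = 1 := List.prod_eq_one fun x hx => by
        obtain ⟨u, hu, rfl⟩ := List.mem_map.mp hx
        exact hf u (hm.1 u hu).le
      have h2 : m.map f' = m.map f := List.map_congr_left fun u hu => hff' u (hm.1 u hu).ne'
      rw [h2, h1, hf t le_rfl]
      simp
    · rw [hff' a (hm.1 t ht).ne, ih hm.2 ht, mul_assoc]

theorem wordProd_update {t : Fin d} {L : Fin d → List (Fin d)} (hL : ∀ u, t ≤ u → L u = [])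
    (l : List (Fin d)) : wordProd (Function.update L t l) = wordProd L * wordStep t l := by
  have := prod_map_eq_mul_of_pairwise (List.pairwise_lt_finRange d) (List.mem_finRange t)
    (f := fun u => wordStep u (L u)) (f' := fun u => wordStep u (Function.update L t l u))
    (fun u hu => by simp [hL u hu, wordStep_nil])
    (fun u hu => by simp [Function.update_of_ne hu])
  simpa [wordProd] using this

theorem wordLength_update {t : Fin d} {L : Fin d → List (Fin d)} (hL : L t = [])
    (l : List (Fin d)) : wordLength (Function.update L t l) = l.length + wordLength L := by
  unfold wordLength
  rw [← Finset.add_sum_erase _ _ (Finset.mem_univ t),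
    ← Finset.add_sum_erase (a := t) _ (fun t => (L t).length) (Finset.mem_univ t)]
  simp only [Function.update_self, hL, List.length_nil, zero_add]
  congr 1
  exact Finset.sum_congr rfl fun u hu => by
    rw [Function.update_of_ne (Finset.ne_of_mem_erase hu)]

/-- A word on `insert t S`, where `t` exceeds the elements of `S`, is a list of elements of `S`
together with a word on `S`. -/
noncomputable def wordInsertEquiv {t : Fin d} {S : Finset (Fin d)} (h : ∀ s ∈ S, s < t) :
    List S × Word S ≃ Word (insert t S) :=
  have ht : t ∉ S := fun hts => lt_irrefl t (h t hts)
  Equiv.ofBijective (fun p => ⟨Function.update p.2.1 t (p.1.map (↑)), by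
      intro u s hs
      rcases eq_or_ne u t with rfl | hu
      · rw [Function.update_self] at hs
        obtain ⟨a, _, rfl⟩ := List.mem_map.mp hs
        exact ⟨Finset.mem_insert_self _ _, Finset.mem_insert_of_mem a.2, h _ a.2⟩
      · rw [Function.update_of_ne hu] at hs
        exact (p.2.2.mono (Finset.subset_insert _ _)) u s hs⟩) (by
    constructor
    · rintro ⟨l, L, hL⟩ ⟨m, M, hM⟩ heq
      replace heq := congrArg Subtype.val heq
      have h1 : l = m := by
        have := congrFun heq t
        simp only [Function.update_self] at this
        exact List.map_injective_iff.mpr Subtype.val_injective this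
      have h2 : L = M := by
        funext u
        rcases eq_or_ne u t with rfl | hu
        · rw [hL.eq_nil ht, hM.eq_nil ht]
        · have := congrFun heq u
          simpa only [Function.update_of_ne hu] using this
      subst h1 h2; rfl
    · rintro ⟨L, hL⟩
      have hl : ∀ s ∈ L t, s ∈ S := fun s hs =>
        (Finset.mem_insert.mp (hL t s hs).2.1).resolve_left (hL t s hs).2.2.ne
      obtain ⟨l, hl'⟩ : ∃ l : List S, l.map (↑) = L t := by
        generalize L t = m at hl
        lift m to List S using hl
        exact ⟨m, rfl⟩
      refine ⟨(l, ⟨Function.update L t [], ?_⟩), ?_⟩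
      · intro u s hs
        rcases eq_or_ne u t with rfl | hu
        · simp at hs
        · rw [Function.update_of_ne hu] at hs
          have hu' := (Finset.mem_insert.mp (hL u s hs).1).resolve_left hu
          have hst : s ≠ t := fun hst =>
            absurd ((hL u s hs).2.2.trans (h u hu')) (by simp [hst])
          exact ⟨hu', (Finset.mem_insert.mp (hL u s hs).2.1).resolve_left hst, (hL u s hs).2.2⟩
      · simp [hl'])

theorem wordInsertEquiv_apply {t : Fin d} {S : Finset (Fin d)} (h : ∀ s ∈ S, s < t)
    (p : List S × Word S) :
    (wordInsertEquiv h p : Fin d → List (Fin d)) = Function.update p.2.1 t (p.1.map (↑)) := rfl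

theorem wordLength_wordInsertEquiv {t : Fin d} {S : Finset (Fin d)} (h : ∀ s ∈ S, s < t)
    (p : List S × Word S) :
    wordLength (wordInsertEquiv h p).1 = p.1.length + wordLength p.2.1 := by
  rw [wordInsertEquiv_apply, wordLength_update (p.2.2.eq_nil fun hts => lt_irrefl t (h t hts)),
    List.length_map]

theorem wordProd_wordInsertEquiv {t : Fin d} {S : Finset (Fin d)} (h : ∀ s ∈ S, s < t)
    (p : List S × Word S) :
    wordProd (wordInsertEquiv h p).1 = wordProd p.2.1 * wordStep t (p.1.map (↑)) := by
  rw [wordInsertEquiv_apply, wordProd_update]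
  exact fun u hu => p.2.2.eq_nil fun hus => absurd (h u hus) (not_lt.mpr hu)

instance uniqueWordEmpty : Unique (Word (∅ : Finset (Fin d))) where
  default := ⟨fun _ => [], by simp [Admissible]⟩
  uniq L := Subtype.ext (funext fun t => L.2.eq_nil (Finset.notMem_empty t))

theorem summable_pow_wordLength (S : Finset (Fin d)) {r : ℝ} (hr : 0 ≤ r)
    (h : ((S.card : ℝ) - 1) * r < 1) : Summable fun L : Word S => r ^ wordLength L.1 := by
  induction S using Finset.induction_on_max with
  | empty => exact Summable.of_finite
  | insert t S hS ih =>
    have ht : t ∉ S := fun hts => lt_irrefl t (hS t hts)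
    rw [Finset.card_insert_of_notMem ht, Nat.cast_succ, add_sub_cancel_right] at h
    rw [← (wordInsertEquiv hS).summable_iff]
    have h1 := summable_pow_length (α := S) hr (by simpa using h)
    have h2 := ih (by nlinarith)
    refine (h1.mul_of_nonneg h2 (fun _ => by positivity) fun _ => by positivity).congr fun p => ?_
    simp [wordLength_wordInsertEquiv, pow_add]

end StrongCoupling

namespace StrongCoupling

variable {d N : ℕ}

theorem sum_permsOfFinset_insert {κ M : Type*} [DecidableEq κ] [AddCommMonoid M] {t : κ}
    {S : Finset κ} (ht : t ∉ S) (f : Equiv.Perm κ → M) :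
    ∑ τ ∈ permsOfFinset (insert t S), f τ =
      ∑ l ∈ insert t S, ∑ τ ∈ permsOfFinset S, f (Equiv.swap l t * τ) := by
  rw [← Finset.sum_product']
  symm
  have hfix : ∀ {τ : Equiv.Perm κ}, τ ∈ permsOfFinset S → τ t = t := by
    intro τ hτ
    by_contra hne
    exact ht (mem_perms_of_finset_iff.mp hτ hne)
  refine Finset.sum_nbij' (fun p => Equiv.swap p.1 t * p.2)
    (fun τ => (τ t, Equiv.swap (τ t) t * τ)) ?_ ?_ ?_ ?_ fun _ _ => rfl
  · rintro ⟨l, τ⟩ h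
    rw [Finset.mem_product] at h
    rw [mem_perms_of_finset_iff]
    intro x hx
    by_contra hxS
    rw [Finset.mem_insert, not_or] at hxS
    have h1 : τ x = x := by
      by_contra hne
      exact hxS.2 (mem_perms_of_finset_iff.mp h.2 hne)
    apply hx
    rw [Equiv.Perm.mul_apply, h1, Equiv.swap_apply_of_ne_of_ne _ hxS.1]
    rintro rfl
    exact (Finset.mem_insert.mp h.1).elim hxS.1 hxS.2
  · intro τ hτ
    rw [Finset.mem_product]
    have hτ' : ∀ {x}, τ x ≠ x → x ∈ insert t S := mem_perms_of_finset_iff.mp hτ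
    refine ⟨?_, ?_⟩
    · by_cases h : τ t = t
      · simp [h]
      · exact hτ' fun h' => h (τ.injective h')
    · rw [mem_perms_of_finset_iff]
      intro x hx
      rw [Equiv.Perm.mul_apply] at hx
      have hxt : x ≠ t := by rintro rfl; simp at hx
      by_contra hxS
      have h1 : τ x = x := by
        by_contra hne
        exact (Finset.mem_insert.mp (hτ' hne)).elim hxt hxS
      rw [h1, Equiv.swap_apply_of_ne_of_ne _ hxt] at hx
      · exact hx rfl
      · rintro h2
        exact hxt (τ.injective (h1.trans h2))
  · rintro ⟨l, τ⟩ h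
    rw [Finset.mem_product] at h
    simp [hfix h.2]
  · intro τ _
    simp

/-- The number of permutations of `S` transporting `(i, j)` to `(i', j')`. -/
noncomputable def matchCount (S : Finset (Fin d)) (i j i' j' : Fin d → Fin N) : ℂ :=
  ∑ τ ∈ permsOfFinset S, if ∀ k ∈ S, i k = i' (τ k) ∧ j k = j' (τ k) then 1 else 0

theorem norm_matchCount_le (S : Finset (Fin d)) (i j i' j' : Fin d → Fin N) :
    ‖matchCount S i j i' j'‖ ≤ (permsOfFinset S).card := by
  refine (norm_sum_le _ _).trans ?_
  rw [Finset.card_eq_sum_ones, Nat.cast_sum]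
  gcongr
  split_ifs <;> simp

theorem matchCount_insert {t : Fin d} {S : Finset (Fin d)} (ht : t ∉ S)
    (i j i' j' : Fin d → Fin N) :
    matchCount (insert t S) i j i' j' = ∑ k ∈ insert t S, if i t = i' k ∧ j t = j' k then
      matchCount S i j (i' ∘ Equiv.swap k t) (j' ∘ Equiv.swap k t) else 0 := by
  unfold matchCount
  rw [sum_permsOfFinset_insert ht]
  refine Finset.sum_congr rfl fun k _ => ?_
  have h : ∀ τ ∈ permsOfFinset S, (∀ a ∈ insert t S, i a = i' ((Equiv.swap k t * τ) a) ∧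
      j a = j' ((Equiv.swap k t * τ) a)) ↔ (i t = i' k ∧ j t = j' k) ∧ ∀ a ∈ S,
        i a = (i' ∘ Equiv.swap k t) (τ a) ∧ j a = (j' ∘ Equiv.swap k t) (τ a) := by
    intro τ hτ
    have hτt : τ t = t := by
      by_contra hne
      exact ht (mem_perms_of_finset_iff.mp hτ hne)
    simp [hτt]
  rw [Finset.sum_congr rfl fun τ hτ => if_congr (h τ hτ) rfl rfl]
  split_ifs with hc
  · simp [hc]
  · simp [hc]

theorem wordStep_apply_of_notMem {S : Finset (Fin d)} {t x : Fin d} {l : List (Fin d)}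
    (h : ∀ s ∈ l, s ∈ S) (ht : t ∈ S) (hx : x ∉ S) : wordStep t l x = x := by
  induction l with
  | nil => rfl
  | cons a l ih =>
    have h1 : wordStep t (a :: l) = Equiv.swap a t * wordStep t l := by simp [wordStep]
    rw [h1, Equiv.Perm.mul_apply, ih fun s hs => h s (List.mem_cons_of_mem _ hs),
      Equiv.swap_apply_of_ne_of_ne]
    · rintro rfl; exact hx (h _ List.mem_cons_self)
    · rintro rfl; exact hx ht

theorem prod_map_apply_eq_self {κ β : Type*} {l : List β} {f : β → Equiv.Perm κ} {x : κ}
    (h : ∀ b ∈ l, f b x = x) : (l.map f).prod x = x := by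
  induction l with
  | nil => rfl
  | cons a l ih =>
    rw [List.map_cons, List.prod_cons, Equiv.Perm.mul_apply,
      ih fun b hb => h b (List.mem_cons_of_mem _ hb), h a List.mem_cons_self]

theorem wordProd_apply_of_notMem {S : Finset (Fin d)} {L : Fin d → List (Fin d)}
    (h : Admissible S L) {x : Fin d} (hx : x ∉ S) : wordProd L x = x := by
  refine prod_map_apply_eq_self fun t _ => ?_
  by_cases ht : t ∈ S
  · exact wordStep_apply_of_notMem (fun s hs => (h t s hs).2.1) ht hx
  · rw [h.eq_nil ht, wordStep_nil, Equiv.Perm.one_apply]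

theorem wordStep_reverse (t : Fin d) (l : List (Fin d)) :
    wordStep t l.reverse = (wordStep t l)⁻¹ := by
  unfold wordStep
  rw [List.prod_inv_reverse, List.map_reverse, List.map_map]
  simp [Function.comp_def]

theorem summable_pow_wordLength_mul {S : Finset (Fin d)} {x : ℂ}
    (h : ((S.card : ℝ) - 1) * ‖x‖ < 1) {g : Word S → ℂ} {C : ℝ} (hg : ∀ L, ‖g L‖ ≤ C) :
    Summable fun L : Word S => x ^ wordLength L.1 * g L := by
  refine Summable.of_norm_bounded ((summable_pow_wordLength S (norm_nonneg x) h).mul_right C)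
    fun l => ?_
  rw [norm_mul, norm_pow]
  gcongr
  exact hg l

theorem card_sub_one_mul_norm_lt_one {n : ℕ} (h : n ≤ N) :
    ((n : ℝ) - 1) * ‖(-1 / N : ℂ)‖ < 1 := by
  rcases Nat.eq_zero_or_pos N with rfl | hN
  · simp
  · have hN' : (0 : ℝ) < N := Nat.cast_pos.mpr hN
    have : (n : ℝ) ≤ N := Nat.cast_le.mpr h
    rw [norm_div, norm_neg, norm_one, Complex.norm_natCast, mul_one_div, div_lt_one hN']
    linarith

/-- The moments of Haar unitary matrices as sums over monotone words. -/
theorem moment_eq_tsum (S : Finset (Fin d)) (hS : S.card ≤ N) (i j i' j' : Fin d → Fin N) :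
    moment S S i j i' j' = (N : ℂ)⁻¹ ^ S.card * ∑' L : Word S, (-1 / N : ℂ) ^ wordLength L.1 *
      matchCount S i (j ∘ ⇑(wordProd L.1)⁻¹) i' j' := by
  induction S using Finset.induction_on_max generalizing i j i' j' with
  | empty =>
    rw [tsum_eq_single default fun L hL => absurd (Subsingleton.elim _ _) hL]
    have : permsOfFinset (∅ : Finset (Fin d)) = {1} := rfl
    simp [moment, entryMonomial, matchCount, this, default, wordLength]
  | insert t S hlt ih =>
    have ht : t ∉ S := fun hts => lt_irrefl t (hlt t hts)
    rw [Finset.card_insert_of_notMem ht] at hS ⊢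
    have hN : (N : ℂ) ≠ 0 := Nat.cast_ne_zero.mpr (by omega)
    have hx := card_sub_one_mul_norm_lt_one hS
    rw [Nat.cast_succ, add_sub_cancel_right] at hx
    have hx' := card_sub_one_mul_norm_lt_one (Nat.le_of_succ_le hS)
    set x : ℂ := -1 / N with hxdef
    set γ : Equiv.Perm (Fin d) → ℂ := fun g => ∑ k ∈ insert t S,
      if i t = i' k ∧ j (g t) = j' k then moment S S i (j ∘ g) (i' ∘ Equiv.swap k t)
        (j' ∘ Equiv.swap k t) else 0 with hγ
    have hrec : ∀ g : Equiv.Perm (Fin d), N * moment (insert t S) (insert t S) i (j ∘ g) i' j' +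
        ∑ a : S, moment (insert t S) (insert t S) i (j ∘ ⇑(g * Equiv.swap (a : Fin d) t)) i' j' =
          γ g := by
      intro g
      have h := moment_recursion (S' := insert t S) (Finset.mem_insert_self t S) i (j ∘ g) i' j'
      rw [Finset.erase_insert ht] at h
      rw [hγ, Finset.sum_coe_sort S fun a =>
        moment (insert t S) (insert t S) i (j ∘ ⇑(g * Equiv.swap a t)) i' j']
      refine h.trans (Finset.sum_congr rfl fun k hk => ?_)
      rw [Function.comp_apply]
      split_ifs
      · have := moment_erase_erase hk (Finset.mem_insert_self t S) i (j ∘ g) i' j'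
        rwa [Finset.erase_insert ht] at this
      · rfl
    have hγ' : ∀ l : List S, γ (((l.reverse).map fun a : S => Equiv.swap (a : Fin d) t).prod) =
        (N : ℂ)⁻¹ ^ S.card * ∑' L : Word S, x ^ wordLength L.1 *
          matchCount (insert t S) i (j ∘ ⇑(wordProd (wordInsertEquiv hlt (l, L)).1)⁻¹) i' j' := by
      intro l
      have hW : ((l.reverse).map fun a : S => Equiv.swap (a : Fin d) t).prod =
          (wordStep t (l.map (↑)))⁻¹ := by
        rw [← wordStep_reverse, ← List.map_reverse, wordStep, List.map_map]; rfl
      rw [hW, hγ]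
      simp only [wordProd_wordInsertEquiv, matchCount_insert ht, Finset.mul_sum]
      rw [Summable.tsum_finsetSum, Finset.mul_sum]
      · refine Finset.sum_congr rfl fun k hk => ?_
        have hP : ∀ L : Word S, (wordProd L.1)⁻¹ t = t := fun L => by
          rw [Equiv.Perm.inv_eq_iff_eq, wordProd_apply_of_notMem L.2 ht]
        simp only [mul_inv_rev, Equiv.Perm.coe_mul, Function.comp_apply, hP]
        split_ifs
        · rw [ih (Nat.le_of_succ_le hS)]; rfl
        · simp
      · intro k _
        refine summable_pow_wordLength_mul hx' (C := (permsOfFinset S).card) fun L => ?_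
        split_ifs
        · exact norm_matchCount_le _ _ _ _ _
        · simp
    have hmain := eq_tsum_list_of_recursion (fun a : S => Equiv.swap (a : Fin d) t) hN
      (by rw [Fintype.card_coe]; exact hx)
      (φ := fun g : Equiv.Perm (Fin d) => moment (insert t S) (insert t S) i (j ∘ g) i' j') hrec 1
    simp only [Equiv.Perm.coe_one, Function.comp_id, ← hxdef] at hmain
    have hsum : Summable fun L : Word (insert t S) => x ^ wordLength L.1 *
        matchCount (insert t S) i (j ∘ ⇑(wordProd L.1)⁻¹) i' j' :=
      summable_pow_wordLength_mul (by
        rw [Finset.card_insert_of_notMem ht]; push_cast; linarith)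
        fun L => norm_matchCount_le _ _ _ _ _
    have hsum' : Summable fun p : List S × Word S => x ^ wordLength (wordInsertEquiv hlt p).1 *
        matchCount (insert t S) i (j ∘ ⇑(wordProd (wordInsertEquiv hlt p).1)⁻¹) i' j' :=
      hsum.comp_injective (wordInsertEquiv hlt).injective
    rw [hmain, ← (Equiv.ofBijective _ (List.reverse_involutive (α := S)).bijective).tsum_eq,
      ← (wordInsertEquiv hlt).tsum_eq,
      hsum'.tsum_prod]
    simp only [Equiv.ofBijective_apply, one_mul, hγ', List.length_reverse, pow_succ', mul_assoc,
      ← tsum_mul_left, wordLength_wordInsertEquiv, pow_add]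
    refine tsum_congr fun l => tsum_congr fun L => ?_
    ring

end StrongCoupling

namespace StrongCoupling

variable {d N : ℕ}

/-! ### Colourings fixed by a permutation -/

theorem sum_prod_mem {β : Type*} [Fintype β] (S : Finset (Fin d)) (F : Fin d → β → ℂ) :
    ∑ i : Fin d → β, ∏ k ∈ S, F k (i k) =
      (Fintype.card β : ℂ) ^ (d - S.card) * ∏ k ∈ S, ∑ b, F k b := by
  classical
  have h : ∀ i : Fin d → β, ∏ k ∈ S, F k (i k) = ∏ k, if k ∈ S then F k (i k) else 1 := by
    intro i
    rw [Finset.prod_ite_mem, Finset.univ_inter]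
  have h2 := Finset.prod_univ_sum (fun _ : Fin d => (Finset.univ : Finset β))
    (fun k b => if k ∈ S then F k b else (1 : ℂ))
  rw [Fintype.piFinset_univ] at h2
  simp only [h, ← h2]
  have h3 : ∀ k, ∑ b, (if k ∈ S then F k b else (1 : ℂ)) =
      if k ∈ S then ∑ b, F k b else (Fintype.card β : ℂ) := by
    intro k; split_ifs <;> simp
  simp only [h3]
  rw [Finset.prod_ite]
  simp only [Finset.prod_const, Finset.filter_mem_eq_inter, Finset.univ_inter]
  rw [mul_comm]
  congr 2
  rw [Finset.filter_not, Finset.filter_mem_eq_inter, Finset.univ_inter,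
    ← Finset.compl_eq_univ_sdiff, Finset.card_compl, Fintype.card_fin]

theorem sum_prod_mem_eq {β : Type*} [Fintype β] (S : Finset (Fin d)) (F : β → ℂ) :
    ∑ i : Fin d → β, ∏ k ∈ S, F (i k) =
      (Fintype.card β : ℂ) ^ (d - S.card) * (∑ b, F b) ^ S.card := by
  rw [sum_prod_mem S fun _ => F, Finset.prod_const]

/-- Functions of complementary sets of coordinates are uncorrelated. -/
theorem sum_mul_card_pow {β : Type*} [Fintype β] (T : Finset (Fin d)) (A B : (Fin d → β) → ℂ)
    (hA : ∀ i i', (∀ k ∈ T, i k = i' k) → A i = A i')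
    (hB : ∀ i i', (∀ k ∉ T, i k = i' k) → B i = B i') :
    (∑ i, A i * B i) * (Fintype.card β : ℂ) ^ d = (∑ i, A i) * ∑ i, B i := by
  classical
  have h1 : (∑ i, A i * B i) * (Fintype.card β : ℂ) ^ d =
      ∑ p : (Fin d → β) × (Fin d → β), A p.1 * B p.1 := by
    rw [Fintype.sum_prod_type]
    simp [Finset.mul_sum, mul_comm]
  rw [h1, Finset.sum_mul_sum, ← Fintype.sum_prod_type']
  let e : (Fin d → β) × (Fin d → β) → (Fin d → β) × (Fin d → β) := fun p =>
    (fun k => if k ∈ T then p.1 k else p.2 k, fun k => if k ∈ T then p.2 k else p.1 k)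
  have he : ∀ p, e (e p) = p := by
    rintro ⟨i, i'⟩
    refine Prod.ext (funext fun k => ?_) (funext fun k => ?_) <;>
      by_cases hk : k ∈ T <;> simp [e, hk]
  refine Finset.sum_nbij' e e (by simp) (by simp) (fun p _ => he p) (fun p _ => he p) ?_
  rintro ⟨i, i'⟩ _
  rw [hA i (e (i, i')).1 fun k hk => by simp [e, hk], hB i (e (i, i')).2 fun k hk => by simp [e, hk]]

/-- The weighted number of colourings that are fixed by `σ`. -/
noncomputable def colourSum (a : Fin N → ℂ) (S : Finset (Fin d)) (σ : Equiv.Perm (Fin d)) : ℂ :=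
  ∑ i : Fin d → Fin N, if ∀ k, i (σ k) = i k then ∏ k ∈ S, a (i k) else 0

/-- The product of `q k` over the lengths `k` of the cycles of `σ` on `S`. -/
noncomputable def cycleWeight (q : ℕ → ℂ) (S : Finset (Fin d)) (σ : Equiv.Perm (Fin d)) : ℂ :=
  q 1 ^ (S.card - σ.support.card) * (σ.cycleType.map q).prod

theorem colourSum_isCycle (a : Fin N → ℂ) {σ : Equiv.Perm (Fin d)} (hσ : σ.IsCycle) :
    colourSum a σ.support σ =
      (N : ℂ) ^ (d - σ.support.card) * ∑ j, a j ^ σ.support.card := by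
  classical
  obtain ⟨k₀, hk₀⟩ := hσ.nonempty_support
  have h1 : ∀ i : Fin d → Fin N, (if ∀ k, i (σ k) = i k then ∏ k ∈ σ.support, a (i k) else 0) =
      ∑ j, ∏ k ∈ σ.support, if i k = j then a j else 0 := by
    intro i
    have hconst : (∀ k, i (σ k) = i k) ↔ ∀ k ∈ σ.support, i k = i k₀ := by
      constructor
      · intro h k hk
        obtain ⟨n, rfl⟩ := hσ.exists_pow_eq (Equiv.Perm.mem_support.mp hk₀)
          (Equiv.Perm.mem_support.mp hk)
        clear hk
        induction n with
        | zero => rfl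
        | succ n ih => rw [pow_succ', Equiv.Perm.mul_apply, h, ih]
      · intro h k
        by_cases hk : k ∈ σ.support
        · rw [h _ (Equiv.Perm.apply_mem_support.mpr hk), h k hk]
        · rw [Equiv.Perm.notMem_support.mp hk]
    rw [if_congr hconst rfl rfl, Finset.sum_eq_single (i k₀)]
    · split_ifs with h
      · exact Finset.prod_congr rfl fun k hk => by rw [if_pos (h k hk), h k hk]
      · push Not at h
        obtain ⟨k, hk, hne⟩ := h
        rw [Finset.prod_eq_zero hk (if_neg hne)]
    · intro j _ hj
      exact Finset.prod_eq_zero hk₀ (if_neg hj.symm)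
    · simp
  unfold colourSum
  simp only [h1]
  rw [Finset.sum_comm, Finset.mul_sum]
  refine Finset.sum_congr rfl fun j _ => ?_
  rw [sum_prod_mem_eq σ.support fun b => if b = j then a j else 0]
  simp

theorem colourSum_mul_of_disjoint (a : Fin N → ℂ) {σ τ : Equiv.Perm (Fin d)}
    (h : σ.Disjoint τ) {S : Finset (Fin d)} (hS : σ.support ⊆ S) :
    colourSum a S (σ * τ) * (N : ℂ) ^ d =
      colourSum a σ.support σ * colourSum a (S \ σ.support) τ := by
  classical
  have hd := Equiv.Perm.disjoint_iff_disjoint_support.mp h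
  have key := sum_mul_card_pow (β := Fin N) σ.support
    (fun i => if ∀ k, i (σ k) = i k then ∏ k ∈ σ.support, a (i k) else 0)
    (fun i => if ∀ k, i (τ k) = i k then ∏ k ∈ S \ σ.support, a (i k) else 0) ?_ ?_
  · rw [Fintype.card_fin] at key
    rw [colourSum, colourSum, colourSum, ← key]
    congr 1
    refine Finset.sum_congr rfl fun i _ => ?_
    have hiff : (∀ k, i ((σ * τ) k) = i k) ↔ (∀ k, i (σ k) = i k) ∧ ∀ k, i (τ k) = i k := by
      constructor
      · intro hi
        constructor
        · intro k
          rcases h k with hk | hk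
          · rw [hk]
          · simpa [hk] using hi k
        · intro k
          rcases h.symm k with hk | hk
          · rw [hk]
          · have := hi k
            rw [h.commute.eq] at this
            simpa [hk] using this
      · rintro ⟨h1, h2⟩ k
        rw [Equiv.Perm.mul_apply, h1, h2]
    rw [if_congr hiff rfl rfl]
    by_cases h1 : ∀ k, i (σ k) = i k <;> by_cases h2 : ∀ k, i (τ k) = i k <;>
      simp only [h1, h2, and_self, and_true, and_false, implies_true, if_true, if_false, mul_zero,
        zero_mul]
    rw [mul_comm, Finset.prod_sdiff hS]
  · intro i i' hi
    have : (∀ k, i (σ k) = i k) ↔ ∀ k, i' (σ k) = i' k := by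
      refine forall_congr' fun k => ?_
      by_cases hk : k ∈ σ.support
      · rw [hi _ hk, hi _ (Equiv.Perm.apply_mem_support.mpr hk)]
      · rw [Equiv.Perm.notMem_support.mp hk]; simp
    rw [if_congr this rfl rfl, Finset.prod_congr rfl fun k hk => by rw [hi k hk]]
  · intro i i' hi
    have : (∀ k, i (τ k) = i k) ↔ ∀ k, i' (τ k) = i' k := by
      refine forall_congr' fun k => ?_
      by_cases hk : k ∈ τ.support
      · rw [hi _ (Finset.disjoint_right.mp hd hk),
          hi _ (Finset.disjoint_right.mp hd (Equiv.Perm.apply_mem_support.mpr hk))]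
      · rw [Equiv.Perm.notMem_support.mp hk]; simp
    rw [if_congr this rfl rfl,
      Finset.prod_congr rfl fun k hk => by rw [hi k (Finset.mem_sdiff.mp hk).2]]

theorem colourSum_eq_cycleWeight (hN : N ≠ 0) (a : Fin N → ℂ) {σ : Equiv.Perm (Fin d)}
    {S : Finset (Fin d)} (hS : σ.support ⊆ S) :
    colourSum a S σ = (N : ℂ) ^ (d - S.card) * cycleWeight (fun k => ∑ j, a j ^ k) S σ := by
  have hN' : (N : ℂ) ≠ 0 := Nat.cast_ne_zero.mpr hN
  have hone : ∀ S : Finset (Fin d), colourSum a S 1 =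
      (N : ℂ) ^ (d - S.card) * cycleWeight (fun k => ∑ j, a j ^ k) S 1 := by
    intro S
    simp [colourSum, cycleWeight, sum_prod_mem_eq S a]
  have hstep : ∀ σ τ : Equiv.Perm (Fin d), σ.Disjoint τ → σ.IsCycle →
      (∀ S : Finset (Fin d), τ.support ⊆ S → colourSum a S τ =
        (N : ℂ) ^ (d - S.card) * cycleWeight (fun k => ∑ j, a j ^ k) S τ) →
      ∀ S : Finset (Fin d), (σ * τ).support ⊆ S → colourSum a S (σ * τ) =
        (N : ℂ) ^ (d - S.card) * cycleWeight (fun k => ∑ j, a j ^ k) S (σ * τ) := by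
    intro σ τ hdisj hσ ih S hS
    have hd := Equiv.Perm.disjoint_iff_disjoint_support.mp hdisj
    rw [hdisj.support_mul] at hS
    have hσS := Finset.union_subset_left hS
    have hτS := Finset.union_subset_right hS
    have hτS' : τ.support ⊆ S \ σ.support := fun k hk =>
      Finset.mem_sdiff.mpr ⟨hτS hk, Finset.disjoint_right.mp hd hk⟩
    have h1 := colourSum_mul_of_disjoint a hdisj hσS
    rw [colourSum_isCycle a hσ, ih _ hτS'] at h1
    refine mul_right_cancel₀ (pow_ne_zero d hN') (h1.trans ?_)
    have hc1 : σ.support.card ≤ S.card := Finset.card_le_card hσS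
    have hc2 : S.card ≤ d := by simpa using Finset.card_le_univ S
    have hc3 : τ.support.card ≤ S.card - σ.support.card := by
      simpa [Finset.card_sdiff_of_subset hσS] using Finset.card_le_card hτS'
    unfold cycleWeight
    rw [hdisj.cycleType_mul, hdisj.card_support_mul, hσ.cycleType, Finset.card_sdiff_of_subset hσS,
      Multiset.map_add, Multiset.prod_add, Nat.sub_add_eq]
    simp only [Multiset.map_singleton, Multiset.prod_singleton]
    have hpow : (N : ℂ) ^ (d - σ.support.card) * (N : ℂ) ^ (d - (S.card - σ.support.card)) =
        (N : ℂ) ^ (d - S.card) * (N : ℂ) ^ d := by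
      rw [← pow_add, ← pow_add]; congr 1; omega
    linear_combination (∑ j, a j ^ σ.support.card) * ((∑ j, a j ^ 1) ^
      (S.card - σ.support.card - τ.support.card) *
      (τ.cycleType.map fun k => ∑ j, a j ^ k).prod) * hpow
  have main : ∀ S : Finset (Fin d), σ.support ⊆ S → colourSum a S σ =
      (N : ℂ) ^ (d - S.card) * cycleWeight (fun k => ∑ j, a j ^ k) S σ := by
    clear hS S
    induction σ using Equiv.Perm.cycle_induction_on with
    | base_one => exact fun S _ => hone S
    | base_cycles σ hσ =>
      have := hstep σ 1 (Equiv.Perm.disjoint_one_right σ) hσ fun S _ => hone S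
      rwa [mul_one] at this
    | induction_disjoint σ τ hd hσ _ ih => exact hstep σ τ hd hσ fun S hS => ih S hS
  exact main S hS

end StrongCoupling

namespace StrongCoupling
open MeasureTheory

variable {d N : ℕ}

/-! ### Weighted sums over monotone walks -/

/-- Monotone walks on the symmetric group of `S`: a starting point and a word. -/
abbrev Walk (S : Finset (Fin d)) : Type := permsOfFinset S × Word S

/-- The end point of a walk. -/
def Walk.finish {S : Finset (Fin d)} (ω : Walk S) : Equiv.Perm (Fin d) := ω.1 * wordProd ω.2.1

noncomputable def walkWeight (q q' : ℕ → ℂ) (x : ℂ) {S : Finset (Fin d)} (ω : Walk S) : ℂ :=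
  x ^ wordLength ω.2.1 * (cycleWeight q S ω.1 * cycleWeight q' S ω.finish)

noncomputable def walkSum (q q' : ℕ → ℂ) (x : ℂ) (S : Finset (Fin d)) : ℂ :=
  ∑' ω : Walk S, walkWeight q q' x ω

theorem summable_pow_walk (S : Finset (Fin d)) {r : ℝ} (hr : 0 ≤ r)
    (h : ((S.card : ℝ) - 1) * r < 1) : Summable fun ω : Walk S => r ^ wordLength ω.2.1 := by
  have h1 : Summable fun _ : permsOfFinset S => (1 : ℝ) := Summable.of_finite
  refine (h1.mul_of_nonneg (summable_pow_wordLength S hr h) (fun _ => zero_le_one)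
    fun _ => pow_nonneg hr _).congr fun ω => one_mul _

theorem exists_norm_cycleWeight_le (q : ℕ → ℂ) (S : Finset (Fin d)) :
    ∃ C, ∀ σ, ‖cycleWeight q S σ‖ ≤ C := by
  obtain ⟨C, hC⟩ := (Set.finite_range fun σ => ‖cycleWeight q S σ‖).bddAbove
  exact ⟨C, fun σ => hC ⟨σ, rfl⟩⟩

theorem summable_norm_walkWeight (q q' : ℕ → ℂ) {x : ℂ} {S : Finset (Fin d)}
    (h : ((S.card : ℝ) - 1) * ‖x‖ < 1) : Summable fun ω : Walk S => ‖walkWeight q q' x ω‖ := by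
  obtain ⟨C, hC⟩ := exists_norm_cycleWeight_le q S
  obtain ⟨C', hC'⟩ := exists_norm_cycleWeight_le q' S
  refine Summable.of_nonneg_of_le (fun _ => norm_nonneg _) (fun ω => ?_)
    ((summable_pow_walk S (norm_nonneg x) h).mul_right (C * C'))
  rw [walkWeight, norm_mul, norm_pow, norm_mul]
  gcongr
  · exact (norm_nonneg _).trans (hC 1)
  · exact hC _
  · exact hC' _

theorem walkSum_eq_tsum_word (q q' : ℕ → ℂ) {x : ℂ} {S : Finset (Fin d)}
    (h : ((S.card : ℝ) - 1) * ‖x‖ < 1) :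
    walkSum q q' x S = ∑' L : Word S, x ^ wordLength L.1 * ∑ τ ∈ permsOfFinset S,
      cycleWeight q S τ * cycleWeight q' S (τ * wordProd L.1) := by
  have hs : Summable fun ω : Word S × permsOfFinset S => walkWeight q q' x (ω.2, ω.1) :=
    (summable_norm_walkWeight q q' h).of_norm.comp_injective Prod.swap_injective
  rw [walkSum, ← (Equiv.prodComm (Word S) (permsOfFinset S)).tsum_eq]
  simp only [Equiv.prodComm_apply, Prod.swap]
  rw [hs.tsum_prod]
  refine tsum_congr fun L => ?_
  rw [tsum_fintype, Finset.mul_sum, ← Finset.sum_coe_sort (permsOfFinset S)]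
  rfl

theorem mem_permsOfFinset_iff_forall_notMem {S : Finset (Fin d)} {σ : Equiv.Perm (Fin d)} :
    σ ∈ permsOfFinset S ↔ ∀ k, k ∉ S → σ k = k := by
  rw [mem_perms_of_finset_iff]
  exact forall_congr' fun k => by rw [← not_imp_comm]

theorem support_subset_of_mem_permsOfFinset {S : Finset (Fin d)} {σ : Equiv.Perm (Fin d)}
    (h : σ ∈ permsOfFinset S) : σ.support ⊆ S := fun _ hk =>
  mem_perms_of_finset_iff.mp h (Equiv.Perm.mem_support.mp hk)

theorem mul_mem_permsOfFinset {S : Finset (Fin d)} {σ τ : Equiv.Perm (Fin d)}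
    (hσ : σ ∈ permsOfFinset S) (hτ : τ ∈ permsOfFinset S) : σ * τ ∈ permsOfFinset S := by
  rw [mem_permsOfFinset_iff_forall_notMem] at *
  intro k hk
  rw [Equiv.Perm.mul_apply, hτ k hk, hσ k hk]

theorem inv_mem_permsOfFinset {S : Finset (Fin d)} {σ : Equiv.Perm (Fin d)}
    (hσ : σ ∈ permsOfFinset S) : σ⁻¹ ∈ permsOfFinset S := by
  rw [mem_permsOfFinset_iff_forall_notMem] at *
  intro k hk
  rw [Equiv.Perm.inv_eq_iff_eq, hσ k hk]

theorem wordProd_mem_permsOfFinset {S : Finset (Fin d)} (L : Word S) :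
    wordProd L.1 ∈ permsOfFinset S :=
  mem_permsOfFinset_iff_forall_notMem.mpr fun _ hk => wordProd_apply_of_notMem L.2 hk

theorem Walk.finish_mem {S : Finset (Fin d)} (ω : Walk S) : ω.finish ∈ permsOfFinset S :=
  mul_mem_permsOfFinset ω.1.2 (wordProd_mem_permsOfFinset ω.2)

/-- A fixed point free form of the condition counted by `matchCount`. -/
theorem forall_mem_apply_iff {S : Finset (Fin d)} {τ π : Equiv.Perm (Fin d)}
    (hτ : τ ∈ permsOfFinset S) (hπ : π ∈ permsOfFinset S) (j : Fin d → Fin N) :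
    (∀ k ∈ S, j (π⁻¹ k) = j (τ k)) ↔ ∀ k, j ((τ * π) k) = j k := by
  constructor
  · intro h k
    by_cases hk : π k ∈ S
    · rw [Equiv.Perm.mul_apply, ← h _ hk]; simp
    · have h1 := mem_permsOfFinset_iff_forall_notMem.mp hπ _ hk
      rw [Equiv.Perm.mul_apply, mem_permsOfFinset_iff_forall_notMem.mp hτ _ hk, π.injective h1]
  · intro h k _
    have := h (π⁻¹ k)
    simpa using this.symm

theorem pow_card_mul_sum_moment {ι : Type*} [Fintype ι] (hN : N ≠ 0) {S : Finset (Fin d)}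
    (hS : S.card ≤ N) (c : ι → ℂ) (i j i' j' : ι → Fin d → Fin N) :
    (N : ℂ) ^ S.card * ∑ e, c e * moment S S (i e) (j e) (i' e) (j' e) =
      ∑' L : Word S, (-1 / N : ℂ) ^ wordLength L.1 *
        ∑ e, c e * matchCount S (i e) (j e ∘ ⇑(wordProd L.1)⁻¹) (i' e) (j' e) := by
  have hN' : (N : ℂ) ≠ 0 := Nat.cast_ne_zero.mpr hN
  have hsum : ∀ e, Summable fun L : Word S => (-1 / (N : ℂ)) ^ wordLength L.1 *
      (c e * matchCount S (i e) (j e ∘ ⇑(wordProd L.1)⁻¹) (i' e) (j' e)) := by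
    intro e
    refine summable_pow_wordLength_mul (card_sub_one_mul_norm_lt_one hS) (C := ‖c e‖ *
      (permsOfFinset S).card) fun L => ?_
    rw [norm_mul]
    gcongr
    exact norm_matchCount_le _ _ _ _ _
  simp only [Finset.mul_sum]
  rw [Summable.tsum_finsetSum fun e _ => hsum e]
  refine Finset.sum_congr rfl fun e _ => ?_
  rw [moment_eq_tsum S hS, mul_left_comm (c e), ← mul_assoc, ← mul_pow, mul_inv_cancel₀ hN',
    one_pow, one_mul, ← tsum_mul_left]
  exact tsum_congr fun L => mul_left_comm _ _ _

theorem forall_mem_apply_eq_iff {S : Finset (Fin d)} {τ : Equiv.Perm (Fin d)}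
    (hτ : τ ∈ permsOfFinset S) (i : Fin d → Fin N) :
    (∀ k ∈ S, i k = i (τ k)) ↔ ∀ k, i (τ k) = i k := by
  have := forall_mem_apply_iff hτ (mem_permsOfFinset_iff_forall_notMem.mpr
        fun k _ => Equiv.Perm.one_apply k) i
  simpa only [inv_one, Equiv.Perm.one_apply, mul_one] using this

/-- The moments of `Tr (A U B U⁻¹)`, with `A`, `B` diagonal, as sums over monotone walks. -/
theorem integral_trace_conj_pow (hN : N ≠ 0) (a b : Fin N → ℂ) {S : Finset (Fin d)}
    (hS : S.card ≤ N) :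
    (N : ℂ) ^ S.card * ∫ U : Matrix.unitaryGroup (Fin N) ℂ, (∑ p : Fin N × Fin N,
        a p.1 * b p.2 * ((U : Matrix (Fin N) (Fin N) ℂ) p.1 p.2 *
          star ((U : Matrix (Fin N) (Fin N) ℂ) p.1 p.2))) ^ S.card ∂haarUnitary N =
      walkSum (fun k => ∑ j, a j ^ k) (fun k => ∑ j, b j ^ k) (-1 / N) S := by
  have hN' : (N : ℂ) ≠ 0 := Nat.cast_ne_zero.mpr hN
  have hx := card_sub_one_mul_norm_lt_one hS
  rw [walkSum_eq_tsum_word _ _ hx]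
  have h1 : ∀ U : Matrix (Fin N) (Fin N) ℂ,
      (N : ℂ) ^ (2 * (d - S.card)) * (∑ p : Fin N × Fin N,
        a p.1 * b p.2 * (U p.1 p.2 * star (U p.1 p.2))) ^ S.card =
      ∑ e : (Fin d → Fin N) × (Fin d → Fin N), ((∏ k ∈ S, a (e.1 k)) * ∏ k ∈ S, b (e.2 k)) *
        entryMonomial S S e.1 e.2 e.1 e.2 U := by
    intro U
    have := sum_prod_mem_eq S fun p : Fin N × Fin N => a p.1 * b p.2 * (U p.1 p.2 * star (U p.1 p.2))
    rw [Fintype.card_prod, Fintype.card_fin, Nat.cast_mul, ← sq, ← pow_mul] at this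
    rw [← this, ← (Equiv.arrowProdEquivProdArrow (Fin d)
      (fun _ => Fin N) fun _ => Fin N).sum_comp]
    refine Finset.sum_congr rfl fun i _ => ?_
    simp only [Finset.prod_mul_distrib, entryMonomial]
    rfl
  have h2 : (N : ℂ) ^ (2 * (d - S.card)) * ∫ U : Matrix.unitaryGroup (Fin N) ℂ,
      (∑ p : Fin N × Fin N, a p.1 * b p.2 * ((U : Matrix (Fin N) (Fin N) ℂ) p.1 p.2 *
          star ((U : Matrix (Fin N) (Fin N) ℂ) p.1 p.2))) ^ S.card ∂haarUnitary N =
      ∑ e : (Fin d → Fin N) × (Fin d → Fin N), ((∏ k ∈ S, a (e.1 k)) * ∏ k ∈ S, b (e.2 k)) *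
        moment S S e.1 e.2 e.1 e.2 := by
    rw [← integral_const_mul]
    simp only [h1]
    rw [integral_finsetSum _ fun e _ => (integrable_entryMonomial _ _ _ _ _ _).const_mul _]
    exact Finset.sum_congr rfl fun e _ => integral_const_mul _ _
  refine mul_left_cancel₀ (pow_ne_zero (2 * (d - S.card)) hN') ?_
  rw [mul_left_comm, h2, pow_card_mul_sum_moment hN hS
    (fun e : (Fin d → Fin N) × (Fin d → Fin N) => (∏ k ∈ S, a (e.1 k)) * ∏ k ∈ S, b (e.2 k))
    (fun e => e.1) (fun e => e.2) (fun e => e.1) (fun e => e.2), ← tsum_mul_left]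
  refine tsum_congr fun L => ?_
  rw [mul_left_comm]
  congr 1
  simp only [matchCount, Finset.mul_sum]
  rw [Finset.sum_comm]
  refine Finset.sum_congr rfl fun τ hτ => ?_
  have e1 := colourSum_eq_cycleWeight hN a (support_subset_of_mem_permsOfFinset hτ)
  have e2 := colourSum_eq_cycleWeight hN b (support_subset_of_mem_permsOfFinset
    (mul_mem_permsOfFinset hτ (wordProd_mem_permsOfFinset L)))
  rw [two_mul, pow_add, mul_mul_mul_comm, ← e1, ← e2, colourSum, colourSum, Finset.sum_mul_sum,
    ← Fintype.sum_prod_type']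
  refine Finset.sum_congr rfl fun e _ => ?_
  simp only [Function.comp_apply, forall_and, forall_mem_apply_eq_iff hτ,
    forall_mem_apply_iff hτ (wordProd_mem_permsOfFinset L)]
  by_cases h1 : ∀ k, e.1 (τ k) = e.1 k <;>
    by_cases h2 : ∀ k, e.2 ((τ * wordProd L.1) k) = e.2 k <;>
    simp only [h1, h2, and_self, and_true, and_false, implies_true, if_true, if_false, mul_zero,
      zero_mul, mul_one]

/-- The weights of the trivial power sums `q 1 = N`, `q k = 0` for `k ≥ 2`. -/
noncomputable def unitPowerSum (N : ℕ) (k : ℕ) : ℂ := if k = 1 then N else 0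

theorem cycleWeight_unitPowerSum (S : Finset (Fin d)) (σ : Equiv.Perm (Fin d)) :
    cycleWeight (unitPowerSum N) S σ = if σ = 1 then (N : ℂ) ^ S.card else 0 := by
  split_ifs with h
  · simp [h, cycleWeight, unitPowerSum]
  · rw [cycleWeight]
    obtain ⟨n, hn⟩ := Multiset.exists_mem_of_ne_zero (mt Equiv.Perm.cycleType_eq_zero.mp h)
    have hn' := Equiv.Perm.one_lt_of_mem_cycleType hn
    rw [Multiset.prod_eq_zero, mul_zero]
    exact Multiset.mem_map.mpr ⟨n, hn, if_neg hn'.ne'⟩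

theorem cycleWeight_inv (q : ℕ → ℂ) (S : Finset (Fin d)) (σ : Equiv.Perm (Fin d)) :
    cycleWeight q S σ⁻¹ = cycleWeight q S σ := by
  rw [cycleWeight, cycleWeight, Equiv.Perm.support_inv, Equiv.Perm.cycleType_inv]

theorem walkSum_unitPowerSum (q : ℕ → ℂ) {x : ℂ} {S : Finset (Fin d)}
    (h : ((S.card : ℝ) - 1) * ‖x‖ < 1) :
    walkSum q (unitPowerSum N) x S =
      (N : ℂ) ^ S.card * ∑' L : Word S, x ^ wordLength L.1 * cycleWeight q S (wordProd L.1) := by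
  rw [walkSum_eq_tsum_word _ _ h, ← tsum_mul_left]
  refine tsum_congr fun L => ?_
  rw [mul_left_comm, Finset.sum_eq_single (wordProd L.1)⁻¹]
  · rw [inv_mul_cancel, cycleWeight_unitPowerSum, if_pos rfl, cycleWeight_inv]; ring
  · intro τ _ hτ
    rw [cycleWeight_unitPowerSum, if_neg, mul_zero]
    exact fun h => hτ (eq_inv_of_mul_eq_one_left h)
  · exact fun h => absurd (inv_mem_permsOfFinset (wordProd_mem_permsOfFinset L)) h

theorem sum_apply_eq_on_perm (S : Finset (Fin d)) (i : Fin d → Fin N) (τ : Equiv.Perm (Fin d)) :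
    ∑ i' : Fin d → Fin N, (if ∀ k ∈ S, i k = i' (τ k) then (1 : ℂ) else 0) =
      (N : ℂ) ^ (d - S.card) := by
  have h : ∀ i' : Fin d → Fin N, (if ∀ k ∈ S, i k = i' (τ k) then (1 : ℂ) else 0) =
      ∏ k ∈ S, if i k = (τ.arrowCongr (Equiv.refl (Fin N))).symm i' k then 1 else 0 := by
    intro i'
    rw [Finset.prod_ite_zero]
    simp
  simp only [h]
  rw [(τ.arrowCongr (Equiv.refl (Fin N))).symm.sum_comp fun i' : Fin d → Fin N =>
    ∏ k ∈ S, if i k = i' k then (1 : ℂ) else 0,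
    sum_prod_mem S fun k b => if i k = b then (1 : ℂ) else 0]
  simp

/-- The mixed moments of `Tr (A U)`, with `A` diagonal, and `Tr U⁻¹` as sums over monotone
walks. -/
theorem integral_trace_pow_mul (hN : N ≠ 0) (a : Fin N → ℂ) {S : Finset (Fin d)}
    (hS : S.card ≤ N) :
    (N : ℂ) ^ (2 * S.card) * ∫ U : Matrix.unitaryGroup (Fin N) ℂ,
        (∑ p, a p * (U : Matrix (Fin N) (Fin N) ℂ) p p) ^ S.card *
          (∑ p, star ((U : Matrix (Fin N) (Fin N) ℂ) p p)) ^ S.card ∂haarUnitary N =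
      (S.card.factorial : ℂ) * walkSum (fun k => ∑ j, a j ^ k) (unitPowerSum N) (-1 / N) S := by
  have hN' : (N : ℂ) ≠ 0 := Nat.cast_ne_zero.mpr hN
  have hx := card_sub_one_mul_norm_lt_one hS
  rw [walkSum_unitPowerSum _ hx]
  have h1 : ∀ U : Matrix (Fin N) (Fin N) ℂ,
      (N : ℂ) ^ (2 * (d - S.card)) * ((∑ p, a p * U p p) ^ S.card * (∑ p, star (U p p)) ^ S.card) =
      ∑ e : (Fin d → Fin N) × (Fin d → Fin N), (∏ k ∈ S, a (e.1 k)) *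
        entryMonomial S S e.1 e.1 e.2 e.2 U := by
    intro U
    have e1 := sum_prod_mem_eq S fun p : Fin N => a p * U p p
    have e2 := sum_prod_mem_eq S fun p : Fin N => star (U p p)
    rw [Fintype.card_fin] at e1 e2
    rw [two_mul, pow_add, mul_mul_mul_comm, ← e1, ← e2, Finset.sum_mul_sum,
      ← Fintype.sum_prod_type']
    refine Finset.sum_congr rfl fun i _ => ?_
    simp only [Finset.prod_mul_distrib, entryMonomial, mul_assoc]
  have h2 : (N : ℂ) ^ (2 * (d - S.card)) * ∫ U : Matrix.unitaryGroup (Fin N) ℂ,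
        (∑ p, a p * (U : Matrix (Fin N) (Fin N) ℂ) p p) ^ S.card *
          (∑ p, star ((U : Matrix (Fin N) (Fin N) ℂ) p p)) ^ S.card ∂haarUnitary N =
      ∑ e : (Fin d → Fin N) × (Fin d → Fin N), (∏ k ∈ S, a (e.1 k)) *
        moment S S e.1 e.1 e.2 e.2 := by
    rw [← integral_const_mul]
    simp only [h1]
    rw [integral_finsetSum _ fun e _ => (integrable_entryMonomial _ _ _ _ _ _).const_mul _]
    exact Finset.sum_congr rfl fun e _ => integral_const_mul _ _
  refine mul_left_cancel₀ (pow_ne_zero (2 * (d - S.card)) hN') ?_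
  rw [mul_left_comm, h2, two_mul, pow_add, mul_assoc, pow_card_mul_sum_moment hN hS
    (fun e : (Fin d → Fin N) × (Fin d → Fin N) => ∏ k ∈ S, a (e.1 k)) (fun e => e.1) (fun e => e.1)
    (fun e => e.2) (fun e => e.2),
    mul_left_comm (S.card.factorial : ℂ), mul_left_comm _ ((N : ℂ) ^ S.card)]
  congr 1
  rw [← tsum_mul_left, ← tsum_mul_left]
  refine tsum_congr fun L => ?_
  rw [← mul_assoc, mul_left_comm, ← cycleWeight_inv]
  congr 1
  simp only [matchCount, Finset.mul_sum]
  rw [Finset.sum_comm, mul_assoc, ← card_perms_of_finset, mul_left_comm, ← nsmul_eq_mul]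
  refine Finset.sum_eq_card_nsmul fun τ hτ => ?_
  have hP := inv_mem_permsOfFinset (wordProd_mem_permsOfFinset L)
  have e1 := colourSum_eq_cycleWeight hN a (support_subset_of_mem_permsOfFinset hP)
  rw [two_mul, pow_add, mul_assoc, ← e1, colourSum, Finset.mul_sum, Fintype.sum_prod_type]
  refine Finset.sum_congr rfl fun i _ => ?_
  simp only [← Finset.mul_sum]
  rw [← sum_apply_eq_on_perm S i τ]
  by_cases h : ∀ k, i ((wordProd L.1)⁻¹ k) = i k
  · rw [if_pos h, mul_comm]
    congr 1
    refine Finset.sum_congr rfl fun i' _ => ?_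
    simp only [Function.comp_apply, h, and_self]
  · rw [if_neg h, mul_zero, Finset.sum_eq_zero, mul_zero]
    intro i' _
    rw [if_neg]
    intro h'
    exact h ((forall_mem_apply_eq_iff hP i).mp fun k hk => (h' k hk).1.trans (h' k hk).2.symm)

theorem pow_mul_moment_of_injective (hN : N ≠ 0) {S : Finset (Fin d)} (hS : S.card ≤ N)
    {i : Fin d → Fin N} (hi : Function.Injective i) :
    (N : ℂ) ^ (3 * S.card) * moment S S i i i i =
      walkSum (unitPowerSum N) (unitPowerSum N) (-1 / N) S := by
  rw [walkSum_unitPowerSum _ (card_sub_one_mul_norm_lt_one hS)]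
  have h := pow_card_mul_sum_moment hN hS (fun _ : Unit => 1) (fun _ => i) (fun _ => i) (fun _ => i)
    (fun _ => i)
  simp only [Finset.univ_unique, one_mul, Finset.sum_const, Finset.card_singleton, one_smul] at h
  rw [show 3 * S.card = S.card + S.card + S.card by ring, pow_add, mul_assoc, h, pow_add, mul_assoc]
  congr 1
  rw [← tsum_mul_left]
  refine tsum_congr fun L => ?_
  rw [mul_left_comm]
  congr 1
  have hmem : (1 : Equiv.Perm (Fin d)) ∈ permsOfFinset S := mem_permsOfFinset_iff_forall_notMem.mpr
        fun k _ => Equiv.Perm.one_apply k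
  have hiff : ∀ τ ∈ permsOfFinset S, (∀ k ∈ S, i k = i (τ k) ∧
      (i ∘ ⇑(wordProd L.1)⁻¹) k = i (τ k)) ↔ τ = 1 ∧ wordProd L.1 = 1 := by
    intro τ hτ
    simp only [Function.comp_apply, forall_and]
    rw [forall_mem_apply_eq_iff hτ, forall_mem_apply_iff hτ (wordProd_mem_permsOfFinset L)]
    simp only [hi.eq_iff]
    constructor
    · rintro ⟨h1, h2⟩
      have h1 : τ = 1 := Equiv.ext h1
      subst h1
      exact ⟨rfl, Equiv.ext (by simpa using h2)⟩
    · rintro ⟨h1, h2⟩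
      simp [h1, h2]
  rw [matchCount, Finset.sum_congr rfl fun τ hτ => if_congr (hiff τ hτ) rfl rfl,
    Finset.sum_eq_single 1 (fun τ _ hτ => if_neg fun h => hτ h.1) fun h => absurd hmem h,
    cycleWeight_unitPowerSum]
  simp

end StrongCoupling

namespace StrongCoupling

variable {d : ℕ}

/-! ### The exponential formula for monotone walks -/

/-- The set `A` is a union of orbits of the group generated by `σ` and the letters of `L`. -/
def IsStable (σ : Equiv.Perm (Fin d)) (L : Fin d → List (Fin d)) (A : Finset (Fin d)) : Prop :=
  (∀ k, σ k ∈ A ↔ k ∈ A) ∧ ∀ t, ∀ s ∈ L t, s ∈ A ↔ t ∈ A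

/-- Transitivity on `T` of the group generated by `σ` and the letters of `L`. -/
def IsConnectedOn (σ : Equiv.Perm (Fin d)) (L : Fin d → List (Fin d)) (T : Finset (Fin d)) : Prop :=
  ∀ A ⊆ T, A.Nonempty → IsStable σ L A → A = T

/-- The part of `walkSum` contributed by the connected walks. -/
noncomputable def connectedSum (q q' : ℕ → ℂ) (x : ℂ) (S : Finset (Fin d)) : ℂ :=
  open Classical in
  ∑' ω : Walk S, if IsConnectedOn ω.1 ω.2.1 S then walkWeight q q' x ω else 0

theorem IsStable.sdiff {σ : Equiv.Perm (Fin d)} {L : Fin d → List (Fin d)} {A B : Finset (Fin d)}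
    (hA : IsStable σ L A) (hB : IsStable σ L B) : IsStable σ L (A \ B) := by
  refine ⟨fun k => ?_, fun t s hs => ?_⟩
  · rw [Finset.mem_sdiff, Finset.mem_sdiff, hA.1, hB.1]
  · rw [Finset.mem_sdiff, Finset.mem_sdiff, hA.2 t s hs, hB.2 t s hs]

theorem isStable_of_mem {S : Finset (Fin d)} {σ : Equiv.Perm (Fin d)} {L : Fin d → List (Fin d)}
    (hσ : σ ∈ permsOfFinset S) (hL : Admissible S L) : IsStable σ L S := by
  refine ⟨fun k => ?_, fun t s hs => iff_of_true (hL t s hs).2.1 (hL t s hs).1⟩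
  by_cases hk : σ k = k
  · rw [hk]
  · exact iff_of_true (mem_perms_of_finset_iff.mp hσ fun h => hk (σ.injective h))
      (mem_perms_of_finset_iff.mp hσ hk)

/-- Every point has exactly one orbit. -/
theorem existsUnique_isConnectedOn {S : Finset (Fin d)} {σ : Equiv.Perm (Fin d)}
    {L : Fin d → List (Fin d)} (hS : IsStable σ L S) {t : Fin d} (ht : t ∈ S) :
    ∃! T, (T ∈ S.powerset.filter (t ∈ ·)) ∧ IsStable σ L T ∧ IsConnectedOn σ L T := by
  classical
  set T : Finset (Fin d) := Finset.univ.filter fun k => ∀ A, IsStable σ L A → t ∈ A → k ∈ A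
    with hT
  have hmem : ∀ k, k ∈ T ↔ ∀ A, IsStable σ L A → t ∈ A → k ∈ A := fun k => by simp [hT]
  have htT : t ∈ T := (hmem t).mpr fun _ _ h => h
  have hTs : IsStable σ L T := by
    refine ⟨fun k => ?_, fun u s hs => ?_⟩
    · rw [hmem, hmem]
      exact forall_congr' fun A => forall_congr' fun hA => by rw [hA.1]
    · rw [hmem, hmem]
      exact forall_congr' fun A => forall_congr' fun hA => by rw [hA.2 u s hs]
  refine ⟨T, ⟨?_, hTs, ?_⟩, ?_⟩
  · rw [Finset.mem_filter, Finset.mem_powerset]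
    exact ⟨fun k hk => (hmem k).mp hk S hS ht, htT⟩
  · intro A hAT hne hA
    refine Finset.Subset.antisymm hAT fun k hk => ?_
    by_cases htA : t ∈ A
    · exact (hmem k).mp hk A hA htA
    · obtain ⟨a, ha⟩ := hne
      exact absurd ha (Finset.mem_sdiff.mp ((hmem a).mp (hAT ha) _ (hTs.sdiff hA)
        (Finset.mem_sdiff.mpr ⟨htT, htA⟩))).2
  · rintro T' ⟨hT', hs', hc'⟩
    rw [Finset.mem_filter] at hT'
    have hsub : T ⊆ T' := fun k hk => (hmem k).mp hk T' hs' hT'.2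
    exact (hc' T hsub ⟨t, htT⟩ hTs).symm

theorem commute_of_mem_permsOfFinset {T T' : Finset (Fin d)} (h : Disjoint T T')
    {σ τ : Equiv.Perm (Fin d)} (hσ : σ ∈ permsOfFinset T) (hτ : τ ∈ permsOfFinset T') :
    σ.Disjoint τ := fun k => by
  by_cases hk : k ∈ T
  · exact Or.inr (mem_permsOfFinset_iff_forall_notMem.mp hτ k (Finset.disjoint_left.mp h hk))
  · exact Or.inl (mem_permsOfFinset_iff_forall_notMem.mp hσ k hk)

theorem list_prod_map_mul_of_commute {α G : Type*} [Monoid G] (l : List α) (f g : α → G)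
    (h : ∀ a b, Commute (f a) (g b)) :
    (l.map fun a => f a * g a).prod = (l.map f).prod * (l.map g).prod := by
  induction l with
  | nil => simp
  | cons a l ih =>
    have hc : Commute (g a) (l.map f).prod := Commute.list_prod_right _ _ fun x hx => by
      obtain ⟨b, _, rfl⟩ := List.mem_map.mp hx
      exact (h b a).symm
    simp only [List.map_cons, List.prod_cons, ih]
    rw [mul_assoc, ← mul_assoc (g a), hc.eq, mul_assoc, mul_assoc]

theorem wordStep_mem_permsOfFinset {S : Finset (Fin d)} (L : Word S) (t : Fin d) :
    wordStep t (L.1 t) ∈ permsOfFinset S := by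
  rw [mem_permsOfFinset_iff_forall_notMem]
  intro k hk
  by_cases ht : t ∈ S
  · exact wordStep_apply_of_notMem (fun s hs => (L.2 t s hs).2.1) ht hk
  · rw [L.2.eq_nil ht, wordStep_nil, Equiv.Perm.one_apply]

theorem wordProd_append {T T' : Finset (Fin d)} (h : Disjoint T T') (L : Word T) (L' : Word T') :
    wordProd (fun t => L.1 t ++ L'.1 t) = wordProd L.1 * wordProd L'.1 := by
  unfold wordProd
  rw [← list_prod_map_mul_of_commute]
  · congr 2
    funext t
    simp [wordStep]
  · exact fun a b => (commute_of_mem_permsOfFinset h (wordStep_mem_permsOfFinset L a)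
      (wordStep_mem_permsOfFinset L' b)).commute

theorem wordLength_append (L L' : Fin d → List (Fin d)) :
    wordLength (fun t => L t ++ L' t) = wordLength L + wordLength L' := by
  simp [wordLength, Finset.sum_add_distrib]

theorem permsOfFinset_mono {S T : Finset (Fin d)} (h : S ⊆ T) :
    permsOfFinset S ⊆ permsOfFinset T := fun _ hσ =>
  mem_perms_of_finset_iff.mpr fun hx => h (mem_perms_of_finset_iff.mp hσ hx)

theorem cycleWeight_mul_of_disjoint (q : ℕ → ℂ) {S T : Finset (Fin d)} (hT : T ⊆ S)
    {σ τ : Equiv.Perm (Fin d)} (hσ : σ ∈ permsOfFinset T) (hτ : τ ∈ permsOfFinset (S \ T)) :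
    cycleWeight q S (σ * τ) = cycleWeight q T σ * cycleWeight q (S \ T) τ := by
  have hd := commute_of_mem_permsOfFinset Finset.disjoint_sdiff hσ hτ
  have h1 := Finset.card_le_card (support_subset_of_mem_permsOfFinset hσ)
  have h2 := Finset.card_le_card (support_subset_of_mem_permsOfFinset hτ)
  have h3 := Finset.card_sdiff_add_card_eq_card hT
  unfold cycleWeight
  rw [hd.cycleType_mul, hd.card_support_mul, Multiset.map_add, Multiset.prod_add,
    mul_mul_mul_comm, ← pow_add]
  congr 2
  omega

/-- The disjoint union of a walk on `T` and a walk on `S \ T`. -/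
def Walk.merge {S T : Finset (Fin d)} (hT : T ⊆ S) (p : Walk T × Walk (S \ T)) : Walk S :=
  (⟨p.1.1 * p.2.1, mul_mem_permsOfFinset (permsOfFinset_mono hT p.1.1.2)
      (permsOfFinset_mono Finset.sdiff_subset p.2.1.2)⟩,
    ⟨fun t => p.1.2.1 t ++ p.2.2.1 t, fun t s hs => by
      rcases List.mem_append.mp hs with hs | hs
      · exact (p.1.2.2.mono hT) t s hs
      · exact (p.2.2.2.mono Finset.sdiff_subset) t s hs⟩)

theorem Walk.finish_merge {S T : Finset (Fin d)} (hT : T ⊆ S) (p : Walk T × Walk (S \ T)) :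
    (Walk.merge hT p).finish = p.1.finish * p.2.finish := by
  have hc := (commute_of_mem_permsOfFinset Finset.disjoint_sdiff
    (wordProd_mem_permsOfFinset p.1.2) p.2.1.2).commute
  simp only [Walk.finish, Walk.merge]
  rw [wordProd_append Finset.disjoint_sdiff, mul_assoc, ← mul_assoc (p.2.1 : Equiv.Perm (Fin d)),
    ← hc.eq, mul_assoc, mul_assoc]

theorem walkWeight_merge (q q' : ℕ → ℂ) (x : ℂ) {S T : Finset (Fin d)} (hT : T ⊆ S)
    (p : Walk T × Walk (S \ T)) :
    walkWeight q q' x (Walk.merge hT p) = walkWeight q q' x p.1 * walkWeight q q' x p.2 := by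
  unfold walkWeight
  rw [Walk.finish_merge, cycleWeight_mul_of_disjoint q' hT p.1.finish_mem p.2.finish_mem]
  simp only [Walk.merge]
  rw [cycleWeight_mul_of_disjoint q hT p.1.1.2 p.2.1.2, wordLength_append, pow_add]
  ring

theorem isStable_merge_iff {S T A : Finset (Fin d)} (hT : T ⊆ S) (p : Walk T × Walk (S \ T))
    (hA : A ⊆ T) : IsStable (Walk.merge hT p).1 (Walk.merge hT p).2.1 A ↔
      IsStable p.1.1 p.1.2.1 A := by
  have h1 : ∀ k, ((p.1.1 : Equiv.Perm (Fin d)) * p.2.1) k ∈ A ↔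
      (p.1.1 : Equiv.Perm (Fin d)) k ∈ A := by
    intro k
    rw [Equiv.Perm.mul_apply]
    by_cases hk : k ∈ S \ T
    · have hk' := ((isStable_of_mem p.2.1.2 p.2.2.2).1 k).mpr hk
      rw [mem_permsOfFinset_iff_forall_notMem.mp p.1.1.2 _ (Finset.mem_sdiff.mp hk).2,
        mem_permsOfFinset_iff_forall_notMem.mp p.1.1.2 _ (Finset.mem_sdiff.mp hk').2]
      exact iff_of_false (fun h => (Finset.mem_sdiff.mp hk').2 (hA h))
        fun h => (Finset.mem_sdiff.mp hk).2 (hA h)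
    · rw [mem_permsOfFinset_iff_forall_notMem.mp p.2.1.2 _ hk]
  refine and_congr (forall_congr' fun k => by rw [← h1]; rfl) (forall_congr' fun t => ?_)
  constructor
  · exact fun h s hs => h s (List.mem_append_left _ hs)
  · intro h s hs
    rcases List.mem_append.mp hs with hs | hs
    · exact h s hs
    · have := p.2.2.2 t s hs
      exact iff_of_false (fun h => (Finset.mem_sdiff.mp this.2.1).2 (hA h))
        fun h => (Finset.mem_sdiff.mp this.1).2 (hA h)

theorem Walk.merge_injective {S T : Finset (Fin d)} (hT : T ⊆ S) :
    Function.Injective (Walk.merge hT) := by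
  rintro ⟨⟨⟨σ, hσ⟩, ⟨L, hL⟩⟩, ⟨⟨τ, hτ⟩, ⟨M, hM⟩⟩⟩ ⟨⟨⟨σ', hσ'⟩, ⟨L', hL'⟩⟩, ⟨⟨τ', hτ'⟩, ⟨M', hM'⟩⟩⟩ h
  simp only [Walk.merge, Prod.mk.injEq, Subtype.mk.injEq] at h
  obtain ⟨h1, h2⟩ := h
  replace h2 : (fun t => L t ++ M t) = fun t => L' t ++ M' t := congrArg Subtype.val h2
  have hτ1 := mem_permsOfFinset_iff_forall_notMem.mp hτ
  have hτ1' := mem_permsOfFinset_iff_forall_notMem.mp hτ'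
  have hσ1 := mem_permsOfFinset_iff_forall_notMem.mp hσ
  have hσ1' := mem_permsOfFinset_iff_forall_notMem.mp hσ'
  have e1 : σ = σ' := by
    ext k
    by_cases hk : k ∈ T
    · have hk' : k ∉ S \ T := fun h => (Finset.mem_sdiff.mp h).2 hk
      have := Equiv.congr_fun h1 k
      rw [Equiv.Perm.mul_apply, Equiv.Perm.mul_apply, hτ1 k hk', hτ1' k hk'] at this
      rw [this]
    · rw [hσ1 k hk, hσ1' k hk]
  subst e1
  have e2 : τ = τ' := mul_left_cancel h1
  have e3 : L = L' := by
    funext t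
    by_cases ht : t ∈ T
    · have ht' : t ∉ S \ T := fun h => (Finset.mem_sdiff.mp h).2 ht
      have := congrFun h2 t
      simpa [hM.eq_nil ht', hM'.eq_nil ht'] using this
    · rw [hL.eq_nil ht, hL'.eq_nil ht]
  subst e2 e3
  have e4 : M = M' := funext fun t => by simpa using congrFun h2 t
  subst e4
  rfl

theorem Walk.exists_merge_eq {S T : Finset (Fin d)} (hT : T ⊆ S) (ω : Walk S)
    (h : IsStable ω.1 ω.2.1 T) : ∃ p, Walk.merge hT p = ω := by
  classical
  obtain ⟨⟨σ, hσ⟩, ⟨L, hL⟩⟩ := ω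
  replace h : IsStable σ L T := h
  set σ₁ : Equiv.Perm (Fin d) := Equiv.Perm.ofSubtype (σ.subtypePerm (p := (· ∈ T)) h.1) with hσ₁
  have hσ₁T : ∀ k ∈ T, σ₁ k = σ k := fun k hk => by
    rw [hσ₁, Equiv.Perm.ofSubtype_apply_of_mem _ hk]; rfl
  have hσ₁m : σ₁ ∈ permsOfFinset T := mem_permsOfFinset_iff_forall_notMem.mpr fun k hk =>
    Equiv.Perm.ofSubtype_apply_of_not_mem _ hk
  have hσ₂m : σ₁⁻¹ * σ ∈ permsOfFinset (S \ T) := by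
    rw [mem_permsOfFinset_iff_forall_notMem]
    intro k hk
    rw [Equiv.Perm.mul_apply, Equiv.Perm.inv_eq_iff_eq]
    by_cases hkT : k ∈ T
    · exact (hσ₁T k hkT).symm
    · rw [mem_permsOfFinset_iff_forall_notMem.mp hσ₁m k hkT]
      exact mem_permsOfFinset_iff_forall_notMem.mp hσ k fun hkS =>
        hk (Finset.mem_sdiff.mpr ⟨hkS, hkT⟩)
  refine ⟨((⟨σ₁, hσ₁m⟩, ⟨fun t => if t ∈ T then L t else [], fun t s hs => ?_⟩),
    (⟨σ₁⁻¹ * σ, hσ₂m⟩, ⟨fun t => if t ∈ T then [] else L t, fun t s hs => ?_⟩)), ?_⟩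
  · beta_reduce at hs
    split_ifs at hs with ht
    · exact ⟨ht, (h.2 t s hs).mpr ht, (hL t s hs).2.2⟩
    · simp at hs
  · beta_reduce at hs
    split_ifs at hs with ht
    · simp at hs
    · exact ⟨Finset.mem_sdiff.mpr ⟨(hL t s hs).1, ht⟩,
        Finset.mem_sdiff.mpr ⟨(hL t s hs).2.1, fun hsT => ht ((h.2 t s hs).mp hsT)⟩,
        (hL t s hs).2.2⟩
  · simp only [Walk.merge, mul_inv_cancel_left]
    refine Prod.ext rfl (Subtype.ext (funext fun t => ?_))
    dsimp only
    split_ifs <;> simp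

theorem connectedSum_mul_walkSum (q q' : ℕ → ℂ) {x : ℂ} {S T : Finset (Fin d)} (hT : T ⊆ S)
    (h : ((S.card : ℝ) - 1) * ‖x‖ < 1) :
    open Classical in
    ∑' ω : Walk S, (if IsStable ω.1 ω.2.1 T ∧ IsConnectedOn ω.1 ω.2.1 T then walkWeight q q' x ω
      else 0) = connectedSum q q' x T * walkSum q q' x (S \ T) := by
  classical
  have hle : ∀ {T' : Finset (Fin d)}, T' ⊆ S → ((T'.card : ℝ) - 1) * ‖x‖ < 1 := fun hT' =>
    lt_of_le_of_lt (mul_le_mul_of_nonneg_right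
      (sub_le_sub_right (Nat.cast_le.mpr (Finset.card_le_card hT')) 1) (norm_nonneg x)) h
  have hs : Summable fun ω : Walk T =>
      ‖if IsConnectedOn ω.1 ω.2.1 T then walkWeight q q' x ω else 0‖ := by
    refine Summable.of_nonneg_of_le (fun _ => norm_nonneg _) (fun ω => ?_)
      (summable_norm_walkWeight q q' (hle hT))
    split_ifs <;> simp
  rw [connectedSum, walkSum, tsum_mul_tsum_of_summable_norm hs
    (summable_norm_walkWeight q q' (hle Finset.sdiff_subset)),
    ← (Walk.merge_injective hT).tsum_eq]
  · refine tsum_congr fun p => ?_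
    have h1 : (IsStable (Walk.merge hT p).1 (Walk.merge hT p).2.1 T ∧
        IsConnectedOn (Walk.merge hT p).1 (Walk.merge hT p).2.1 T) ↔
          IsConnectedOn p.1.1 p.1.2.1 T := by
      rw [isStable_merge_iff hT p (Finset.Subset.refl T),
        and_iff_right (isStable_of_mem p.1.1.2 p.1.2.2)]
      exact forall_congr' fun A => forall_congr' fun hA => by rw [isStable_merge_iff hT p hA]
    rw [if_congr h1 rfl rfl, walkWeight_merge, ite_mul, zero_mul]
  · intro ω hω
    have : IsStable ω.1 ω.2.1 T := by
      by_contra hn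
      exact hω (if_neg fun h => hn h.1)
    exact Walk.exists_merge_eq hT ω this

/-- The exponential formula: a walk decomposes into the connected component of `t` and a walk on
the complement. -/
theorem walkSum_eq_sum_connectedSum (q q' : ℕ → ℂ) {x : ℂ} {S : Finset (Fin d)}
    (h : ((S.card : ℝ) - 1) * ‖x‖ < 1) {t : Fin d} (ht : t ∈ S) :
    walkSum q q' x S =
      ∑ T ∈ S.powerset.filter (t ∈ ·), connectedSum q q' x T * walkSum q q' x (S \ T) := by
  classical
  have h1 : ∀ ω : Walk S, walkWeight q q' x ω = ∑ T ∈ S.powerset.filter (t ∈ ·),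
      if IsStable ω.1 ω.2.1 T ∧ IsConnectedOn ω.1 ω.2.1 T then walkWeight q q' x ω else 0 := by
    intro ω
    obtain ⟨T, ⟨hT, hsc⟩, huniq⟩ := existsUnique_isConnectedOn (isStable_of_mem ω.1.2 ω.2.2) ht
    rw [Finset.sum_eq_single T, if_pos hsc]
    · exact fun T' hT' hne => if_neg fun hc => hne (huniq T' ⟨hT', hc⟩)
    · exact fun hn => absurd hT hn
  rw [walkSum, tsum_congr h1, Summable.tsum_finsetSum]
  · exact Finset.sum_congr rfl fun T hT => connectedSum_mul_walkSum q q'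
      (Finset.mem_powerset.mp (Finset.mem_filter.mp hT).1) h
  · intro T _
    refine Summable.of_norm_bounded (summable_norm_walkWeight q q' h) fun ω => ?_
    split_ifs <;> simp

end StrongCoupling

namespace StrongCoupling
open MeasureTheory

/-! ### Maclaurin coefficients -/

/-- Near `0`, the function `f` is the sum of the exponential generating series of `c`. -/
def HasMaclaurin (f : ℂ → ℂ) (c : ℕ → ℂ) : Prop :=
  ∀ᶠ z in nhds (0 : ℂ), HasSum (fun n => z ^ n / (n.factorial : ℂ) * c n) (f z)

theorem HasMaclaurin.hasFPowerSeriesAt {f : ℂ → ℂ} {c : ℕ → ℂ} (h : HasMaclaurin f c) :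
    HasFPowerSeriesAt f (FormalMultilinearSeries.ofScalars ℂ fun n => c n / n.factorial) 0 := by
  rw [hasFPowerSeriesAt_iff]
  filter_upwards [h] with z hz
  rw [zero_add]
  refine hz.congr_fun fun n => ?_
  rw [FormalMultilinearSeries.coeff_ofScalars, smul_eq_mul]
  ring

theorem HasMaclaurin.analyticAt {f : ℂ → ℂ} {c : ℕ → ℂ} (h : HasMaclaurin f c) :
    AnalyticAt ℂ f 0 := h.hasFPowerSeriesAt.analyticAt

theorem HasMaclaurin.iteratedDeriv_eq {f : ℂ → ℂ} {c : ℕ → ℂ} (h : HasMaclaurin f c) (n : ℕ) :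
    iteratedDeriv n f 0 = c n := by
  have h1 := congrArg (fun p => p.coeff n)
    (h.analyticAt.hasFPowerSeriesAt.eq_formalMultilinearSeries h.hasFPowerSeriesAt)
  simp only [FormalMultilinearSeries.coeff_ofScalars] at h1
  exact (div_left_inj' (Nat.cast_ne_zero.mpr n.factorial_ne_zero)).mp h1

theorem HasMaclaurin.analyticAt_log {f : ℂ → ℂ} {c : ℕ → ℂ} (h : HasMaclaurin f c) (h0 : c 0 = 1) :
    AnalyticAt ℂ (fun z => Complex.log (f z)) 0 := by
  refine h.analyticAt.clog ?_
  have := h.iteratedDeriv_eq 0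
  rw [iteratedDeriv_zero, h0] at this
  rw [this]
  exact Complex.one_mem_slitPlane

/-- The relation between moments and cumulants. -/
theorem HasMaclaurin.coeff_succ {f : ℂ → ℂ} {c : ℕ → ℂ} (h : HasMaclaurin f c) (h0 : c 0 = 1)
    (n : ℕ) : c (n + 1) = ∑ k ∈ Finset.range (n + 1), (n.choose k : ℂ) *
      iteratedDeriv (k + 1) (fun z => Complex.log (f z)) 0 * c (n - k) := by
  have hf := h.analyticAt
  have hf0 : f 0 = 1 := by
    have := h.iteratedDeriv_eq 0
    rwa [iteratedDeriv_zero, h0] at this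
  have hF := h.analyticAt_log h0
  have hev : deriv f =ᶠ[nhds 0] deriv (fun z => Complex.log (f z)) * f := by
    have hs : ∀ᶠ z in nhds (0 : ℂ), f z ∈ Complex.slitPlane :=
      hf.continuousAt.eventually_mem (Complex.isOpen_slitPlane.mem_nhds
        (by rw [hf0]; exact Complex.one_mem_slitPlane))
    filter_upwards [hs, hf.eventually_analyticAt] with z hz hz'
    rw [Pi.mul_apply, (hz'.differentiableAt.hasDerivAt.clog hz).deriv,
      div_mul_cancel₀ _ (Complex.slitPlane_ne_zero hz)]
  rw [← h.iteratedDeriv_eq, iteratedDeriv_succ', hev.iteratedDeriv_eq,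
    iteratedDeriv_mul hF.deriv.contDiffAt hf.contDiffAt]
  refine Finset.sum_congr rfl fun k _ => ?_
  rw [h.iteratedDeriv_eq, ← iteratedDeriv_succ']

theorem sum_powerset_filter_mem_card {d : ℕ} {M : Type*} [AddCommMonoid M] {t : Fin d}
    {S : Finset (Fin d)} (ht : t ∈ S)
    (g : ℕ → M) : ∑ T ∈ S.powerset.filter (t ∈ ·), g T.card =
      ∑ k ∈ Finset.range S.card, (S.card - 1).choose k • g (k + 1) := by
  have h1 : ∑ T ∈ S.powerset.filter (t ∈ ·), g T.card =
      ∑ T ∈ (S.erase t).powerset, g (T.card + 1) := by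
    refine Finset.sum_nbij' (fun T => T.erase t) (fun T => insert t T) ?_ ?_ ?_ ?_ ?_
    · intro T hT
      simp only [Finset.mem_filter, Finset.mem_powerset] at hT ⊢
      exact Finset.erase_subset_erase t hT.1
    · intro T hT
      simp only [Finset.mem_filter, Finset.mem_powerset] at hT ⊢
      exact ⟨Finset.insert_subset ht (hT.trans (Finset.erase_subset _ _)),
        Finset.mem_insert_self _ _⟩
    · intro T hT
      exact Finset.insert_erase (Finset.mem_filter.mp hT).2
    · intro T hT
      exact Finset.erase_insert fun h => Finset.notMem_erase t S (Finset.mem_powerset.mp hT h)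
    · intro T hT
      rw [Finset.card_erase_add_one (Finset.mem_filter.mp hT).2]
  rw [h1, Finset.sum_powerset_apply_card fun n => g (n + 1), Finset.card_erase_of_mem ht,
    Nat.sub_add_cancel (Finset.card_pos.mpr ⟨t, ht⟩)]

/-- If the walk sums are Maclaurin coefficients of `f`, then the sums over connected walks are
those of `log f`. -/
theorem iteratedDeriv_log_eq_connectedSum {d : ℕ} {f : ℂ → ℂ} {c : ℕ → ℂ} (h : HasMaclaurin f c)
    (h0 : c 0 = 1) {q q' : ℕ → ℂ} {x : ℂ} (hx : ((d : ℝ) - 1) * ‖x‖ < 1)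
    (hc : ∀ S : Finset (Fin d), walkSum q q' x S = c S.card) (S : Finset (Fin d))
    (hS : S.Nonempty) :
    iteratedDeriv S.card (fun z => Complex.log (f z)) 0 = connectedSum q q' x S := by
  induction S using Finset.strongInduction with
  | H S ih =>
    obtain ⟨t, ht⟩ := hS
    have hcard : S.card ≤ d := by simpa using Finset.card_le_univ S
    have hx' : ((S.card : ℝ) - 1) * ‖x‖ < 1 := lt_of_le_of_lt (mul_le_mul_of_nonneg_right
      (sub_le_sub_right (Nat.cast_le.mpr hcard) 1) (norm_nonneg x)) hx
    have h1 := walkSum_eq_sum_connectedSum q q' hx' ht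
    have hpos : 0 < S.card := Finset.card_pos.mpr ⟨t, ht⟩
    have h2 := h.coeff_succ h0 (S.card - 1)
    rw [Nat.sub_add_cancel hpos] at h2
    have h3 := sum_powerset_filter_mem_card ht fun k =>
      iteratedDeriv k (fun z => Complex.log (f z)) 0 * c (S.card - k)
    have h4 : c S.card = ∑ T ∈ S.powerset.filter (t ∈ ·),
        iteratedDeriv T.card (fun z => Complex.log (f z)) 0 * c (S.card - T.card) := by
      rw [h3, h2]
      refine Finset.sum_congr rfl fun k _ => ?_
      rw [nsmul_eq_mul, mul_assoc, Nat.sub_sub, Nat.add_comm 1 k]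
    rw [hc, h4] at h1
    have hmem : S ∈ S.powerset.filter (t ∈ ·) := by simp [ht]
    rw [← Finset.add_sum_erase _ _ hmem, ← Finset.add_sum_erase _ _ hmem,
      Finset.sum_congr rfl fun T hT => ?_] at h1
    · have h5 := add_right_cancel h1
      simpa [hc, h0] using h5
    · rw [Finset.mem_erase, Finset.mem_filter, Finset.mem_powerset] at hT
      rw [ih T (hT.2.1.ssubset_of_ne hT.1) ⟨t, hT.2.2⟩, hc, Finset.card_sdiff_of_subset hT.2.1]

/-! ### Maclaurin series of the matrix integrals -/

variable {N : ℕ}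

theorem hasSum_integral_exp {f : Matrix.unitaryGroup (Fin N) ℂ → ℂ} (hf : Continuous f) (w : ℂ) :
    HasSum (fun n : ℕ => w ^ n / (n.factorial : ℂ) * ∫ U, f U ^ n ∂haarUnitary N)
      (∫ U, Complex.exp (w * f U) ∂haarUnitary N) := by
  obtain ⟨C, hC⟩ := exists_norm_le_of_continuous hf
  have h := hasSum_integral_of_summable_integral_norm (μ := haarUnitary N)
    (F := fun (n : ℕ) U => (w * f U) ^ n / (n.factorial : ℂ))
    (fun n => integrable_of_continuous (((continuous_const.mul hf).pow n).div_const _)) (by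
      refine Summable.of_nonneg_of_le (fun n => integral_nonneg fun _ => norm_nonneg _) (fun n => ?_)
        (Real.summable_pow_div_factorial (‖w‖ * C))
      have : ∀ U, ‖(w * f U) ^ n / (n.factorial : ℂ)‖ ≤ (‖w‖ * C) ^ n / n.factorial := by
        intro U
        rw [norm_div, norm_pow, norm_mul, Complex.norm_natCast]
        gcongr
        exact hC U
      refine (integral_mono_of_nonneg (Filter.Eventually.of_forall fun _ => norm_nonneg _)
        (integrable_const _) (Filter.Eventually.of_forall this)).trans ?_
      simp)
  have h1 : ∀ U, ∑' n : ℕ, (w * f U) ^ n / (n.factorial : ℂ) = Complex.exp (w * f U) := by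
    intro U
    rw [Complex.exp_eq_exp_ℂ]
    exact (NormedSpace.expSeries_div_hasSum_exp (w * f U)).tsum_eq
  simp only [h1] at h
  refine h.congr_fun fun n => ?_
  rw [← integral_const_mul]
  congr 1
  funext U
  rw [mul_pow]; ring

theorem coe_inv_unitaryGroup (U : Matrix.unitaryGroup (Fin N) ℂ) :
    ((U⁻¹ : Matrix.unitaryGroup (Fin N) ℂ) : Matrix (Fin N) (Fin N) ℂ) =
      star (U : Matrix (Fin N) (Fin N) ℂ) := rfl

theorem trace_diagonal_conj (a b : Fin N → ℂ) (U : Matrix (Fin N) (Fin N) ℂ) :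
    Matrix.trace (Matrix.diagonal a * U * Matrix.diagonal b * star U) =
      ∑ p : Fin N × Fin N, a p.1 * b p.2 * (U p.1 p.2 * star (U p.1 p.2)) := by
  rw [Fintype.sum_prod_type, Matrix.trace]
  refine Finset.sum_congr rfl fun i _ => ?_
  rw [Matrix.diag_apply, Matrix.mul_apply]
  refine Finset.sum_congr rfl fun j _ => ?_
  rw [Matrix.mul_diagonal, Matrix.diagonal_mul, Matrix.star_apply]
  ring

theorem hasMaclaurin_hciz (a b : Fin N → ℂ) :
    HasMaclaurin (hcizIntegral N (Matrix.diagonal a) (Matrix.diagonal b)) fun n =>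
      (N : ℂ) ^ n * ∫ U : Matrix.unitaryGroup (Fin N) ℂ, (∑ p : Fin N × Fin N,
        a p.1 * b p.2 * ((U : Matrix (Fin N) (Fin N) ℂ) p.1 p.2 *
          star ((U : Matrix (Fin N) (Fin N) ℂ) p.1 p.2))) ^ n ∂haarUnitary N := by
  refine Filter.Eventually.of_forall fun z => ?_
  have hf : Continuous fun U : Matrix.unitaryGroup (Fin N) ℂ => ∑ p : Fin N × Fin N,
        a p.1 * b p.2 * ((U : Matrix (Fin N) (Fin N) ℂ) p.1 p.2 *
          star ((U : Matrix (Fin N) (Fin N) ℂ) p.1 p.2)) :=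
    continuous_finsetSum _ fun p _ => continuous_const.mul
      ((continuous_unitaryGroup_apply _ _).mul (continuous_unitaryGroup_apply _ _).star)
  have h := hasSum_integral_exp hf (z * N)
  unfold hcizIntegral
  simp only [coe_inv_unitaryGroup, trace_diagonal_conj]
  refine h.congr_fun fun n => ?_
  rw [mul_pow]; ring

theorem integral_trace_pow_mul_eq_zero (a : Fin N → ℂ) {m n : ℕ} (hmn : m ≠ n) :
    ∫ U : Matrix.unitaryGroup (Fin N) ℂ, (∑ p, a p * (U : Matrix (Fin N) (Fin N) ℂ) p p) ^ m *
      (∑ p, star ((U : Matrix (Fin N) (Fin N) ℂ) p p)) ^ n ∂haarUnitary N = 0 := by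
  have hmn' : (m : ℂ) - n ≠ 0 := sub_ne_zero.mpr (Nat.cast_injective.ne hmn)
  set θ : ℝ := Real.pi / ((m : ℝ) - n) with hθ
  set ζ : ℂ := Complex.exp (θ * Complex.I) with hζ
  have hζs : star ζ = Complex.exp (-(θ * Complex.I)) := by
    rw [hζ, Complex.star_def, ← Complex.exp_conj]
    simp
  have hζ1 : ζ * star ζ = 1 := by rw [hζs, hζ, ← Complex.exp_add]; simp
  have hζ2 : ζ ^ m * star ζ ^ n = -1 := by
    rw [hζs, hζ, ← Complex.exp_nat_mul, ← Complex.exp_nat_mul, ← Complex.exp_add,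
      show (m : ℂ) * (θ * Complex.I) + n * -(θ * Complex.I) = Real.pi * Complex.I by
        rw [hθ]; push_cast; field_simp; ring]
    exact Complex.exp_pi_mul_I
  have hV : ζ • (1 : Matrix (Fin N) (Fin N) ℂ) ∈ Matrix.unitaryGroup (Fin N) ℂ := by
    rw [Matrix.mem_unitaryGroup_iff, star_smul, star_one, smul_mul_smul_comm, hζ1]
    simp
  have h := integral_mul_left_eq_self (μ := haarUnitary N)
    (fun U : Matrix.unitaryGroup (Fin N) ℂ => (∑ p, a p * (U : Matrix (Fin N) (Fin N) ℂ) p p) ^ m *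
      (∑ p, star ((U : Matrix (Fin N) (Fin N) ℂ) p p)) ^ n) ⟨_, hV⟩
  have h' : ∀ U : Matrix.unitaryGroup (Fin N) ℂ,
      (∑ p, a p * ((⟨_, hV⟩ * U : Matrix.unitaryGroup (Fin N) ℂ) : Matrix (Fin N) (Fin N) ℂ) p p) ^ m *
      (∑ p, star (((⟨_, hV⟩ * U : Matrix.unitaryGroup (Fin N) ℂ) : Matrix (Fin N) (Fin N) ℂ) p p)) ^ n =
      -((∑ p, a p * (U : Matrix (Fin N) (Fin N) ℂ) p p) ^ m *
        (∑ p, star ((U : Matrix (Fin N) (Fin N) ℂ) p p)) ^ n) := by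
    intro U
    simp only [Submonoid.coe_mul, Matrix.smul_mul, one_mul, Matrix.smul_apply, smul_eq_mul,
      star_mul', mul_left_comm _ ζ, ← Finset.mul_sum, mul_pow]
    rw [mul_mul_mul_comm, hζ2, neg_one_mul]
  simp only [h', integral_neg] at h
  exact self_eq_neg.mp h.symm

theorem hasMaclaurin_bgw (a : Fin N → ℂ) :
    HasMaclaurin (bgwIntegral N (Matrix.diagonal a) 1) fun n =>
      (N : ℂ) ^ (2 * n) / n.factorial * ∫ U : Matrix.unitaryGroup (Fin N) ℂ,
        (∑ p, a p * (U : Matrix (Fin N) (Fin N) ℂ) p p) ^ n *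
          (∑ p, star ((U : Matrix (Fin N) (Fin N) ℂ) p p)) ^ n ∂haarUnitary N := by
  refine Filter.Eventually.of_forall fun z => ?_
  set X : Matrix.unitaryGroup (Fin N) ℂ → ℂ := fun U =>
    ∑ p, a p * (U : Matrix (Fin N) (Fin N) ℂ) p p with hX
  set Y : Matrix.unitaryGroup (Fin N) ℂ → ℂ := fun U =>
    ∑ p, star ((U : Matrix (Fin N) (Fin N) ℂ) p p) with hY
  have hXc : Continuous X :=
    continuous_finsetSum _ fun p _ => continuous_const.mul (continuous_unitaryGroup_apply _ _)
  have hYc : Continuous Y :=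
    continuous_finsetSum _ fun p _ => (continuous_unitaryGroup_apply _ _).star
  set w : ℂ := z ^ (1 / 2 : ℂ) with hw
  have hw2 : w ^ 2 = z := by
    have := Complex.cpow_nat_inv_pow z two_ne_zero
    rwa [show ((2 : ℕ) : ℂ)⁻¹ = 1 / 2 by norm_num] at this
  have h := hasSum_integral_exp (hXc.add hYc) (w * N)
  have hbin : ∀ n : ℕ, ∫ U, (X U + Y U) ^ n ∂haarUnitary N =
      ∑ k ∈ Finset.range (n + 1), (n.choose k : ℂ) * ∫ U, X U ^ k * Y U ^ (n - k) ∂haarUnitary N := by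
    intro n
    simp only [add_pow]
    rw [integral_finsetSum _ fun k _ => integrable_of_continuous (by fun_prop)]
    refine Finset.sum_congr rfl fun k _ => ?_
    rw [← integral_const_mul]
    congr 1
    funext U
    ring
  have hodd : ∀ n ∉ Set.range fun n : ℕ => 2 * n, (w * N) ^ n / (n.factorial : ℂ) *
      ∫ U, (X U + Y U) ^ n ∂haarUnitary N = 0 := by
    intro n hn
    rw [hbin, Finset.sum_eq_zero, mul_zero]
    intro k hk
    rw [integral_trace_pow_mul_eq_zero a, mul_zero]
    intro hkn
    exact hn ⟨k, by have := Finset.mem_range.mp hk; simp only; omega⟩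
  have h2 := ((mul_right_injective₀ (two_ne_zero' ℕ)).hasSum_iff hodd).mpr h
  have htr : ∀ U : Matrix.unitaryGroup (Fin N) ℂ, Matrix.trace (Matrix.diagonal a *
      (U : Matrix (Fin N) (Fin N) ℂ) + 1 *
        ((U⁻¹ : Matrix.unitaryGroup (Fin N) ℂ) : Matrix (Fin N) (Fin N) ℂ)) = X U + Y U := by
    intro U
    rw [one_mul, Matrix.trace_add, coe_inv_unitaryGroup]
    simp [hX, hY, Matrix.trace]
  unfold bgwIntegral
  simp only [htr]
  refine h2.congr_fun fun n => ?_
  rw [Function.comp_apply, hbin, Finset.sum_eq_single n]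
  · rw [show 2 * n - n = n by omega, mul_pow, pow_mul w, hw2]
    have hc : ((2 * n).choose n : ℂ) * n.factorial * n.factorial = (2 * n).factorial := by
      have := Nat.choose_mul_factorial_mul_factorial (n := 2 * n) (k := n) (by omega)
      rw [show 2 * n - n = n by omega] at this
      exact_mod_cast this
    have h1 : ((2 * n).factorial : ℂ) ≠ 0 := Nat.cast_ne_zero.mpr (Nat.factorial_ne_zero _)
    have h3 : (n.factorial : ℂ) ≠ 0 := Nat.cast_ne_zero.mpr (Nat.factorial_ne_zero _)
    have h5 : ((2 * n).choose n : ℂ) = (2 * n).factorial / (n.factorial * n.factorial) := by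
      rw [eq_div_iff (mul_ne_zero h3 h3), ← hc, mul_assoc]
    rw [h5]
    field_simp
    rfl
  · intro k hk hkn
    rw [integral_trace_pow_mul_eq_zero a, mul_zero]
    have := Finset.mem_range.mp hk
    omega
  · intro hn
    exact absurd (Finset.mem_range.mpr (by omega)) hn

end StrongCoupling

namespace StrongCoupling

variable {d : ℕ}

/-! ### The Riemann-Hurwitz inequality and parity -/

theorem finrank_le_finrank_inf_ker_add_one {K V : Type*} [Field K] [AddCommGroup V] [Module K V]
    [FiniteDimensional K V] (W : Submodule K V) (φ : V →ₗ[K] K) :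
    Module.finrank K W ≤ Module.finrank K ↥(W ⊓ LinearMap.ker φ) + 1 := by
  have h := LinearMap.finrank_range_add_finrank_ker (φ.domRestrict W)
  have h1 : Module.finrank K (LinearMap.range (φ.domRestrict W)) ≤ 1 :=
    (Submodule.finrank_le _).trans (Module.finrank_self K).le
  have h2 : Module.finrank K (LinearMap.ker (φ.domRestrict W)) =
      Module.finrank K ↥(W ⊓ LinearMap.ker φ) := by
    rw [← Submodule.finrank_map_subtype_eq W (LinearMap.ker (φ.domRestrict W))]
    rw [LinearMap.ker_domRestrict, Submodule.map_comap_subtype]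
  omega

/-- The functions with values in `ZMod 2` that are invariant under `π`. -/
def invariants (π : Equiv.Perm (Fin d)) : Submodule (ZMod 2) (Fin d → ZMod 2) where
  carrier := {f | ∀ k, f (π k) = f k}
  add_mem' hf hg k := by rw [Pi.add_apply, Pi.add_apply, hf k, hg k]
  zero_mem' _ := rfl
  smul_mem' c f hf k := by rw [Pi.smul_apply, Pi.smul_apply, hf k]

/-- The functions with values in `ZMod 2` that are invariant under `π` and the transpositions
in `w`. -/
def jointInvariants (π : Equiv.Perm (Fin d)) (w : List (Fin d × Fin d)) :
    Submodule (ZMod 2) (Fin d → ZMod 2) where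
  carrier := {f | (∀ k, f (π k) = f k) ∧ ∀ p ∈ w, f p.1 = f p.2}
  add_mem' hf hg := ⟨fun k => by rw [Pi.add_apply, Pi.add_apply, hf.1 k, hg.1 k],
    fun p hp => by rw [Pi.add_apply, Pi.add_apply, hf.2 p hp, hg.2 p hp]⟩
  zero_mem' := ⟨fun _ => rfl, fun _ _ => rfl⟩
  smul_mem' c f hf := ⟨fun k => by rw [Pi.smul_apply, Pi.smul_apply, hf.1 k],
    fun p hp => by rw [Pi.smul_apply, Pi.smul_apply, hf.2 p hp]⟩

/-- The product of the transpositions in a list. -/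
def swapProd (w : List (Fin d × Fin d)) : Equiv.Perm (Fin d) :=
  (w.map fun p => Equiv.swap p.1 p.2).prod

theorem swapProd_append (w w' : List (Fin d × Fin d)) :
    swapProd (w ++ w') = swapProd w * swapProd w' := by
  simp [swapProd]

theorem swapProd_singleton (p : Fin d × Fin d) : swapProd [p] = Equiv.swap p.1 p.2 := by
  simp [swapProd]

theorem apply_swapProd {f : Fin d → ZMod 2} {w : List (Fin d × Fin d)}
    (hf : ∀ p ∈ w, f p.1 = f p.2) (k : Fin d) : f (swapProd w k) = f k := by
  induction w generalizing k with
  | nil => rfl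
  | cons p w ih =>
    have hp := hf p (by simp)
    rw [← List.singleton_append, swapProd_append, swapProd_singleton, Equiv.Perm.mul_apply]
    rw [← ih (fun q hq => hf q (by simp [hq])) k]
    generalize swapProd w k = j
    by_cases h1 : j = p.1
    · rw [h1, Equiv.swap_apply_left, hp]
    by_cases h2 : j = p.2
    · rw [h2, Equiv.swap_apply_right, hp]
    rw [Equiv.swap_apply_of_ne_of_ne h1 h2]

theorem jointInvariants_le (π : Equiv.Perm (Fin d)) (w : List (Fin d × Fin d)) :
    jointInvariants π w ≤ invariants (π * swapProd w) := by
  rintro f ⟨h1, h2⟩ k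
  rw [Equiv.Perm.mul_apply, h1, apply_swapProd h2]

theorem invariants_mul_swap_inf_le (π : Equiv.Perm (Fin d)) {a b : Fin d} {g : Fin d → ZMod 2}
    (hg : g ∈ invariants (π * Equiv.swap a b)) (hab : g a = g b) : g ∈ invariants π := by
  intro k
  have h := hg (Equiv.swap a b k)
  rw [Equiv.Perm.mul_apply, Equiv.swap_apply_self] at h
  rw [h]
  by_cases h1 : k = a
  · rw [h1, Equiv.swap_apply_left, hab]
  by_cases h2 : k = b
  · rw [h2, Equiv.swap_apply_right, hab]
  rw [Equiv.swap_apply_of_ne_of_ne h1 h2]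

theorem apply_eq_of_mem_invariants_mul_swap {π : Equiv.Perm (Fin d)} {a b : Fin d} (hne : a ≠ b)
    {f g : Fin d → ZMod 2} (hf : f ∈ invariants π) (hfab : f a ≠ f b)
    (hg : g ∈ invariants (π * Equiv.swap a b)) : g a = g b := by
  have h1 : ∑ k, f k * (g (π (Equiv.swap a b k)) - g (π k)) = 0 := by
    have e1 : ∑ k, f k * g (π k) = ∑ k, f k * g k := by
      rw [← Equiv.sum_comp π fun k => f k * g k]
      exact Finset.sum_congr rfl fun k _ => by rw [hf k]
    simp only [mul_sub, Finset.sum_sub_distrib]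
    rw [e1, sub_eq_zero]
    exact Finset.sum_congr rfl fun k _ => by rw [← Equiv.Perm.mul_apply, hg k]
  have h2 : ∑ k, f k * (g (π (Equiv.swap a b k)) - g (π k)) =
      (f a - f b) * (g (π b) - g (π a)) := by
    rw [← Finset.sum_subset (Finset.subset_univ {a, b}), Finset.sum_pair hne,
      Equiv.swap_apply_left, Equiv.swap_apply_right]
    · ring
    · intro k _ hk
      simp only [Finset.mem_insert, Finset.mem_singleton, not_or] at hk
      rw [Equiv.swap_apply_of_ne_of_ne hk.1 hk.2, sub_self, mul_zero]
  rw [h2] at h1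
  have h3 : g (π b) = g (π a) := sub_eq_zero.mp
    ((mul_eq_zero.mp h1).resolve_left (sub_ne_zero.mpr hfab))
  have ha := hg a
  have hb := hg b
  rw [Equiv.Perm.mul_apply, Equiv.swap_apply_left] at ha
  rw [Equiv.Perm.mul_apply, Equiv.swap_apply_right] at hb
  rw [← ha, ← hb, h3]

theorem finrank_invariants_mul_swapProd_le (σ : Equiv.Perm (Fin d)) {w : List (Fin d × Fin d)}
    (hw : ∀ p ∈ w, p.1 ≠ p.2) :
    Module.finrank (ZMod 2) (invariants (σ * swapProd w)) + Module.finrank (ZMod 2) (invariants σ) ≤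
      w.length + 2 * Module.finrank (ZMod 2) (jointInvariants σ w) := by
  induction w using List.reverseRecOn with
  | nil =>
    have : jointInvariants σ [] = invariants σ := by
      ext f
      exact ⟨fun h => h.1, fun h => ⟨h, fun p hp => by simp at hp⟩⟩
    have h1 : σ * swapProd [] = σ := mul_one σ
    rw [this, h1, List.length_nil]
    omega
  | append_singleton w p ih =>
    obtain ⟨a, b⟩ := p
    have hne : a ≠ b := hw (a, b) (by simp)
    specialize ih fun q hq => hw q (by simp [hq])
    rw [swapProd_append, swapProd_singleton, ← mul_assoc, List.length_append, List.length_singleton]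
    set π := σ * swapProd w with hπ
    set φ : (Fin d → ZMod 2) →ₗ[ZMod 2] ZMod 2 := 
      LinearMap.proj (R := ZMod 2) (φ := fun _ : Fin d => ZMod 2) a - LinearMap.proj b with hφ
    have hφ' : ∀ f, f ∈ LinearMap.ker φ ↔ f a = f b := fun f => by
      rw [LinearMap.mem_ker, hφ, LinearMap.sub_apply, sub_eq_zero]
      rfl
    have hJ : jointInvariants σ (w ++ [(a, b)]) = jointInvariants σ w ⊓ LinearMap.ker φ := by
      ext f
      rw [Submodule.mem_inf, hφ']
      constructor
      · intro h
        exact ⟨⟨h.1, fun q hq => h.2 q (by simp [hq])⟩, h.2 (a, b) (by simp)⟩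
      · rintro ⟨⟨h1, h2⟩, h3⟩
        refine ⟨h1, fun q hq => ?_⟩
        rcases List.mem_append.mp hq with hq | hq
        · exact h2 q hq
        · rw [List.mem_singleton] at hq
          rw [hq]
          exact h3
    by_cases hcase : ∀ f ∈ jointInvariants σ w, f a = f b
    · have h1 : jointInvariants σ w ⊓ LinearMap.ker φ = jointInvariants σ w :=
        inf_eq_left.mpr fun f hf => (hφ' f).mpr (hcase f hf)
      have h2 := finrank_le_finrank_inf_ker_add_one (invariants (π * Equiv.swap a b)) φ
      have h3 : invariants (π * Equiv.swap a b) ⊓ LinearMap.ker φ ≤ invariants π :=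
        fun g hg => invariants_mul_swap_inf_le π hg.1 ((hφ' g).mp hg.2)
      have h4 := Submodule.finrank_mono h3
      rw [hJ, h1]
      dsimp only
      omega
    · push Not at hcase
      obtain ⟨f, hf, hfab⟩ := hcase
      have hfπ : f ∈ invariants π := jointInvariants_le σ w hf
      have h2 := finrank_le_finrank_inf_ker_add_one (jointInvariants σ w) φ
      have h3 : invariants (π * Equiv.swap a b) < invariants π := by
        refine lt_of_le_of_ne (fun g hg => invariants_mul_swap_inf_le π hg
          (apply_eq_of_mem_invariants_mul_swap hne hfπ hfab hg)) fun h => hfab ?_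
        exact apply_eq_of_mem_invariants_mul_swap hne hfπ hfab (h ▸ hfπ)
      have h4 := Submodule.finrank_lt_finrank_of_lt h3
      rw [hJ]
      dsimp only
      omega

theorem cycleWeight_univ (q : ℕ → ℂ) (σ : Equiv.Perm (Fin d)) :
    cycleWeight q Finset.univ σ = (σ.partition.parts.map q).prod := by
  rw [Equiv.Perm.parts_partition, Multiset.map_add, Multiset.prod_add, Multiset.map_replicate,
    Multiset.prod_replicate, cycleWeight, Finset.card_univ, mul_comm]

theorem finrank_invariants (σ : Equiv.Perm (Fin d)) :
    Module.finrank (ZMod 2) (invariants σ) = σ.partition.parts.card := by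
  classical
  have h1 : colourSum (fun _ : Fin 2 => 1) Finset.univ σ = 2 ^ σ.partition.parts.card := by
    rw [colourSum_eq_cycleWeight two_ne_zero _ (Finset.subset_univ _), cycleWeight_univ]
    simp
  have h2 : colourSum (fun _ : Fin 2 => 1) Finset.univ σ =
      (Fintype.card (invariants σ) : ℂ) := by
    have : Fintype.card (invariants σ) =
        (Finset.univ.filter fun f : Fin d → Fin 2 => ∀ k, f (σ k) = f k).card :=
      Fintype.card_of_subtype (Finset.univ.filter fun f : Fin d → ZMod 2 => ∀ k, f (σ k) = f k)
        fun f => by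
          rw [Finset.mem_filter]
          exact ⟨fun h => h.2, fun h => ⟨Finset.mem_univ _, h⟩⟩
    rw [this, colourSum, Finset.card_filter]
    push_cast
    simp
  rw [h2, Module.card_eq_pow_finrank (K := ZMod 2), ZMod.card] at h1
  exact Nat.pow_right_injective le_rfl (by exact_mod_cast h1)

theorem neg_one_pow_card_parts (σ : Equiv.Perm (Fin d)) :
    ((-1) ^ (d + σ.partition.parts.card) : ℤˣ) = Equiv.Perm.sign σ := by
  have h := σ.partition.parts_sum
  rw [Equiv.Perm.sign_of_cycleType, Equiv.Perm.parts_partition, Multiset.card_add,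
    Multiset.card_replicate]
  have hs : σ.cycleType.sum = σ.support.card := σ.sum_cycleType
  have hle : σ.support.card ≤ d := by simpa using Finset.card_le_univ σ.support
  rw [hs, Fintype.card_fin]
  have : d + (σ.cycleType.card + (d - σ.support.card)) =
      2 * (d - σ.support.card) + (σ.support.card + σ.cycleType.card) := by omega
  rw [this, pow_add, pow_mul]
  simp

/-! ### Words as lists of transpositions -/

/-- The list of the transpositions of the word `L`. -/
def wordPairs (L : Fin d → List (Fin d)) : List (Fin d × Fin d) :=
  (List.finRange d).flatMap fun t => (L t).map fun s => (s, t)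

theorem mem_wordPairs {L : Fin d → List (Fin d)} {p : Fin d × Fin d} :
    p ∈ wordPairs L ↔ p.1 ∈ L p.2 := by
  simp only [wordPairs, List.mem_flatMap, List.mem_finRange, true_and, List.mem_map]
  constructor
  · rintro ⟨t, s, hs, rfl⟩
    exact hs
  · exact fun h => ⟨p.2, p.1, h, rfl⟩

theorem length_wordPairs (L : Fin d → List (Fin d)) : (wordPairs L).length = wordLength L := by
  simp only [wordPairs, List.length_flatMap, List.length_map, wordLength]
  rw [← List.ofFn_eq_map, List.sum_ofFn]

theorem swapProd_wordPairs (L : Fin d → List (Fin d)) : swapProd (wordPairs L) = wordProd L := by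
  rw [swapProd, wordPairs, wordProd, List.map_flatMap]
  generalize List.finRange d = m
  induction m with
  | nil => rfl
  | cons t m ih =>
    rw [List.flatMap_cons, List.prod_append, ih, List.map_cons, List.prod_cons, wordStep,
      List.map_map]
    rfl

theorem pairwise_wordPairs (L : Fin d → List (Fin d)) :
    (wordPairs L).Pairwise fun p p' => p.2 ≤ p'.2 := by
  have h := List.pairwise_lt_finRange d
  rw [wordPairs]
  generalize List.finRange d = m at h ⊢
  induction m with
  | nil => exact List.Pairwise.nil
  | cons t m ih =>
    rw [List.pairwise_cons] at h
    rw [List.flatMap_cons, List.pairwise_append]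
    refine ⟨?_, ih h.2, ?_⟩
    · rw [List.pairwise_map]
      exact List.pairwise_of_forall fun _ _ => le_rfl
    · intro p hp p' hp'
      obtain ⟨s, -, rfl⟩ := List.mem_map.mp hp
      obtain ⟨u, hu, hp'⟩ := List.mem_flatMap.mp hp'
      obtain ⟨s', -, rfl⟩ := List.mem_map.mp hp'
      exact (h.1 u hu).le

/-- The word with a given list of transpositions. -/
def wordOfPairs (l : List (Fin d × Fin d)) (t : Fin d) : List (Fin d) :=
  (l.filter fun p => p.2 = t).map Prod.fst

theorem mem_wordOfPairs {l : List (Fin d × Fin d)} {s t : Fin d} :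
    s ∈ wordOfPairs l t ↔ (s, t) ∈ l := by
  simp only [wordOfPairs, List.mem_map, List.mem_filter, decide_eq_true_eq]
  constructor
  · rintro ⟨⟨a, b⟩, ⟨h, rfl⟩, rfl⟩
    exact h
  · exact fun h => ⟨(s, t), ⟨h, rfl⟩, rfl⟩

theorem wordOfPairs_wordPairs (L : Fin d → List (Fin d)) : wordOfPairs (wordPairs L) = L := by
  funext t
  have h := List.nodup_finRange d
  have ht := List.mem_finRange t
  rw [wordOfPairs, wordPairs]
  generalize List.finRange d = m at h ht
  induction m with
  | nil => simp at ht
  | cons u m ih =>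
    rw [List.nodup_cons] at h
    rw [List.flatMap_cons, List.filter_append, List.map_append]
    by_cases hut : u = t
    · subst hut
      have h1 : ((L u).map fun s => (s, u)).filter (fun p => p.2 = u) =
          (L u).map fun s => (s, u) :=
        List.filter_eq_self.mpr fun p hp => by
          obtain ⟨s, -, rfl⟩ := List.mem_map.mp hp
          simp
      have h2 : (m.flatMap fun t => (L t).map fun s => (s, t)).filter (fun p => p.2 = u) = [] :=
        List.filter_eq_nil_iff.mpr fun p hp => by
          obtain ⟨v, hv, hp⟩ := List.mem_flatMap.mp hp
          obtain ⟨s, -, rfl⟩ := List.mem_map.mp hp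
          simp only [decide_eq_true_eq]
          rintro rfl
          exact h.1 hv
      rw [h1, h2, List.map_map]
      simp [Function.comp_def]
    · have h1 : ((L u).map fun s => (s, u)).filter (fun p => p.2 = t) = [] :=
        List.filter_eq_nil_iff.mpr fun p hp => by
          obtain ⟨s, -, rfl⟩ := List.mem_map.mp hp
          simpa using hut
      rw [h1, ih h.2 ((List.mem_cons.mp ht).resolve_left (Ne.symm hut))]
      simp

theorem eq_filter_append_filter {l : List (Fin d × Fin d)} {u : Fin d}
    (hl : l.Pairwise fun p p' => p.2 ≤ p'.2) (hu : ∀ p ∈ l, u ≤ p.2) :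
    l = l.filter (fun p => p.2 = u) ++ l.filter (fun p => p.2 ≠ u) := by
  induction l with
  | nil => rfl
  | cons p l ih =>
    rw [List.pairwise_cons] at hl
    by_cases hp : p.2 = u
    · rw [List.filter_cons_of_pos (by simpa using hp), List.filter_cons_of_neg (by simpa using hp),
        List.cons_append, ← ih hl.2 fun p' hp' => hu p' (by simp [hp'])]
    · have h1 : ∀ p' ∈ p :: l, p'.2 ≠ u := by
        intro p' hp'
        rcases List.mem_cons.mp hp' with rfl | hp'
        · exact hp
        · exact ((lt_of_le_of_ne (hu p (by simp)) (Ne.symm hp)).trans_le (hl.1 p' hp')).ne'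
      have h2 : (p :: l).filter (fun p => p.2 = u) = [] :=
        List.filter_eq_nil_iff.mpr fun p' hp' => by simpa using h1 p' hp'
      have h3 : (p :: l).filter (fun p => p.2 ≠ u) = p :: l :=
        List.filter_eq_self.mpr fun p' hp' => by simpa using h1 p' hp'
      rw [h2, h3, List.nil_append]

theorem flatMap_filter_eq {m : List (Fin d)} (hm : m.Pairwise (· < ·)) {l : List (Fin d × Fin d)}
    (hl : l.Pairwise fun p p' => p.2 ≤ p'.2) (hlm : ∀ p ∈ l, p.2 ∈ m) :
    (m.flatMap fun t => l.filter fun p => p.2 = t) = l := by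
  induction m generalizing l with
  | nil => exact (List.eq_nil_iff_forall_not_mem.mpr fun p hp => by simpa using hlm p hp).symm
  | cons u m ih =>
    rw [List.pairwise_cons] at hm
    have hu : ∀ p ∈ l, u ≤ p.2 := fun p hp => by
      rcases List.mem_cons.mp (hlm p hp) with h | h
      · exact h.ge
      · exact (hm.1 _ h).le
    have h1 : (m.flatMap fun t => l.filter fun p => p.2 = t) =
        m.flatMap fun t => (l.filter fun p => p.2 ≠ u).filter fun p => p.2 = t := by
      refine List.flatMap_congr fun t ht => ?_
      rw [List.filter_filter]
      refine List.filter_congr fun p _ => ?_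
      by_cases hpt : p.2 = t
      · simp [hpt, (hm.1 t ht).ne']
      · simp [hpt]
    rw [List.flatMap_cons, h1, ih hm.2 (hl.filter _), ← eq_filter_append_filter hl hu]
    intro p hp
    rw [List.mem_filter] at hp
    exact (List.mem_cons.mp (hlm p hp.1)).resolve_left (by simpa using hp.2)

theorem wordPairs_wordOfPairs {l : List (Fin d × Fin d)}
    (hl : l.Pairwise fun p p' => p.2 ≤ p'.2) : wordPairs (wordOfPairs l) = l := by
  have : ∀ t, ((wordOfPairs l t).map fun s => (s, t)) = l.filter fun p => p.2 = t := by
    intro t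
    rw [wordOfPairs, List.map_map]
    refine (List.map_congr_left fun p hp => ?_).trans (List.map_id _)
    rw [List.mem_filter] at hp
    have h2 : p.2 = t := by simpa using hp.2
    simp [← h2]
  simp only [wordPairs, this]
  exact flatMap_filter_eq (List.pairwise_lt_finRange d) hl fun p _ => List.mem_finRange _

/-! ### The genus of a connected walk -/

theorem finrank_jointInvariants_le_one {σ : Equiv.Perm (Fin d)} {L : Fin d → List (Fin d)}
    (h : IsConnectedOn σ L Finset.univ) :
    Module.finrank (ZMod 2) (jointInvariants σ (wordPairs L)) ≤ 1 := by
  classical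
  have hle : jointInvariants σ (wordPairs L) ≤ Submodule.span (ZMod 2) {(1 : Fin d → ZMod 2)} := by
    intro f hf
    have hs : IsStable σ L (Finset.univ.filter fun k => f k = 1) := by
      refine ⟨fun k => ?_, fun t s hs => ?_⟩
      · rw [Finset.mem_filter, Finset.mem_filter, hf.1 k]
        simp
      · rw [Finset.mem_filter, Finset.mem_filter, hf.2 (s, t) (mem_wordPairs.mpr hs)]
        simp
    rw [Submodule.mem_span_singleton]
    rcases Finset.eq_empty_or_nonempty (Finset.univ.filter fun k => f k = 1) with he | hne
    · refine ⟨0, funext fun k => ?_⟩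
      have hk : k ∉ Finset.univ.filter fun k => f k = 1 := he ▸ Finset.notMem_empty k
      rw [Finset.mem_filter, not_and] at hk
      have hk := hk (Finset.mem_univ k)
      rw [Pi.smul_apply, zero_smul]
      generalize f k = y at hk
      revert y
      decide
    · have ha := h _ (Finset.subset_univ _) hne hs
      refine ⟨1, funext fun k => ?_⟩
      have hk := Finset.mem_univ k
      rw [← ha, Finset.mem_filter] at hk
      rw [one_smul, Pi.one_apply, hk.2]
  exact (Submodule.finrank_mono hle).trans ((finrank_span_le_card _).trans (by simp))

theorem sign_wordProd {L : Fin d → List (Fin d)} (hL : ∀ p ∈ wordPairs L, p.1 ≠ p.2) :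
    Equiv.Perm.sign (wordProd L) = (-1) ^ wordLength L := by
  rw [← swapProd_wordPairs, ← length_wordPairs]
  generalize wordPairs L = l at hL
  induction l with
  | nil => simp [swapProd]
  | cons p l ih =>
    rw [← List.singleton_append, swapProd_append, swapProd_singleton, Equiv.Perm.sign_mul,
      Equiv.Perm.sign_swap (hL p (by simp)), ih fun q hq => hL q (by simp [hq]), List.length_append,
      List.length_singleton, pow_add, pow_one]

/-- The Riemann-Hurwitz formula. -/
theorem exists_genus (ω : Walk (Finset.univ : Finset (Fin d)))
    (h : IsConnectedOn ω.1 ω.2.1 Finset.univ) :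
    ∃ g : ℕ, wordLength ω.2.1 + 2 = 2 * g + (ω.1 : Equiv.Perm (Fin d)).partition.parts.card +
      ω.finish.partition.parts.card := by
  have hne : ∀ p ∈ wordPairs ω.2.1, p.1 ≠ p.2 := fun p hp =>
    (ω.2.2 p.2 p.1 (mem_wordPairs.mp hp)).2.2.ne
  have h1 := finrank_invariants_mul_swapProd_le (ω.1 : Equiv.Perm (Fin d)) hne
  rw [finrank_invariants, finrank_invariants, swapProd_wordPairs, length_wordPairs] at h1
  have h2 := finrank_jointInvariants_le_one h
  have h3 : ((-1) ^ (d + ω.finish.partition.parts.card) : ℤˣ) =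
      (-1) ^ (d + (ω.1 : Equiv.Perm (Fin d)).partition.parts.card + wordLength ω.2.1) := by
    rw [neg_one_pow_card_parts, Walk.finish, Equiv.Perm.sign_mul, pow_add (-1 : ℤˣ) (d + _),
      neg_one_pow_card_parts, sign_wordProd hne]
  have h4 : Even (d + ω.finish.partition.parts.card +
      (d + (ω.1 : Equiv.Perm (Fin d)).partition.parts.card + wordLength ω.2.1)) := by
    rw [← neg_one_pow_eq_one_iff_even (R := ℤˣ) (by decide), pow_add, h3, ← pow_add,
      Even.neg_one_pow ⟨_, rfl⟩]
  have h5 : (ω.1 * wordProd ω.2.1 : Equiv.Perm (Fin d)) = ω.finish := rfl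
  rw [h5] at h1
  obtain ⟨c, hc⟩ := h4
  refine ⟨(wordLength ω.2.1 + 2 - ω.finish.partition.parts.card -
    (ω.1 : Equiv.Perm (Fin d)).partition.parts.card) / 2, ?_⟩
  omega

/-! ### Monotone walks as words -/

theorem isPretransitive_closure_iff {σ : Equiv.Perm (Fin d)} {L : Fin d → List (Fin d)}
    {G : Set (Equiv.Perm (Fin d))} (hG : ∀ τ, τ ∈ G ↔ ∃ t, ∃ s ∈ L t, Equiv.swap s t = τ) :
    MulAction.IsPretransitive (Subgroup.closure (insert σ G)) (Fin d) ↔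
      IsConnectedOn σ L Finset.univ := by
  classical
  constructor
  · intro h A _ hne hA
    have hinv : ∀ τ ∈ Subgroup.closure (insert σ G), ∀ k, τ k ∈ A ↔ k ∈ A := by
      intro τ hτ
      induction hτ using Subgroup.closure_induction with
      | mem τ hτ =>
        rcases hτ with rfl | hτ
        · exact hA.1
        · obtain ⟨t, s, hs, rfl⟩ := (hG τ).mp hτ
          intro k
          by_cases h1 : k = s
          · rw [h1, Equiv.swap_apply_left, hA.2 t s hs]
          by_cases h2 : k = t
          · rw [h2, Equiv.swap_apply_right, hA.2 t s hs]
          rw [Equiv.swap_apply_of_ne_of_ne h1 h2]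
      | one => exact fun k => Iff.rfl
      | mul τ τ' _ _ ih ih' => exact fun k => by rw [Equiv.Perm.mul_apply, ih, ih']
      | inv τ _ ih => exact fun k => by rw [← ih]; simp
    obtain ⟨a, ha⟩ := hne
    refine Finset.eq_univ_iff_forall.mpr fun k => ?_
    obtain ⟨⟨τ, hτ⟩, hk⟩ := h.exists_smul_eq a k
    rw [← hk]
    exact (hinv τ hτ a).mpr ha
  · intro h
    refine ⟨fun a b => ?_⟩
    have key := h (Finset.univ.filter fun k => ∃ τ ∈ Subgroup.closure (insert σ G), τ a = k)
      (Finset.subset_univ _) ⟨a, by simpa using ⟨1, Subgroup.one_mem _, rfl⟩⟩ ?_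
    · have hb := Finset.mem_univ b
      rw [← key, Finset.mem_filter] at hb
      obtain ⟨τ, hτ, hb⟩ := hb.2
      exact ⟨⟨τ, hτ⟩, hb⟩
    · have hmem : ∀ π ∈ Subgroup.closure (insert σ G), ∀ k,
          (π k ∈ Finset.univ.filter fun k => ∃ τ ∈ Subgroup.closure (insert σ G), τ a = k) ↔
          k ∈ Finset.univ.filter fun k => ∃ τ ∈ Subgroup.closure (insert σ G), τ a = k := by
        intro π hπ k
        simp only [Finset.mem_filter, Finset.mem_univ, true_and]
        constructor
        · rintro ⟨τ, hτ, hk⟩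
          exact ⟨π⁻¹ * τ, mul_mem (inv_mem hπ) hτ, by simp [hk]⟩
        · rintro ⟨τ, hτ, hk⟩
          exact ⟨π * τ, mul_mem hπ hτ, by simp [hk]⟩
      refine ⟨hmem σ (Subgroup.subset_closure (Set.mem_insert _ _)), fun t s hs => ?_⟩
      have := hmem (Equiv.swap s t) (Subgroup.subset_closure
        (Set.mem_insert_of_mem _ ((hG _).mpr ⟨t, s, hs, rfl⟩))) t
      rwa [Equiv.swap_apply_right] at this

namespace MonotoneWalk

variable {r : ℕ}

def pairs (w : MonotoneWalk d r) : List (Fin d × Fin d) := List.ofFn fun i => (w.small i, w.large i)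

theorem pairwise_pairs (w : MonotoneWalk d r) : w.pairs.Pairwise fun p p' => p.2 ≤ p'.2 :=
  List.pairwise_ofFn.mpr fun _ _ h => w.monotone_large h.le

/-- The walk described by a word. -/
def toWalk (w : MonotoneWalk d r) : Walk (Finset.univ : Finset (Fin d)) :=
  (⟨w.start, mem_permsOfFinset_iff_forall_notMem.mpr fun k hk => absurd (Finset.mem_univ k) hk⟩,
    ⟨wordOfPairs w.pairs, fun t s hs => ⟨Finset.mem_univ _, Finset.mem_univ _, by
      obtain ⟨i, hi⟩ := (List.mem_ofFn' _ _).mp (mem_wordOfPairs.mp hs)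
      rw [← (Prod.mk.inj hi).1, ← (Prod.mk.inj hi).2]
      exact w.small_lt_large i⟩⟩)

theorem finish_toWalk (w : MonotoneWalk d r) : w.toWalk.finish = w.finish := by
  have : wordProd (wordOfPairs w.pairs) = (List.ofFn w.step).prod := by
    rw [← swapProd_wordPairs, wordPairs_wordOfPairs w.pairwise_pairs, swapProd, pairs, List.map_ofFn]
    rfl
  exact congrArg (w.start * ·) this

theorem wordLength_toWalk (w : MonotoneWalk d r) : wordLength w.toWalk.2.1 = r := by
  have : wordLength (wordOfPairs w.pairs) = r := by
    rw [← length_wordPairs, wordPairs_wordOfPairs w.pairwise_pairs, pairs, List.length_ofFn]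
  exact this

theorem isConnectedOn_toWalk (w : MonotoneWalk d r) :
    IsConnectedOn w.toWalk.1 w.toWalk.2.1 Finset.univ ↔ w.Connected := by
  refine (isPretransitive_closure_iff fun τ => ?_).symm
  constructor
  · rintro ⟨i, rfl⟩
    exact ⟨w.large i, w.small i, mem_wordOfPairs.mpr ((List.mem_ofFn' _ _).mpr ⟨i, rfl⟩), rfl⟩
  · rintro ⟨t, s, hs, rfl⟩
    obtain ⟨i, hi⟩ := (List.mem_ofFn' _ _).mp (mem_wordOfPairs.mp hs)
    refine ⟨i, ?_⟩
    rw [← (Prod.mk.inj hi).1, ← (Prod.mk.inj hi).2]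
    rfl

theorem toWalk_injective : Function.Injective (toWalk : MonotoneWalk d r → _) := by
  intro w w' h
  have h1 : w.start = w'.start := congrArg (fun ω => (ω.1 : Equiv.Perm (Fin d))) h
  have h2 : wordOfPairs w.pairs = wordOfPairs w'.pairs := congrArg (fun ω => ω.2.1) h
  have h3 : w.pairs = w'.pairs := by
    rw [← wordPairs_wordOfPairs w.pairwise_pairs, h2, wordPairs_wordOfPairs w'.pairwise_pairs]
  have h4 := List.ofFn_injective h3
  obtain ⟨σ, a, b, _, _⟩ := w
  obtain ⟨σ', a', b', _, _⟩ := w'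
  obtain rfl : σ = σ' := h1
  obtain rfl : a = a' := funext fun i => congrArg Prod.fst (congrFun h4 i)
  obtain rfl : b = b' := funext fun i => congrArg Prod.snd (congrFun h4 i)
  rfl

theorem exists_toWalk_eq (ω : Walk (Finset.univ : Finset (Fin d))) (h : wordLength ω.2.1 = r) :
    ∃ w : MonotoneWalk d r, w.toWalk = ω := by
  rw [← length_wordPairs] at h
  subst h
  refine ⟨⟨ω.1, fun i => ((wordPairs ω.2.1).get i).1, fun i => ((wordPairs ω.2.1).get i).2,
    fun i => (ω.2.2 _ _ (mem_wordPairs.mp (List.get_mem _ i))).2.2, fun i j hij => ?_⟩, ?_⟩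
  · rcases hij.eq_or_lt with rfl | hij
    · exact le_rfl
    · exact List.pairwise_iff_get.mp (pairwise_wordPairs ω.2.1) i j hij
  · refine Prod.ext (Subtype.ext rfl) (Subtype.ext ?_)
    have : wordOfPairs (List.ofFn (wordPairs ω.2.1).get) = ω.2.1 := by
      rw [List.ofFn_get, wordOfPairs_wordPairs]
    exact this

end MonotoneWalk

theorem connectedWalkCount_eq_card (r : ℕ) (α β : Nat.Partition d) :
    connectedWalkCount r α β = Nat.card {ω : Walk (Finset.univ : Finset (Fin d)) //
      IsConnectedOn ω.1 ω.2.1 Finset.univ ∧ wordLength ω.2.1 = r ∧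
        (ω.1 : Equiv.Perm (Fin d)).partition.parts = α.parts ∧
        ω.finish.partition.parts = β.parts} := by
  refine Nat.card_congr (Equiv.ofBijective
    (fun w => ⟨w.1.toWalk, w.1.isConnectedOn_toWalk.mpr w.2.2.2, w.1.wordLength_toWalk, w.2.1, ?_⟩)
    ⟨fun w w' h => Subtype.ext (MonotoneWalk.toWalk_injective (congrArg Subtype.val h)), ?_⟩)
  · rw [MonotoneWalk.finish_toWalk]
    exact w.2.2.1
  · rintro ⟨ω, h1, h2, h3, h4⟩
    obtain ⟨w, rfl⟩ := MonotoneWalk.exists_toWalk_eq ω h2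
    refine ⟨⟨w, h3, ?_, w.isConnectedOn_toWalk.mp h1⟩, rfl⟩
    rw [MonotoneWalk.finish_toWalk] at h4
    exact h4

end StrongCoupling

namespace StrongCoupling

/-! ### Conditional expectations in group algebras -/

section CondExp

variable {G : Type*} [Group G]

open Classical in
/-- The linear projection of a group algebra onto the group algebra of a subgroup. -/
noncomputable def condExp (H : Subgroup G) : MonoidAlgebra ℂ G →ₗ[ℂ] MonoidAlgebra ℂ G where
  toFun a := .ofCoeff (a.coeff.filter (· ∈ H))
  map_add' a b := by
    rw [MonoidAlgebra.coeff_add, Finsupp.filter_add, MonoidAlgebra.ofCoeff_add]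
  map_smul' c a := by
    rw [MonoidAlgebra.coeff_smul, Finsupp.filter_smul, MonoidAlgebra.ofCoeff_smul,
      RingHom.id_apply]

open Classical in
theorem condExp_single_of_mem {H : Subgroup G} {g : G} (hg : g ∈ H) (r : ℂ) :
    condExp H (.single g r) = .single g r :=
  congrArg MonoidAlgebra.ofCoeff (Finsupp.filter_single_of_pos (· ∈ H) hg)

open Classical in
theorem condExp_single_of_notMem {H : Subgroup G} {g : G} (hg : g ∉ H) (r : ℂ) :
    condExp H (.single g r) = 0 :=
  congrArg MonoidAlgebra.ofCoeff (Finsupp.filter_single_of_neg (· ∈ H) hg)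

theorem condExp_one (H : Subgroup G) : condExp H 1 = 1 := condExp_single_of_mem H.one_mem 1

open Classical in
theorem coeff_condExp_one (H : Subgroup G) (a : MonoidAlgebra ℂ G) :
    (condExp H a).coeff 1 = a.coeff 1 :=
  Finsupp.filter_apply_pos (· ∈ H) a.coeff H.one_mem

theorem condExp_condExp_mul (H : Subgroup G) (a b : MonoidAlgebra ℂ G) :
    condExp H (condExp H a * b) = condExp H a * condExp H b := by
  induction a using MonoidAlgebra.induction_linear with
  | zero => simp
  | add a a' ha ha' => simp only [map_add, add_mul, ha, ha']
  | single g r =>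
    by_cases hg : g ∈ H
    · rw [condExp_single_of_mem hg]
      induction b using MonoidAlgebra.induction_linear with
      | zero => simp
      | add b b' hb hb' => simp only [map_add, mul_add, hb, hb']
      | single g' r' =>
        rw [MonoidAlgebra.single_mul_single]
        by_cases hg' : g' ∈ H
        · rw [condExp_single_of_mem hg', condExp_single_of_mem (H.mul_mem hg hg'),
            MonoidAlgebra.single_mul_single]
        · rw [condExp_single_of_notMem hg', condExp_single_of_notMem, mul_zero]
          rwa [H.mul_mem_cancel_left hg]
    · rw [condExp_single_of_notMem hg, zero_mul, map_zero, zero_mul]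

theorem condExp_mul_condExp (H : Subgroup G) (a b : MonoidAlgebra ℂ G) :
    condExp H (a * condExp H b) = condExp H a * condExp H b := by
  induction b using MonoidAlgebra.induction_linear with
  | zero => simp
  | add b b' hb hb' => simp only [map_add, mul_add, hb, hb']
  | single g r =>
    by_cases hg : g ∈ H
    · rw [condExp_single_of_mem hg]
      induction a using MonoidAlgebra.induction_linear with
      | zero => simp
      | add a a' ha ha' => simp only [map_add, add_mul, ha, ha']
      | single g' r' =>
        rw [MonoidAlgebra.single_mul_single]
        by_cases hg' : g' ∈ H
        · rw [condExp_single_of_mem hg', condExp_single_of_mem (H.mul_mem hg' hg),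
            MonoidAlgebra.single_mul_single]
        · rw [condExp_single_of_notMem hg', condExp_single_of_notMem, zero_mul]
          rwa [H.mul_mem_cancel_right hg]
    · rw [condExp_single_of_notMem hg, mul_zero, map_zero, mul_zero]

theorem condExp_mul_of_left {H : Subgroup G} {a : MonoidAlgebra ℂ G} (ha : condExp H a = a)
    (b : MonoidAlgebra ℂ G) : condExp H (a * b) = a * condExp H b := by
  rw [← ha, condExp_condExp_mul]

theorem condExp_mul_of_right {H : Subgroup G} {b : MonoidAlgebra ℂ G} (hb : condExp H b = b)
    (a : MonoidAlgebra ℂ G) : condExp H (a * b) = condExp H a * b := by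
  rw [← hb, condExp_mul_condExp]

end CondExp

/-! ### Jucys-Murphy elements -/

/-- The permutations of `ℕ` that move only numbers less than `k`. -/
def permsBelow (k : ℕ) : Subgroup (Equiv.Perm ℕ) where
  carrier := {π | ∀ n, k ≤ n → π n = n}
  mul_mem' hπ hρ n hn := by rw [Equiv.Perm.mul_apply, hρ n hn, hπ n hn]
  one_mem' _ _ := rfl
  inv_mem' {π} hπ n hn := by
    rw [Equiv.Perm.inv_eq_iff_eq]
    exact (hπ n hn).symm

theorem permsBelow_mono {k l : ℕ} (h : k ≤ l) : permsBelow k ≤ permsBelow l :=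
  fun _ hπ n hn => hπ n (h.trans hn)

theorem apply_lt_of_mem_permsBelow {k n : ℕ} {π : Equiv.Perm ℕ} (hπ : π ∈ permsBelow k)
    (hn : n < k) : π n < k := by
  by_contra! h
  exact (π.injective (hπ _ h) ▸ hn).not_ge h

theorem swap_mem_permsBelow {k a b : ℕ} (ha : a < k) (hb : b < k) :
    Equiv.swap a b ∈ permsBelow k :=
  fun _ hn => Equiv.swap_apply_of_ne_of_ne (by omega) (by omega)

/-- The Jucys-Murphy element `∑_{s < k} (s k)` of the group algebra. -/
noncomputable def jucysMurphy (k : ℕ) : MonoidAlgebra ℂ (Equiv.Perm ℕ) :=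
  ∑ s ∈ Finset.range k, .single (Equiv.swap s k) 1

theorem condExp_jucysMurphy {k l : ℕ} (h : k < l) :
    condExp (permsBelow l) (jucysMurphy k) = jucysMurphy k := by
  rw [jucysMurphy, map_sum]
  refine Finset.sum_congr rfl fun s hs => condExp_single_of_mem ?_ 1
  exact swap_mem_permsBelow ((Finset.mem_range.mp hs).trans h) h

theorem single_mul_jucysMurphy {k : ℕ} {π : Equiv.Perm ℕ} (hπ : π ∈ permsBelow k) (r : ℂ) :
    .single π r * jucysMurphy k = jucysMurphy k * .single π r := by
  rw [jucysMurphy, Finset.mul_sum, Finset.sum_mul]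
  refine Finset.sum_nbij' (fun s => π s) (fun s => π⁻¹ s) (fun s hs => ?_) (fun s hs => ?_)
    (fun s _ => by simp) (fun s _ => by simp) fun s _ => ?_
  · exact Finset.mem_range.mpr (apply_lt_of_mem_permsBelow hπ (Finset.mem_range.mp hs))
  · exact Finset.mem_range.mpr (apply_lt_of_mem_permsBelow (inv_mem hπ) (Finset.mem_range.mp hs))
  · rw [MonoidAlgebra.single_mul_single, MonoidAlgebra.single_mul_single,
      Equiv.mul_swap_eq_swap_mul, hπ k le_rfl, mul_comm r]

theorem commute_jucysMurphy {k : ℕ} {a : MonoidAlgebra ℂ (Equiv.Perm ℕ)}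
    (ha : condExp (permsBelow k) a = a) : Commute a (jucysMurphy k) := by
  have key : ∀ a, condExp (permsBelow k) a * jucysMurphy k =
      jucysMurphy k * condExp (permsBelow k) a := by
    intro a
    induction a using MonoidAlgebra.induction_linear with
    | zero => simp
    | add a a' ha ha' => simp only [map_add, add_mul, mul_add, ha, ha']
    | single g r =>
      by_cases hg : g ∈ permsBelow k
      · rw [condExp_single_of_mem hg, single_mul_jucysMurphy hg]
      · rw [condExp_single_of_notMem hg, zero_mul, mul_zero]
  rw [← ha]
  exact key a

theorem condExp_conj (k : ℕ) (a : MonoidAlgebra ℂ (Equiv.Perm ℕ)) :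
    condExp (permsBelow (k + 1)) (.single (Equiv.swap k (k + 1)) 1 *
      condExp (permsBelow (k + 1)) a * .single (Equiv.swap k (k + 1)) 1) =
    condExp (permsBelow k) a := by
  induction a using MonoidAlgebra.induction_linear with
  | zero => simp
  | add a a' ha ha' => simp only [map_add, add_mul, mul_add, ha, ha']
  | single g r =>
    by_cases hg : g ∈ permsBelow (k + 1)
    · rw [condExp_single_of_mem hg, MonoidAlgebra.single_mul_single,
        MonoidAlgebra.single_mul_single, one_mul, mul_one]
      by_cases hk : g ∈ permsBelow k
      · have h1 : Equiv.swap k (k + 1) * g * Equiv.swap k (k + 1) = g := by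
          rw [mul_assoc, Equiv.mul_swap_eq_swap_mul, hk k le_rfl, hk (k + 1) (Nat.le_succ k),
            ← mul_assoc, Equiv.swap_mul_self, one_mul]
        rw [h1, condExp_single_of_mem hg, condExp_single_of_mem hk]
      · rw [condExp_single_of_notMem hk, condExp_single_of_notMem]
        intro h
        apply hk
        intro n hn
        rcases hn.eq_or_lt with rfl | hn
        · have h2 := h (k + 1) le_rfl
          rw [Equiv.Perm.mul_apply, Equiv.Perm.mul_apply, Equiv.swap_apply_right] at h2
          have h3 := congrArg (Equiv.swap k (k + 1)) h2
          rwa [Equiv.swap_apply_self, Equiv.swap_apply_right] at h3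
        · exact hg n hn
    · rw [condExp_single_of_notMem hg, condExp_single_of_notMem fun h =>
        hg (permsBelow_mono (Nat.le_succ k) h)]
      simp

theorem jucysMurphy_succ_mul_single (k : ℕ) :
    jucysMurphy (k + 1) * .single (Equiv.swap k (k + 1)) 1 =
      .single (Equiv.swap k (k + 1)) 1 * jucysMurphy k + 1 := by
  rw [jucysMurphy, Finset.sum_range_succ, add_mul, MonoidAlgebra.single_mul_single,
    Equiv.swap_mul_self, one_mul, ← MonoidAlgebra.one_def, jucysMurphy, Finset.sum_mul,
    Finset.mul_sum]
  congr 1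
  refine Finset.sum_congr rfl fun s hs => ?_
  rw [Finset.mem_range] at hs
  rw [MonoidAlgebra.single_mul_single, MonoidAlgebra.single_mul_single,
    Equiv.mul_swap_eq_swap_mul (Equiv.swap k (k + 1)) s k, Equiv.swap_apply_left,
    Equiv.swap_apply_of_ne_of_ne hs.ne (by omega)]

theorem jucysMurphy_succ_pow_succ (k r : ℕ) :
    jucysMurphy (k + 1) ^ (r + 1) =
      .single (Equiv.swap k (k + 1)) 1 * jucysMurphy k ^ (r + 1) *
          .single (Equiv.swap k (k + 1)) 1 +
        jucysMurphy (k + 1) ^ r * .single (Equiv.swap k (k + 1)) 1 +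
        jucysMurphy k * jucysMurphy (k + 1) ^ r -
        jucysMurphy k * (.single (Equiv.swap k (k + 1)) 1 * jucysMurphy k ^ r *
          .single (Equiv.swap k (k + 1)) 1) := by
  have h1 := jucysMurphy_succ_mul_single k
  have h2 : jucysMurphy k * jucysMurphy (k + 1) = jucysMurphy (k + 1) * jucysMurphy k :=
    commute_jucysMurphy (condExp_jucysMurphy (Nat.lt_succ_self k))
  have h3 : (MonoidAlgebra.single (Equiv.swap k (k + 1)) 1 : MonoidAlgebra ℂ (Equiv.Perm ℕ)) *
      .single (Equiv.swap k (k + 1)) 1 = 1 := by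
    rw [MonoidAlgebra.single_mul_single, Equiv.swap_mul_self, one_mul, MonoidAlgebra.one_def]
  generalize (MonoidAlgebra.single (Equiv.swap k (k + 1)) 1 : MonoidAlgebra ℂ (Equiv.Perm ℕ)) = s
    at h1 h3 ⊢
  generalize jucysMurphy (k + 1) = y at h1 h2 ⊢
  generalize jucysMurphy k = x at h1 h2 ⊢
  have h4 : y = s * x * s + s := by
    calc y = y * s * s := by rw [mul_assoc, h3, mul_one]
      _ = s * x * s + s := by rw [h1, add_mul, one_mul]
  induction r with
  | zero =>
    simp only [pow_zero, one_mul, mul_one, h3, zero_add, pow_one, add_sub_cancel_right]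
    exact h4
  | succ r ih =>
    have e0 := congrArg (y * ·) ih
    simp only [mul_sub, mul_add] at e0
    rw [pow_succ' y (r + 1), e0]
    have e1 : y * (s * x ^ (r + 1) * s) = s * x ^ (r + 1 + 1) * s + x ^ (r + 1) * s := by
      rw [← mul_assoc, ← mul_assoc, h1, add_mul, one_mul, add_mul, mul_assoc s x, ← pow_succ' x]
    have e2 : y * (y ^ r * s) = y ^ (r + 1) * s := by rw [← mul_assoc, ← pow_succ']
    have e3 : y * (x * y ^ r) = x * y ^ (r + 1) := by
      rw [← mul_assoc, ← h2, mul_assoc, ← pow_succ']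
    have e4 : y * (x * (s * x ^ r * s)) = x * (s * x ^ (r + 1) * s) + x ^ (r + 1) * s := by
      rw [← mul_assoc, ← h2, mul_assoc, ← mul_assoc y, ← mul_assoc y, h1, add_mul, one_mul,
        add_mul, mul_assoc s x, ← pow_succ', mul_add, ← mul_assoc x (x ^ r), ← pow_succ']
    rw [e1, e2, e3, e4]
    abel

/-- The recursion for the conditional moments of Jucys-Murphy elements. -/
def momentPair {B : Type*} [Ring B] (b : ℕ → B) (x : B) : ℕ → B × B
  | 0 => (1, 0)
  | r + 1 => (b (r + 1) + (momentPair b x r).2 + x * ((momentPair b x r).1 - b r),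
      (momentPair b x r).1 + (momentPair b x r).2 * x)

theorem condExp_jucysMurphy_succ_pow (k r : ℕ) :
    (condExp (permsBelow (k + 1)) (jucysMurphy (k + 1) ^ r),
      condExp (permsBelow (k + 1)) (jucysMurphy (k + 1) ^ r * .single (Equiv.swap k (k + 1)) 1)) =
    momentPair (fun r => condExp (permsBelow k) (jucysMurphy k ^ r)) (jucysMurphy k) r := by
  have hx : condExp (permsBelow (k + 1)) (jucysMurphy k) = jucysMurphy k :=
    condExp_jucysMurphy (Nat.lt_succ_self k)
  have hpow : ∀ r, condExp (permsBelow (k + 1)) (jucysMurphy k ^ r) = jucysMurphy k ^ r := by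
    intro r
    induction r with
    | zero => rw [pow_zero, condExp_one]
    | succ r ih => rw [pow_succ, condExp_mul_of_left ih, hx]
  have hconj : ∀ r, condExp (permsBelow (k + 1)) (.single (Equiv.swap k (k + 1)) 1 *
      jucysMurphy k ^ r * .single (Equiv.swap k (k + 1)) 1) =
      condExp (permsBelow k) (jucysMurphy k ^ r) := fun r => by
    rw [← condExp_conj k, hpow]
  induction r with
  | zero =>
    rw [pow_zero, one_mul, condExp_one, condExp_single_of_notMem]
    · rfl
    · intro h
      have h1 := h (k + 1) le_rfl
      rw [Equiv.swap_apply_right] at h1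
      omega
  | succ r ih =>
    rw [momentPair, ← ih]
    refine Prod.ext ?_ ?_
    · dsimp only
      rw [jucysMurphy_succ_pow_succ, map_sub, map_add, map_add, hconj, condExp_mul_of_left hx,
        condExp_mul_of_left hx, hconj, mul_sub]
      abel
    · dsimp only
      rw [pow_succ, mul_assoc, jucysMurphy_succ_mul_single, mul_add, mul_one, ← mul_assoc, map_add,
        condExp_mul_of_right hx, add_comm]

/-! ### Joint distribution of Jucys-Murphy elements -/

section JointMoments

variable {ι : Type*}

/-- The sum of `f` over the words of length `n`. -/
def wordSum [Fintype ι] : ℕ → (List ι → ℂ) → ℂ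
  | 0, f => f []
  | n + 1, f => wordSum n fun w => ∑ i, f (i :: w)

theorem wordSum_congr [Fintype ι] {n : ℕ} {f f' : List ι → ℂ}
    (h : ∀ w, w.length = n → f w = f' w) : wordSum n f = wordSum n f' := by
  induction n generalizing f f' with
  | zero => exact h [] rfl
  | succ n ih =>
    exact ih fun w hw => Finset.sum_congr rfl fun i _ => h (i :: w) (by simp [hw])

theorem wordSum_add [Fintype ι] (n : ℕ) (f f' : List ι → ℂ) :
    wordSum n (fun w => f w + f' w) = wordSum n f + wordSum n f' := by
  induction n generalizing f f' with
  | zero => rfl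
  | succ n ih =>
    rw [wordSum, wordSum, wordSum, ← ih]
    simp only [Finset.sum_add_distrib]

theorem wordSum_mul_left [Fintype ι] (n : ℕ) (c : ℂ) (f : List ι → ℂ) :
    wordSum n (fun w => c * f w) = c * wordSum n f := by
  induction n generalizing f with
  | zero => rfl
  | succ n ih =>
    rw [wordSum, wordSum, ← ih]
    simp only [Finset.mul_sum]

/-- The value of `κ` at the `t`-th letter of a word; the first letter is the last in the list. -/
def stepValue (κ : List ι → ι → ℂ) (t : ℕ) : List ι → ℂ
  | [] => 0
  | i :: w => if w.length = t then κ w i else stepValue κ t w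

/-- A Jucys-Murphy element together with its spectral model. -/
noncomputable def modelledJucysMurphy (κ : List ι → ι → ℂ) (t : ℕ) :
    MonoidAlgebra ℂ (Equiv.Perm ℕ) × (List ι → ℂ) := (jucysMurphy t, stepValue κ t)

noncomputable def modelledAlgebra (κ : List ι → ι → ℂ) (n : ℕ) :
    Subalgebra ℂ (MonoidAlgebra ℂ (Equiv.Perm ℕ) × (List ι → ℂ)) :=
  Algebra.adjoin ℂ (modelledJucysMurphy κ '' Set.Iio n)

/-- The conditional moments of the Jucys-Murphy element `jucysMurphy n`, together with their
spectral model. -/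
noncomputable def modelledMoment (κ : List ι → ι → ℂ) :
    ℕ → ℕ → MonoidAlgebra ℂ (Equiv.Perm ℕ) × (List ι → ℂ)
  | 0, r => if r = 0 then 1 else 0
  | n + 1, r => (momentPair (modelledMoment κ n) (modelledJucysMurphy κ n) r).1

variable {κ : List ι → ι → ℂ}

theorem modelledAlgebra_mono {n n' : ℕ} (h : n ≤ n') :
    modelledAlgebra κ n ≤ modelledAlgebra κ n' :=
  Algebra.adjoin_mono (Set.image_mono (Set.Iio_subset_Iio h))

theorem modelledJucysMurphy_mem {t n : ℕ} (h : t < n) :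
    modelledJucysMurphy κ t ∈ modelledAlgebra κ n :=
  Algebra.subset_adjoin ⟨t, h, rfl⟩

theorem momentPair_mem {B : Type*} [Ring B] [Algebra ℂ B] (T : Subalgebra ℂ B) {b : ℕ → B} {x : B}
    (hb : ∀ r, b r ∈ T) (hx : x ∈ T) (r : ℕ) :
    (momentPair b x r).1 ∈ T ∧ (momentPair b x r).2 ∈ T := by
  induction r with
  | zero => exact ⟨one_mem T, zero_mem T⟩
  | succ r ih =>
    exact ⟨add_mem (add_mem (hb _) ih.2) (mul_mem hx (sub_mem ih.1 (hb r))),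
      add_mem ih.1 (mul_mem ih.2 hx)⟩

theorem modelledMoment_mem (n r : ℕ) : modelledMoment κ n r ∈ modelledAlgebra κ n := by
  induction n generalizing r with
  | zero =>
    rw [modelledMoment]
    split_ifs
    exacts [one_mem _, zero_mem _]
  | succ n ih =>
    exact (momentPair_mem _ (fun r => modelledAlgebra_mono (Nat.le_succ n) (ih r))
      (modelledJucysMurphy_mem (Nat.lt_succ_self n)) r).1

theorem map_momentPair {B C : Type*} [Ring B] [Ring C] (f : B →+* C) (b : ℕ → B) (x : B) (r : ℕ) :
    momentPair (fun r => f (b r)) (f x) r = (f (momentPair b x r).1, f (momentPair b x r).2) := by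
  induction r with
  | zero => rw [momentPair, momentPair, map_one, map_zero]
  | succ r ih => rw [momentPair, momentPair, ih]; simp only [map_add, map_mul, map_sub]

theorem modelledMoment_fst (n r : ℕ) :
    (modelledMoment κ n r).1 = condExp (permsBelow n) (jucysMurphy n ^ r) := by
  induction n generalizing r with
  | zero =>
    have h0 : jucysMurphy 0 = 0 := by rw [jucysMurphy, Finset.range_zero, Finset.sum_empty]
    rw [modelledMoment, h0]
    split_ifs with hr
    · rw [hr, pow_zero, condExp_one]
      rfl
    · rw [zero_pow hr, map_zero]
      rfl
  | succ n ih =>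
    have h1 := map_momentPair (RingHom.fst (MonoidAlgebra ℂ (Equiv.Perm ℕ)) (List ι → ℂ))
      (modelledMoment κ n) (modelledJucysMurphy κ n) r
    have h2 := condExp_jucysMurphy_succ_pow n r
    have h3 : (fun r => RingHom.fst (MonoidAlgebra ℂ (Equiv.Perm ℕ)) (List ι → ℂ)
      (modelledMoment κ n r)) = fun r => condExp (permsBelow n) (jucysMurphy n ^ r) := funext ih
    rw [h3] at h1
    have h4 : RingHom.fst (MonoidAlgebra ℂ (Equiv.Perm ℕ)) (List ι → ℂ)
      (modelledJucysMurphy κ n) = jucysMurphy n := rfl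
    rw [h4, ← h2] at h1
    exact (congrArg Prod.fst h1).symm

theorem condExp_fst_of_mem {n : ℕ} {z : MonoidAlgebra ℂ (Equiv.Perm ℕ) × (List ι → ℂ)}
    (hz : z ∈ modelledAlgebra κ n) : condExp (permsBelow n) z.1 = z.1 := by
  induction hz using Algebra.adjoin_induction with
  | mem z hz =>
    obtain ⟨t, ht, rfl⟩ := hz
    exact condExp_jucysMurphy ht
  | algebraMap c =>
    change condExp (permsBelow n) (algebraMap ℂ _ c) = algebraMap ℂ _ c
    rw [Algebra.algebraMap_eq_smul_one, map_smul, condExp_one]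
  | add y z _ _ hy hz => rw [Prod.fst_add, map_add, hy, hz]
  | mul y z _ _ hy hz => rw [Prod.fst_mul, condExp_mul_of_left hy, hz]

theorem snd_cons_of_mem {n : ℕ} {z : MonoidAlgebra ℂ (Equiv.Perm ℕ) × (List ι → ℂ)}
    (hz : z ∈ modelledAlgebra κ n) (i : ι) {w : List ι} (hw : w.length = n) :
    z.2 (i :: w) = z.2 w := by
  induction hz using Algebra.adjoin_induction with
  | mem z hz =>
    obtain ⟨t, ht, rfl⟩ := hz
    exact if_neg (hw ▸ ne_of_gt ht)
  | algebraMap c => rfl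
  | add y z _ _ hy hz => rw [Prod.snd_add, Pi.add_apply, Pi.add_apply, hy, hz]
  | mul y z _ _ hy hz => rw [Prod.snd_mul, Pi.mul_apply, Pi.mul_apply, hy, hz]

theorem mem_span_of_mem_modelledAlgebra_succ {n : ℕ}
    {z : MonoidAlgebra ℂ (Equiv.Perm ℕ) × (List ι → ℂ)} (hz : z ∈ modelledAlgebra κ (n + 1)) :
    z ∈ Submodule.span ℂ {y | ∃ a ∈ modelledAlgebra κ n, ∃ r : ℕ,
      a * modelledJucysMurphy κ n ^ r = y} := by
  set T := Submodule.span ℂ {y | ∃ a ∈ modelledAlgebra κ n, ∃ r : ℕ,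
      a * modelledJucysMurphy κ n ^ r = y} with hT
  have key : ∀ m ∈ T, z * m ∈ T := by
    induction hz using Algebra.adjoin_induction with
    | mem z hz =>
      intro m hm
      induction hm using Submodule.span_induction with
      | mem m hm =>
        obtain ⟨a, ha, r, rfl⟩ := hm
        obtain ⟨t, ht, rfl⟩ := hz
        rcases (Nat.lt_succ_iff.mp ht).eq_or_lt with rfl | ht
        · refine Submodule.subset_span ⟨a, ha, r + 1, ?_⟩
          have : Commute a (modelledJucysMurphy κ t) :=
            Prod.ext (commute_jucysMurphy (condExp_fst_of_mem ha)) (mul_comm _ _)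
          rw [pow_succ', ← mul_assoc, ← mul_assoc, this.eq]
        · exact Submodule.subset_span ⟨_, mul_mem (modelledJucysMurphy_mem ht) ha, r,
            mul_assoc _ _ _⟩
      | zero => rw [mul_zero]; exact zero_mem _
      | add m m' _ _ h h' => rw [mul_add]; exact add_mem h h'
      | smul c m _ h => rw [mul_smul_comm]; exact Submodule.smul_mem _ c h
    | algebraMap c =>
      intro m hm
      rw [← Algebra.smul_def]
      exact Submodule.smul_mem _ c hm
    | add y z _ _ hy hz => exact fun m hm => by rw [add_mul]; exact add_mem (hy m hm) (hz m hm)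
    | mul y z _ _ hy hz => exact fun m hm => by rw [mul_assoc]; exact hy _ (hz m hm)
  have h1 : (1 : MonoidAlgebra ℂ (Equiv.Perm ℕ) × (List ι → ℂ)) ∈ T :=
    Submodule.subset_span ⟨1, one_mem _, 0, by rw [pow_zero, mul_one]⟩
  have := key 1 h1
  rwa [mul_one] at this

/-- The state `a ↦ a.coeff 1` on polynomials in Jucys-Murphy elements is a sum over words. -/
theorem coeff_one_eq_wordSum [Fintype ι] {v : List ι → ℂ} {D : ℕ} (hv : v [] = 1)
    (hvκ : ∀ w, w.length < D → ∀ r, ∑ i, v (i :: w) * κ w i ^ r =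
      v w * (modelledMoment κ w.length r).2 w) {n : ℕ} (hn : n ≤ D)
    {z : MonoidAlgebra ℂ (Equiv.Perm ℕ) × (List ι → ℂ)} (hz : z ∈ modelledAlgebra κ n) :
    z.1.coeff 1 = wordSum n fun w => v w * z.2 w := by
  induction n generalizing z with
  | zero =>
    rw [wordSum, hv, one_mul]
    induction hz using Algebra.adjoin_induction with
    | mem z hz =>
      obtain ⟨t, ht, rfl⟩ := hz
      exact absurd ht (Nat.not_lt_zero t)
    | algebraMap c =>
      change (algebraMap ℂ (MonoidAlgebra ℂ (Equiv.Perm ℕ)) c).coeff 1 = c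
      rw [Algebra.algebraMap_eq_smul_one, MonoidAlgebra.coeff_smul_apply,
        MonoidAlgebra.coeff_one_one, smul_eq_mul, mul_one]
    | add y z _ _ hy hz =>
      rw [Prod.fst_add, MonoidAlgebra.coeff_add, Finsupp.add_apply, hy, hz, Prod.snd_add,
        Pi.add_apply]
    | mul y z hy' _ hy hz =>
      have h0 : ∀ a : MonoidAlgebra ℂ (Equiv.Perm ℕ), condExp (permsBelow 0) a =
          .single 1 (a.coeff 1) := by
        intro a
        refine MonoidAlgebra.coeff_injective (Finsupp.ext fun π => ?_)
        by_cases hπ : π = 1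
        · rw [hπ, coeff_condExp_one, MonoidAlgebra.coeff_single, Finsupp.single_eq_same]
        · rw [MonoidAlgebra.coeff_single, Finsupp.single_eq_of_ne hπ]
          classical
          exact Finsupp.filter_apply_neg (· ∈ permsBelow 0) _ fun h =>
            hπ (Equiv.ext fun k => h k (Nat.zero_le k))
      have h1 := condExp_fst_of_mem hy'
      rw [h0] at h1
      rw [Prod.fst_mul, ← h1, MonoidAlgebra.coeff_single_one_mul, hy, hz, Prod.snd_mul,
        Pi.mul_apply]
  | succ n ih =>
    have hspan := mem_span_of_mem_modelledAlgebra_succ hz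
    clear hz
    induction hspan using Submodule.span_induction with
    | mem z hz =>
      obtain ⟨a, ha, r, rfl⟩ := hz
      have h1 : (a * modelledJucysMurphy κ n ^ r).1.coeff 1 =
          (a * modelledMoment κ n r).1.coeff 1 := by
        rw [Prod.fst_mul, Prod.fst_mul, modelledMoment_fst,
          ← condExp_mul_of_left (condExp_fst_of_mem ha), coeff_condExp_one]
        rfl
      rw [h1, ih (Nat.le_of_succ_le hn) (mul_mem ha (modelledMoment_mem n r)), wordSum]
      refine wordSum_congr fun w hw => ?_
      subst hw
      have h2 : ∀ i, v (i :: w) * (a * modelledJucysMurphy κ w.length ^ r).2 (i :: w) =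
          a.2 w * (v (i :: w) * κ w i ^ r) := by
        intro i
        have h3 : (a * modelledJucysMurphy κ w.length ^ r).2 (i :: w) =
            a.2 (i :: w) * (stepValue κ w.length (i :: w)) ^ r := rfl
        rw [h3, snd_cons_of_mem ha i rfl, stepValue, if_pos rfl]
        ring
      simp only [h2]
      rw [← Finset.mul_sum, hvκ w hn r, Prod.snd_mul, Pi.mul_apply]
      ring
    | zero =>
      simp only [Prod.fst_zero, Prod.snd_zero, Pi.zero_apply, MonoidAlgebra.coeff_zero,
        Finsupp.zero_apply]
      have h0 := wordSum_mul_left (n + 1) 0 v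
      simp only [zero_mul] at h0
      simp only [mul_zero]
      exact h0.symm
    | add y z _ _ hy hz =>
      rw [Prod.fst_add, MonoidAlgebra.coeff_add, Finsupp.add_apply, hy, hz, ← wordSum_add]
      simp only [Prod.snd_add, Pi.add_apply, mul_add]
    | smul c z _ hz =>
      rw [Prod.smul_fst, MonoidAlgebra.coeff_smul_apply, hz, smul_eq_mul, ← wordSum_mul_left]
      simp only [Prod.smul_snd, Pi.smul_apply, smul_eq_mul, mul_left_comm]

end JointMoments

end StrongCoupling

namespace StrongCoupling

/-! ### The Vandermonde weight -/

section Vandermonde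

variable {R : ℕ}

theorem det_vandermonde_comp_perm (v : Fin R → ℂ) (σ : Equiv.Perm (Fin R)) :
    (Matrix.vandermonde (v ∘ σ)).det = (Equiv.Perm.sign σ : ℤ) * (Matrix.vandermonde v).det := by
  have : Matrix.vandermonde (v ∘ σ) = (Matrix.vandermonde v).submatrix σ id := rfl
  rw [this, Matrix.det_permute]

theorem det_vandermonde_update_zero {n : ℕ} (v : Fin (n + 1) → ℂ) (y : ℂ) :
    (Matrix.vandermonde (Function.update v 0 y)).det * ∏ j ∈ Finset.univ.erase 0, (v 0 - v j) =
      (Matrix.vandermonde v).det * ∏ j ∈ Finset.univ.erase 0, (y - v j) := by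
  have he : ∀ f : Fin (n + 1) → ℂ, ∏ j ∈ Finset.univ.erase 0, f j = ∏ j : Fin n, f j.succ := by
    intro f
    rw [Fin.univ_succ, Finset.erase_cons, Finset.prod_map]
    rfl
  rw [Matrix.det_vandermonde, Matrix.det_vandermonde, Fin.prod_univ_succ, Fin.prod_univ_succ,
    he, he]
  simp only [Fin.prod_Ioi_zero, Fin.prod_Ioi_succ, Function.update_self, ne_eq, Fin.succ_ne_zero,
    not_false_eq_true, Function.update_of_ne]
  have h : (∏ j : Fin n, (v j.succ - y)) * ∏ j : Fin n, (v 0 - v j.succ) =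
      (∏ j : Fin n, (v j.succ - v 0)) * ∏ j : Fin n, (y - v j.succ) := by
    rw [← Finset.prod_mul_distrib, ← Finset.prod_mul_distrib]
    exact Finset.prod_congr rfl fun j _ => by ring
  linear_combination (∏ i : Fin n, ∏ j ∈ Finset.Ioi i, (v j.succ - v i.succ)) * h

theorem det_vandermonde_update (v : Fin R → ℂ) (i : Fin R) (y : ℂ) :
    (Matrix.vandermonde (Function.update v i y)).det * ∏ j ∈ Finset.univ.erase i, (v i - v j) =
      (Matrix.vandermonde v).det * ∏ j ∈ Finset.univ.erase i, (y - v j) := by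
  obtain _ | n := R
  · exact i.elim0
  set σ : Equiv.Perm (Fin (n + 1)) := Equiv.swap 0 i with hσ
  have h := det_vandermonde_update_zero (v ∘ σ) y
  have hσ0 : σ 0 = i := Equiv.swap_apply_left 0 i
  have h1 : Function.update (v ∘ σ) 0 y = Function.update v i y ∘ σ := by
    funext j
    by_cases hj : j = 0
    · rw [hj, Function.update_self, Function.comp_apply, hσ0, Function.update_self]
    · have : σ j ≠ i := fun h => hj (σ.injective (h.trans hσ0.symm))
      rw [Function.update_of_ne hj, Function.comp_apply, Function.comp_apply,
        Function.update_of_ne this]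
  have h2 : ∀ f : Fin (n + 1) → ℂ, ∏ j ∈ Finset.univ.erase 0, f (σ j) =
      ∏ j ∈ Finset.univ.erase i, f j := fun f =>
    Finset.prod_equiv σ (fun j => by
      simp only [Finset.mem_erase, Finset.mem_univ, and_true, ne_eq]
      rw [not_iff_not, ← hσ0, σ.injective.eq_iff]) fun _ _ => rfl
  have h3 := h2 fun j => v i - v j
  have h4 := h2 fun j => y - v j
  rw [h1, det_vandermonde_comp_perm, det_vandermonde_comp_perm] at h
  simp only [Function.comp_apply, hσ0] at h
  rw [h3, h4] at h
  have h5 : ((Equiv.Perm.sign σ : ℤ) : ℂ) ≠ 0 := by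
    exact_mod_cast (Equiv.Perm.sign σ).ne_zero
  refine mul_left_cancel₀ h5 ?_
  linear_combination h

/-- The weight of a shifted shape with row lengths `l`. -/
noncomputable def shapeWeight (l : Fin R → ℕ) : ℂ :=
  (Matrix.vandermonde fun i => (l i : ℂ)).det / ∏ i, ((l i).factorial : ℂ)

theorem prod_factorial_ne_zero (l : Fin R → ℕ) : (∏ i, ((l i).factorial : ℂ)) ≠ 0 :=
  Finset.prod_ne_zero_iff.mpr fun _ _ => Nat.cast_ne_zero.mpr (Nat.factorial_ne_zero _)

theorem shapeWeight_comp_perm (l : Fin R → ℕ) (σ : Equiv.Perm (Fin R)) :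
    shapeWeight (l ∘ σ) = (Equiv.Perm.sign σ : ℤ) * shapeWeight l := by
  have h1 := det_vandermonde_comp_perm (fun i => (l i : ℂ)) σ
  have h2 : ∏ i, (((l ∘ σ) i).factorial : ℂ) = ∏ i, ((l i).factorial : ℂ) :=
    Equiv.prod_comp σ fun i => ((l i).factorial : ℂ)
  rw [shapeWeight, shapeWeight, h2, ← mul_div_assoc, ← h1]
  rfl

theorem shapeWeight_ne_zero_iff {l : Fin R → ℕ} : shapeWeight l ≠ 0 ↔ Function.Injective l := by
  rw [shapeWeight, div_ne_zero_iff, and_iff_left (prod_factorial_ne_zero l),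
    Matrix.det_vandermonde_ne_zero_iff]
  exact ⟨fun h => Function.Injective.of_comp h, fun h => Nat.cast_injective.comp h⟩

theorem shapeWeight_add_single (l : Fin R → ℕ) (i : Fin R) :
    shapeWeight (l + Pi.single i 1) * ((l i + 1) * ∏ j ∈ Finset.univ.erase i, ((l i : ℂ) - l j)) =
      shapeWeight l * ∏ j ∈ Finset.univ.erase i, ((l i : ℂ) + 1 - l j) := by
  have h1 : (fun j => ((l + Pi.single i 1 : Fin R → ℕ) j : ℂ)) =
      Function.update (fun j => (l j : ℂ)) i (l i + 1) := by
    funext j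
    by_cases hj : j = i
    · subst hj; simp
    · simp [hj]
  have h2 : ∏ j, (((l + Pi.single i 1 : Fin R → ℕ) j).factorial : ℂ) =
      (l i + 1) * ∏ j, ((l j).factorial : ℂ) := by
    rw [← Finset.mul_prod_erase _ _ (Finset.mem_univ i),
      ← Finset.mul_prod_erase _ (fun j => ((l j).factorial : ℂ)) (Finset.mem_univ i), ← mul_assoc]
    congr 1
    · simp [Nat.factorial_succ]
    · refine Finset.prod_congr rfl fun j hj => ?_
      simp [Finset.ne_of_mem_erase hj]
  have h3 := det_vandermonde_update (fun j => (l j : ℂ)) i (l i + 1)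
  have h4 := prod_factorial_ne_zero l
  have h5 : (l i + 1 : ℂ) ≠ 0 := by exact_mod_cast Nat.succ_ne_zero (l i)
  rw [shapeWeight, shapeWeight, h1, h2]
  field_simp
  linear_combination h3

end Vandermonde

/-! ### The transition moments -/

section Transition

variable {R : ℕ}

/-- The content of a box added to the `i`-th row of the shifted shape `l`. -/
noncomputable def addedContent (l : Fin R → ℕ) (i : Fin R) : ℂ := (l i : ℂ) - R + 1

theorem sum_shapeWeight_mul_eq_zero {l : Fin R → ℕ} (hl : shapeWeight l = 0) (h : ℂ → ℂ) :
    ∑ i, shapeWeight (l + Pi.single i 1) * h (addedContent l i) = 0 := by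
  have hinj : ¬ Function.Injective l := fun h => shapeWeight_ne_zero_iff.mpr h hl
  rw [Function.Injective] at hinj
  push Not at hinj
  obtain ⟨a, b, hab, hne⟩ := hinj
  set σ : Equiv.Perm (Fin R) := Equiv.swap a b with hσ
  have hlσ : ∀ j, l (σ j) = l j := by
    intro j
    by_cases h1 : j = a
    · rw [h1, hσ, Equiv.swap_apply_left, hab]
    by_cases h2 : j = b
    · rw [h2, hσ, Equiv.swap_apply_right, hab]
    rw [hσ, Equiv.swap_apply_of_ne_of_ne h1 h2]
  have h1 : ∀ i, shapeWeight (l + Pi.single (σ i) 1) = -shapeWeight (l + Pi.single i 1) := by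
    intro i
    have h2 : (l + Pi.single (σ i) 1) ∘ σ = l + Pi.single i 1 := by
      funext j
      simp only [Function.comp_apply, Pi.add_apply, hlσ]
      congr 1
      by_cases hj : j = i
      · rw [hj, Pi.single_eq_same, Pi.single_eq_same]
      · rw [Pi.single_eq_of_ne hj, Pi.single_eq_of_ne (fun h => hj (σ.injective h))]
    rw [← h2, shapeWeight_comp_perm, hσ, Equiv.Perm.sign_swap hne]
    simp
  have h2 : ∑ i, shapeWeight (l + Pi.single i 1) * h (addedContent l i) =
      -∑ i, shapeWeight (l + Pi.single i 1) * h (addedContent l i) := by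
    rw [← Finset.sum_neg_distrib, ← Equiv.sum_comp σ]
    refine Finset.sum_congr rfl fun i _ => ?_
    rw [h1, addedContent, addedContent, hlσ, neg_mul]
  exact self_eq_neg.mp h2

open Polynomial in
theorem sum_shapeWeight_mul_prod_sub {l : Fin R → ℕ} (hl : Function.Injective l)
    (h0 : ∃ j, l j = 0) (u : ℂ) :
    ∑ i, shapeWeight (l + Pi.single i 1) *
        ((u + R) * ∏ j ∈ Finset.univ.erase i, (u - addedContent l j)) =
      shapeWeight l * ∏ j, (u - addedContent l j + 1) := by
  classical
  set P : ℂ[X] := ∑ i, C (shapeWeight (l + Pi.single i 1)) *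
    ((X + C (R : ℂ)) * ∏ j ∈ Finset.univ.erase i, (X - C (addedContent l j))) with hP
  set Q : ℂ[X] := C (shapeWeight l) * ∏ j, (X + C (1 - addedContent l j)) with hQ
  have hcinj : Function.Injective (addedContent l) := fun i j hij => by
    have h : (l i : ℂ) = l j := by
      rw [addedContent, addedContent] at hij
      linear_combination hij
    exact hl (by exact_mod_cast h)
  set S : Finset ℂ := insert (-(R : ℂ)) (Finset.univ.image (addedContent l)) with hS
  have hnot : -(R : ℂ) ∉ Finset.univ.image (addedContent l) := by
    rw [Finset.mem_image]
    rintro ⟨i, -, hi⟩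
    have h : (l i + 1 : ℂ) = 0 := by
      rw [addedContent] at hi
      linear_combination hi
    exact Nat.succ_ne_zero (l i) (by exact_mod_cast h)
  have hcard : S.card = R + 1 := by
    rw [hS, Finset.card_insert_of_notMem hnot, Finset.card_image_of_injective _ hcinj,
      Finset.card_univ, Fintype.card_fin]
  have hdP : P.degree ≤ R := by
    refine (degree_sum_le _ _).trans (Finset.sup_le fun i _ => ?_)
    refine (degree_mul_le _ _).trans ((add_le_add degree_C_le le_rfl).trans ?_)
    rw [zero_add]
    have h1 : (X + C (R : ℂ)).degree = 1 := degree_X_add_C _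
    have h2 : (∏ j ∈ Finset.univ.erase i, (X - C (addedContent l j))).degree =
        ((R - 1 : ℕ) : WithBot ℕ) := by
      rw [degree_prod]
      simp only [degree_X_sub_C]
      rw [Finset.sum_const, Finset.card_erase_of_mem (Finset.mem_univ i), Finset.card_univ,
        Fintype.card_fin]
      simp
    rw [degree_mul, h1, h2]
    have hR : 0 < R := i.pos
    norm_cast
    omega
  have hdQ : Q.degree ≤ R := by
    refine (degree_mul_le _ _).trans ((add_le_add degree_C_le le_rfl).trans ?_)
    rw [zero_add]
    rw [degree_prod]
    simp only [degree_X_add_C]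
    simp
  have hPQ : P = Q := by
    refine Polynomial.eq_of_degree_sub_lt_of_eval_finset_eq S ?_ fun x hx => ?_
    · rw [hcard]
      refine lt_of_le_of_lt ((degree_sub_le _ _).trans (max_le hdP hdQ)) ?_
      exact_mod_cast Nat.lt_succ_self R
    · simp only [hP, hQ, eval_finsetSum, eval_mul, eval_C, eval_add, eval_X, eval_prod, eval_sub]
      rcases Finset.mem_insert.mp hx with rfl | hx
      · obtain ⟨j, hj⟩ := h0
        rw [Finset.sum_eq_zero fun i _ => by rw [neg_add_cancel, zero_mul, mul_zero],
          Finset.prod_eq_zero (Finset.mem_univ j), mul_zero]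
        rw [addedContent, hj]
        push_cast
        ring
      · obtain ⟨i, -, rfl⟩ := Finset.mem_image.mp hx
        rw [Finset.sum_eq_single i, ← Finset.mul_prod_erase _ _ (Finset.mem_univ i)]
        · have h := shapeWeight_add_single l i
          have e1 : ∀ j, addedContent l i - addedContent l j = (l i : ℂ) - l j := fun j => by
            rw [addedContent, addedContent]; ring
          have e2 : ∀ j, addedContent l i + (1 - addedContent l j) = (l i : ℂ) + 1 - l j :=
            fun j => by rw [addedContent, addedContent]; ring
          have e3 : addedContent l i + R = l i + 1 := by rw [addedContent]; ring
          simp only [e1, e2, e3]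
          rw [h]
          ring
        · intro k _ hk
          rw [Finset.prod_eq_zero (Finset.mem_erase.mpr ⟨Ne.symm hk, Finset.mem_univ i⟩)
            (sub_self _), mul_zero, mul_zero]
        · exact fun h => absurd (Finset.mem_univ i) h
  have := congrArg (eval u) hPQ
  simp only [hP, hQ, eval_finsetSum, eval_mul, eval_C, eval_add, eval_X, eval_prod, eval_sub]
    at this
  rw [this]
  congr 1
  exact Finset.prod_congr rfl fun j _ => by ring

open Polynomial in
theorem sum_shapeWeight_mul_prod_one_sub {l : Fin R → ℕ} (hl : Function.Injective l)
    (h0 : ∃ j, l j = 0) :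
    ∑ i, C (shapeWeight (l + Pi.single i 1)) *
        ((1 + C (R : ℂ) * X) * ∏ j ∈ Finset.univ.erase i, (1 - C (addedContent l j) * X)) =
      C (shapeWeight l) * ∏ j, (1 - C (addedContent l j - 1) * X) := by
  refine Polynomial.eq_of_infinite_eval_eq _ _ (Set.Infinite.mono (s := {0}ᶜ) (fun t ht => ?_)
    (Set.finite_singleton (0 : ℂ)).infinite_compl)
  have ht : t ≠ 0 := ht
  have h := congrArg (t ^ R * ·) (sum_shapeWeight_mul_prod_sub hl h0 t⁻¹)
  simp only [Set.mem_ofPred_eq, eval_finsetSum, eval_mul, eval_C, eval_add, eval_X, eval_prod,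
    eval_sub, eval_one]
  have hm : ∀ c, 1 - c * t = t * (t⁻¹ - c) := fun c => by field_simp
  convert h using 1
  · rw [Finset.mul_sum]
    refine Finset.sum_congr rfl fun i _ => ?_
    simp only [hm]
    rw [Finset.prod_mul_distrib, Finset.prod_const, Finset.card_erase_of_mem (Finset.mem_univ i),
      Finset.card_univ, Fintype.card_fin]
    have hR : t ^ R = t * t ^ (R - 1) := by
      rw [← pow_succ', Nat.sub_add_cancel (Nat.succ_le_of_lt i.pos)]
    rw [hR]
    field_simp
  · simp only [hm]
    rw [Finset.prod_mul_distrib, Finset.prod_const, Finset.card_univ, Fintype.card_fin,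
      mul_left_comm]
    congr 2
    exact Finset.prod_congr rfl fun j _ => by ring

open PowerSeries in
theorem linear_ne_zero (c : ℂ) : (1 - C c * X : ℂ⟦X⟧) ≠ 0 := fun h => by
  have := congrArg (constantCoeff (R := ℂ)) h
  simp at this

open PowerSeries in
theorem mk_pow_mul_linear (c : ℂ) : (mk fun r => c ^ r) * (1 - C c * X : ℂ⟦X⟧) = 1 := by
  ext n
  cases n with
  | zero => simp
  | succ n =>
    rw [mul_sub, mul_one, map_sub, ← mul_assoc, coeff_succ_mul_X, coeff_mk, coeff_mul_C, coeff_mk,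
      pow_succ, sub_self, coeff_one, if_neg (Nat.succ_ne_zero n)]

open PowerSeries in
/-- The moments of the transition measure of a shape. -/
theorem sum_shapeWeight_mul_pow {l : Fin R → ℕ} (h0 : Function.Injective l → ∃ j, l j = 0)
    {b : ℕ → ℂ} (hb : mk b * ((1 + C (R : ℂ) * X) * ∏ j, (1 - C (addedContent l j) * X)) =
      ∏ j, (1 - C (addedContent l j - 1) * X)) (r : ℕ) :
    ∑ i, shapeWeight (l + Pi.single i 1) * addedContent l i ^ r = shapeWeight l * b r := by
  by_cases hw : shapeWeight l = 0
  · rw [sum_shapeWeight_mul_eq_zero hw fun c => c ^ r, hw, zero_mul]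
  have hinj := shapeWeight_ne_zero_iff.mp hw
  have key := congrArg (fun p : Polynomial ℂ => (p : ℂ⟦X⟧))
    (sum_shapeWeight_mul_prod_one_sub hinj (h0 hinj))
  have hcoe : ∀ (s : Finset (Fin R)) (f : Fin R → Polynomial ℂ),
      ((∏ j ∈ s, f j : Polynomial ℂ) : ℂ⟦X⟧) = ∏ j ∈ s, (f j : ℂ⟦X⟧) := fun s f =>
    map_prod (Polynomial.coeToPowerSeries.ringHom (R := ℂ)) f s
  have hcoe' : ∀ (s : Finset (Fin R)) (f : Fin R → Polynomial ℂ),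
      ((∑ j ∈ s, f j : Polynomial ℂ) : ℂ⟦X⟧) = ∑ j ∈ s, (f j : ℂ⟦X⟧) := fun s f =>
    map_sum (Polynomial.coeToPowerSeries.ringHom (R := ℂ)) f s
  simp only [hcoe, hcoe', Polynomial.coe_mul, Polynomial.coe_C, Polynomial.coe_sub,
    Polynomial.coe_add, Polynomial.coe_one, Polynomial.coe_X] at key
  have hne : ((1 + C (R : ℂ) * X) * ∏ j, (1 - C (addedContent l j) * X) : ℂ⟦X⟧) ≠ 0 := by
    refine mul_ne_zero ?_ (Finset.prod_ne_zero_iff.mpr fun j _ => linear_ne_zero _)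
    have := linear_ne_zero (-(R : ℂ))
    rwa [map_neg, neg_mul, sub_neg_eq_add] at this
  have hser : ∑ i, C (shapeWeight (l + Pi.single i 1)) * mk (fun r => addedContent l i ^ r) =
      C (shapeWeight l) * mk b := by
    refine mul_right_cancel₀ hne ?_
    rw [mul_assoc, hb, ← key, Finset.sum_mul]
    refine Finset.sum_congr rfl fun i _ => ?_
    rw [← Finset.mul_prod_erase _ _ (Finset.mem_univ i)]
    linear_combination (C (shapeWeight (l + Pi.single i 1)) * (1 + C (R : ℂ) * X) *
      ∏ j ∈ Finset.univ.erase i, (1 - C (addedContent l j) * X)) *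
      mk_pow_mul_linear (addedContent l i)
  have := congrArg (coeff r) hser
  simpa [map_sum] using this

/-- The shifted shape reached by a word. -/
def rowState : List (Fin R) → Fin R → ℕ
  | [] => fun j => j
  | i :: w => rowState w + Pi.single i 1

/-- The content of the box added by the letter `i` after the word `w`. -/
noncomputable def wordContent (w : List (Fin R)) (i : Fin R) : ℂ := addedContent (rowState w) i

open PowerSeries in
theorem mk_momentPair {b : ℕ → ℂ} (hb : b 0 = 1) (x : ℂ) :
    (mk fun r => (momentPair b x r).1) * ((1 - C x * X) ^ 2 - X ^ 2) =
      mk b * (1 - C x * X) ^ 2 := by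
  set A : ℂ⟦X⟧ := mk fun r => (momentPair b x r).1 with hA
  set U : ℂ⟦X⟧ := mk fun r => (momentPair b x r).2 with hU
  have h1 : U = (A + U * C x) * X := by
    ext n
    cases n with
    | zero => simp [hU, momentPair]
    | succ n => simp [hU, hA, coeff_succ_mul_X, momentPair]
  have h2 : A + mk b * C x * X = mk b + U * X + A * C x * X := by
    ext n
    cases n with
    | zero => simp [hA, momentPair, hb]
    | succ n =>
      simp only [map_add, coeff_succ_mul_X, coeff_mul_C, hA, hU, coeff_mk, momentPair]
      ring
  linear_combination (1 - C x * X) * h2 + X * h1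

open PowerSeries in
theorem mk_modelledMoment (w : List (Fin R)) :
    (mk fun r => (modelledMoment wordContent w.length r).2 w) *
      ((1 + C (R : ℂ) * X) * ∏ j, (1 - C (addedContent (rowState w) j) * X)) =
      ∏ j, (1 - C (addedContent (rowState w) j - 1) * X) := by
  induction w with
  | nil =>
    have h1 : (mk fun r => (modelledMoment (wordContent (R := R)) 0 r).2 []) = 1 := by
      ext n
      rw [coeff_mk, modelledMoment, coeff_one]
      split_ifs <;> rfl
    rw [List.length_nil, h1, one_mul]
    set φ : ℕ → ℂ⟦X⟧ := fun k => 1 - C ((k : ℂ) - R) * X with hφ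
    have e1 : ∏ j : Fin R, (1 - C (addedContent (rowState []) j) * X) =
        ∏ k ∈ Finset.range R, φ (k + 1) := by
      rw [← Fin.prod_univ_eq_prod_range]
      refine Finset.prod_congr rfl fun j _ => ?_
      rw [addedContent, rowState, hφ]
      push_cast
      congr 3
      ring
    have e2 : ∏ j : Fin R, (1 - C (addedContent (rowState []) j - 1) * X) =
        ∏ k ∈ Finset.range R, φ k := by
      rw [← Fin.prod_univ_eq_prod_range]
      refine Finset.prod_congr rfl fun j _ => ?_
      rw [addedContent, rowState, hφ]
      congr 3
      ring
    have e3 : (1 + C (R : ℂ) * X : ℂ⟦X⟧) = φ 0 := by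
      simp only [hφ, Nat.cast_zero, zero_sub, map_neg, neg_mul, sub_neg_eq_add]
    have e4 : φ R = 1 := by
      simp only [hφ, sub_self, map_zero, zero_mul, sub_zero]
    rw [e1, e2, e3, mul_comm, ← Finset.prod_range_succ', Finset.prod_range_succ, e4, mul_one]
  | cons i w ih =>
    set c := addedContent (rowState w) i with hc
    have hb0 : (modelledMoment (wordContent (R := R)) w.length 0).2 w = 1 := by
      cases w.length with
      | zero => rfl
      | succ n => rfl
    have h1 : ∀ r, (modelledMoment (wordContent (R := R)) (i :: w).length r).2 (i :: w) =
        (momentPair (fun r => (modelledMoment (wordContent (R := R)) w.length r).2 w) c r).1 := by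
      intro r
      have h2 := map_momentPair ((Pi.evalRingHom (fun _ : List (Fin R) => ℂ) (i :: w)).comp
        (RingHom.snd (MonoidAlgebra ℂ (Equiv.Perm ℕ)) (List (Fin R) → ℂ)))
        (modelledMoment wordContent w.length) (modelledJucysMurphy wordContent w.length) r
      have h3 : (fun r => ((Pi.evalRingHom (fun _ : List (Fin R) => ℂ) (i :: w)).comp
        (RingHom.snd (MonoidAlgebra ℂ (Equiv.Perm ℕ)) (List (Fin R) → ℂ)))
        (modelledMoment wordContent w.length r)) =
          fun r => (modelledMoment (wordContent (R := R)) w.length r).2 w :=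
        funext fun r => snd_cons_of_mem (modelledMoment_mem _ _) i rfl
      have h4 : ((Pi.evalRingHom (fun _ : List (Fin R) => ℂ) (i :: w)).comp
        (RingHom.snd (MonoidAlgebra ℂ (Equiv.Perm ℕ)) (List (Fin R) → ℂ)))
        (modelledJucysMurphy wordContent w.length) = c := if_pos rfl
      rw [h3, h4] at h2
      exact (congrArg Prod.fst h2).symm
    simp only [h1]
    have h5 := mk_momentPair (b := fun r => (modelledMoment (wordContent (R := R)) w.length r).2 w) hb0 c
    set A : ℂ⟦X⟧ := mk fun r =>
      (momentPair (fun r => (modelledMoment (wordContent (R := R)) w.length r).2 w) c r).1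
    set B : ℂ⟦X⟧ := mk fun r => (modelledMoment (wordContent (R := R)) w.length r).2 w
    have hci : addedContent (rowState (i :: w)) i = c + 1 := by
      rw [hc, addedContent, addedContent, rowState]
      simp
      ring
    have hcj : ∀ j ∈ Finset.univ.erase i, addedContent (rowState (i :: w)) j =
        addedContent (rowState w) j := fun j hj => by
      rw [addedContent, addedContent, rowState]
      simp [Finset.ne_of_mem_erase hj]
    rw [← Finset.mul_prod_erase _ _ (Finset.mem_univ i),
      ← Finset.mul_prod_erase _ (fun j => (1 - C (addedContent (rowState (i :: w)) j - 1) * X))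
        (Finset.mem_univ i), hci,
      Finset.prod_congr rfl fun j hj => by rw [hcj j hj],
      Finset.prod_congr (s₁ := Finset.univ.erase i)
        (f := fun j => (1 - C (addedContent (rowState (i :: w)) j - 1) * X)) rfl
        fun j hj => by rw [hcj j hj]]
    rw [← Finset.mul_prod_erase _ _ (Finset.mem_univ i),
      ← Finset.mul_prod_erase _ (fun j => (1 - C (addedContent (rowState w) j - 1) * X))
        (Finset.mem_univ i), ← hc] at ih
    refine mul_right_cancel₀ (mul_ne_zero (linear_ne_zero c) (linear_ne_zero (c - 1))) ?_
    rw [map_add, map_one, map_sub, map_one] at *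
    rw [add_sub_cancel_right]
    set D := ∏ j ∈ Finset.univ.erase i, (1 - C (addedContent (rowState w) j) * X)
    linear_combination ((1 + C (R : ℂ) * X) * (1 - C c * X) * D) * h5 + (1 - C c * X) ^ 2 * ih

theorem sum_rowState (w : List (Fin R)) :
    ∑ j, rowState w j = (∑ j : Fin R, (j : ℕ)) + w.length := by
  induction w with
  | nil => rfl
  | cons i w ih =>
    simp only [rowState, Pi.add_apply, Finset.sum_add_distrib, ih, List.length_cons]
    rw [Finset.sum_pi_single']
    simp [add_assoc]

theorem sum_range_succ_le_sum {B : Finset ℕ} (hB : 0 ∉ B) :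
    ∑ k ∈ Finset.range (B.card + 1), k ≤ ∑ k ∈ B, k := by
  induction B using Finset.induction_on_max with
  | empty => simp
  | insert a S h ih =>
    have ha : a ∉ S := fun h' => (h a h').false
    rw [Finset.card_insert_of_notMem ha, Finset.sum_insert ha, Finset.sum_range_succ, add_comm]
    have h1 := ih fun h0 => hB (Finset.mem_insert_of_mem h0)
    have h2 : S.card ≤ a - 1 := by
      have : S ⊆ Finset.Ico 1 a := fun k hk => Finset.mem_Ico.mpr
        ⟨Nat.one_le_iff_ne_zero.mpr fun h0 => hB (h0 ▸ Finset.mem_insert_of_mem hk), h k hk⟩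
      simpa using Finset.card_le_card this
    have h3 : a ≠ 0 := fun h0 => hB (h0 ▸ Finset.mem_insert_self a S)
    omega

theorem exists_rowState_eq_zero {w : List (Fin R)} (hw : w.length < R)
    (hinj : Function.Injective (rowState w)) : ∃ j, rowState w j = 0 := by
  by_contra! h
  have h1 := sum_range_succ_le_sum (B := Finset.univ.image (rowState w)) fun h0 => by
    obtain ⟨j, -, hj⟩ := Finset.mem_image.mp h0
    exact h j hj
  rw [Finset.card_image_of_injective _ hinj, Finset.card_univ, Fintype.card_fin,
    Finset.sum_image (fun _ _ _ _ h => hinj h), sum_rowState, Finset.sum_range_succ,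
    ← Fin.sum_univ_eq_sum_range fun k => k] at h1
  omega

theorem shapeWeight_rowState_nil : shapeWeight (rowState ([] : List (Fin R))) = 1 := by
  rw [shapeWeight, div_eq_one_iff_eq (prod_factorial_ne_zero _)]
  obtain _ | n := R
  · simp
  · have h1 := Matrix.det_vandermonde_id_eq_superFactorial (R := ℂ) n
    have h2 := Nat.prod_range_succ_factorial n
    rw [← Fin.prod_univ_eq_prod_range] at h2
    simp only [rowState]
    rw [h1, ← h2]
    push_cast
    rfl

theorem coeff_one_eq_wordSum_shapeWeight {n : ℕ} (hn : n ≤ R)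
    {z : MonoidAlgebra ℂ (Equiv.Perm ℕ) × (List (Fin R) → ℂ)}
    (hz : z ∈ modelledAlgebra wordContent n) :
    z.1.coeff 1 = wordSum n fun w => shapeWeight (rowState w) * z.2 w :=
  coeff_one_eq_wordSum (D := R) shapeWeight_rowState_nil (fun w hw r =>
    sum_shapeWeight_mul_pow (exists_rowState_eq_zero hw) (mk_modelledMoment w) r) hn hz

end Transition

end StrongCoupling

namespace StrongCoupling

/-! ### The Neumann series of Jucys-Murphy elements -/

section Neumann

/-- The lists of length less than `M` with entries in `A`. -/
def boundedLists {α : Type*} [DecidableEq α] (A : Finset α) : ℕ → Finset (List α)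
  | 0 => ∅
  | M + 1 => insert [] ((A ×ˢ boundedLists A M).image fun p => p.1 :: p.2)

theorem mem_boundedLists {α : Type*} [DecidableEq α] {A : Finset α} {M : ℕ} {l : List α} :
    l ∈ boundedLists A M ↔ l.length < M ∧ ∀ s ∈ l, s ∈ A := by
  induction M generalizing l with
  | zero => simp [boundedLists]
  | succ M ih =>
    rw [boundedLists, Finset.mem_insert, Finset.mem_image]
    constructor
    · rintro (rfl | ⟨⟨s, l⟩, h, rfl⟩)
      · simp
      · rw [Finset.mem_product, ih] at h
        refine ⟨by simpa using h.2.1, fun u hu => ?_⟩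
        rcases List.mem_cons.mp hu with rfl | hu
        · exact h.1
        · exact h.2.2 u hu
    · rintro ⟨h1, h2⟩
      cases l with
      | nil => exact Or.inl rfl
      | cons s l =>
        refine Or.inr ⟨(s, l), ?_, rfl⟩
        rw [Finset.mem_product, ih]
        exact ⟨h2 s (by simp), by simpa using h1, fun u hu => h2 u (by simp [hu])⟩

theorem sum_boundedLists {α B : Type*} [DecidableEq α] [Ring B] (A : Finset α) (f : α → B)
    (M : ℕ) : ∑ l ∈ boundedLists A M, (l.map f).prod =
      ∑ m ∈ Finset.range M, (∑ s ∈ A, f s) ^ m := by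
  induction M with
  | zero => simp [boundedLists]
  | succ M ih =>
    rw [boundedLists, Finset.sum_insert, Finset.sum_image, Finset.sum_product, Finset.sum_range_succ']
    · simp only [List.map_cons, List.prod_cons, ← Finset.mul_sum, ih, pow_succ', ← Finset.sum_mul]
      rw [add_comm, pow_zero]
      rfl
    · rintro ⟨s, l⟩ _ ⟨s', l'⟩ _ h
      simpa using h
    · rw [Finset.mem_image]
      rintro ⟨p, -, hp⟩
      exact List.cons_ne_nil _ _ hp

theorem viaEmbeddingHom_swap {d : ℕ} (s t : Fin d) :
    Equiv.Perm.viaEmbeddingHom Fin.valEmbedding (Equiv.swap s t) =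
      Equiv.swap (s : ℕ) (t : ℕ) := by
  rw [Equiv.Perm.viaEmbeddingHom_apply]
  ext n
  by_cases hn : n < d
  · have h1 := Equiv.Perm.viaEmbedding_apply (Equiv.swap s t) Fin.valEmbedding (⟨n, hn⟩ : Fin d)
    have h2 : Fin.valEmbedding (⟨n, hn⟩ : Fin d) = n := rfl
    rw [h2] at h1
    rw [h1]
    by_cases hs : (⟨n, hn⟩ : Fin d) = s
    · subst hs
      rw [Equiv.swap_apply_left, Equiv.swap_apply_left]
      rfl
    by_cases ht : (⟨n, hn⟩ : Fin d) = t
    · subst ht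
      rw [Equiv.swap_apply_right, Equiv.swap_apply_right]
      rfl
    rw [Equiv.swap_apply_of_ne_of_ne hs ht, Equiv.swap_apply_of_ne_of_ne]
    · rfl
    · rintro rfl; exact hs rfl
    · rintro rfl; exact ht rfl
  · rw [Equiv.Perm.viaEmbedding_apply_of_notMem, Equiv.swap_apply_of_ne_of_ne]
    · have := s.isLt; omega
    · have := t.isLt; omega
    · rintro ⟨k, hk⟩
      exact hn (hk ▸ k.isLt)

variable {d : ℕ}

theorem sum_single_swap (x : ℂ) (t : Fin d) :
    ∑ s ∈ Finset.univ.filter (· < t),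
      (MonoidAlgebra.single (Equiv.Perm.viaEmbeddingHom Fin.valEmbedding (Equiv.swap s t)) x) =
      x • jucysMurphy t := by
  rw [jucysMurphy, Finset.smul_sum]
  refine Finset.sum_nbij (fun s => (s : ℕ)) (fun s hs => ?_) (fun s _ s' _ h => Fin.ext h)
    (fun k hk => ?_) fun s _ => ?_
  · exact Finset.mem_range.mpr (Finset.mem_filter.mp hs).2
  · have hk : k < t := Finset.mem_range.mp hk
    exact ⟨⟨k, hk.trans t.isLt⟩, Finset.mem_filter.mpr ⟨Finset.mem_univ _, hk⟩, rfl⟩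
  · rw [viaEmbeddingHom_swap, MonoidAlgebra.smul_single, smul_eq_mul, mul_one]

theorem prod_map_single (x : ℂ) (t : Fin d) (l : List (Fin d)) :
    (l.map fun s => (MonoidAlgebra.single
      (Equiv.Perm.viaEmbeddingHom Fin.valEmbedding (Equiv.swap s t)) x)).prod =
    MonoidAlgebra.single (Equiv.Perm.viaEmbeddingHom Fin.valEmbedding (wordStep t l))
      (x ^ l.length) := by
  induction l with
  | nil => rw [wordStep_nil, map_one]; rfl
  | cons s l ih =>
    rw [List.map_cons, List.prod_cons, ih, MonoidAlgebra.single_mul_single, ← map_mul,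
      List.length_cons, pow_succ']
    rfl

theorem prod_ofFn_single (x : ℂ) (L : Fin d → List (Fin d)) :
    (List.ofFn fun t => (MonoidAlgebra.single
      (Equiv.Perm.viaEmbeddingHom Fin.valEmbedding (wordStep t (L t))) (x ^ (L t).length))).prod =
    MonoidAlgebra.single (Equiv.Perm.viaEmbeddingHom Fin.valEmbedding (wordProd L))
      (x ^ wordLength L) := by
  rw [wordProd, wordLength, ← List.sum_ofFn, List.ofFn_eq_map, List.ofFn_eq_map]
  induction List.finRange d with
  | nil => simp [MonoidAlgebra.one_def]
  | cons t m ih =>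
    rw [List.map_cons, List.prod_cons, ih, MonoidAlgebra.single_mul_single, ← map_mul,
      List.map_cons, List.map_cons, List.sum_cons, pow_add, List.prod_cons]

/-- The partial Neumann series for the product of the elements `1 - x J`. -/
noncomputable def neumannProduct {ι : Type*} (κ : List ι → ι → ℂ) (d : ℕ) (x : ℂ) (M : ℕ) :
    MonoidAlgebra ℂ (Equiv.Perm ℕ) × (List ι → ℂ) :=
  (List.ofFn fun t : Fin d => ∑ m ∈ Finset.range M, (x • modelledJucysMurphy κ t) ^ m).prod

theorem neumannProduct_mem {ι : Type*} (κ : List ι → ι → ℂ) (d : ℕ) (x : ℂ) (M : ℕ) :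
    neumannProduct κ d x M ∈ modelledAlgebra κ d := by
  refine list_prod_mem fun z hz => ?_
  obtain ⟨t, rfl⟩ := (List.mem_ofFn' _ _).mp hz
  exact sum_mem fun m _ => pow_mem (Subalgebra.smul_mem _ (modelledJucysMurphy_mem t.isLt) x) m

theorem coeff_neumannProduct_fst {ι : Type*} (κ : List ι → ι → ℂ) (x : ℂ) (M : ℕ) :
    (neumannProduct κ d x M).1.coeff 1 =
      ∑ L ∈ Fintype.piFinset fun t : Fin d => boundedLists (Finset.univ.filter (· < t)) M,
        if wordProd L = 1 then x ^ wordLength L else 0 := by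
  classical
  have h1 : (neumannProduct κ d x M).1 = (List.ofFn fun t : Fin d =>
      ∑ l ∈ boundedLists (Finset.univ.filter (· < t)) M, (MonoidAlgebra.single
        (Equiv.Perm.viaEmbeddingHom Fin.valEmbedding (wordStep t l)) (x ^ l.length))).prod := by
    have h2 := map_list_prod (RingHom.fst (MonoidAlgebra ℂ (Equiv.Perm ℕ)) (List ι → ℂ))
      (List.ofFn fun t : Fin d => ∑ m ∈ Finset.range M, (x • modelledJucysMurphy κ t) ^ m)
    rw [List.map_ofFn] at h2
    refine h2.trans ?_
    congr 2
    funext t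
    rw [Function.comp_apply, map_sum]
    simp only [← prod_map_single]
    rw [sum_boundedLists, sum_single_swap]
    rfl
  rw [h1, ← MultilinearMap.mkPiAlgebraFin_apply (R := ℂ), MultilinearMap.map_sum_finset,
    MonoidAlgebra.coeff_sum, Finsupp.finsetSum_apply]
  refine Finset.sum_congr rfl fun L _ => ?_
  rw [MultilinearMap.mkPiAlgebraFin_apply, prod_ofFn_single, MonoidAlgebra.coeff_single,
    Finsupp.single_apply]
  have : Equiv.Perm.viaEmbeddingHom Fin.valEmbedding (wordProd L) = 1 ↔ wordProd L = 1 :=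
    map_eq_one_iff _ (Equiv.Perm.viaEmbeddingHom_injective _)
  simp only [this]

theorem neumannProduct_snd {ι : Type*} (κ : List ι → ι → ℂ) (x : ℂ) (M : ℕ) (w : List ι) :
    (neumannProduct κ d x M).2 w =
      ∏ t : Fin d, ∑ m ∈ Finset.range M, (x * stepValue κ t w) ^ m := by
  have h := map_list_prod ((Pi.evalRingHom (fun _ : List ι => ℂ) w).comp
    (RingHom.snd (MonoidAlgebra ℂ (Equiv.Perm ℕ)) (List ι → ℂ)))
    (List.ofFn fun t : Fin d => ∑ m ∈ Finset.range M, (x • modelledJucysMurphy κ t) ^ m)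
  rw [List.map_ofFn, List.prod_ofFn] at h
  refine h.trans (Finset.prod_congr rfl fun t _ => ?_)
  rw [Function.comp_apply, map_sum]
  rfl

theorem tendsto_sum_piFinset_boundedLists {f : (Fin d → List (Fin d)) → ℂ}
    (hf : Summable fun L : Word (Finset.univ : Finset (Fin d)) => f L.1) :
    Filter.Tendsto (fun M => ∑ L ∈ Fintype.piFinset fun t : Fin d =>
      boundedLists (Finset.univ.filter (· < t)) M, f L) Filter.atTop
      (nhds (∑' L : Word (Finset.univ : Finset (Fin d)), f L.1)) := by
  classical
  have hmem : ∀ M (L : Fin d → List (Fin d)), (L ∈ Fintype.piFinset fun t : Fin d =>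
      boundedLists (Finset.univ.filter (· < t)) M) ↔
      (∀ t, (L t).length < M) ∧ Admissible Finset.univ L := by
    intro M L
    simp only [Fintype.mem_piFinset, mem_boundedLists, Finset.mem_filter, Finset.mem_univ,
      true_and, Admissible, forall_and]
  have h1 : Filter.Tendsto (fun M => (Fintype.piFinset fun t : Fin d =>
      boundedLists (Finset.univ.filter (· < t)) M).subtype (Admissible Finset.univ))
      Filter.atTop Filter.atTop := by
    refine Filter.tendsto_atTop_finset_of_monotone (fun M M' h L hL => ?_) fun L => ?_
    · rw [Finset.mem_subtype, hmem] at hL ⊢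
      exact ⟨fun t => (hL.1 t).trans_le h, hL.2⟩
    · refine ⟨wordLength L.1 + 1, ?_⟩
      rw [Finset.mem_subtype, hmem]
      refine ⟨fun t => Nat.lt_succ_of_le ?_, L.2⟩
      exact Finset.single_le_sum (f := fun t => (L.1 t).length) (fun _ _ => Nat.zero_le _)
        (Finset.mem_univ t)
  refine (hf.hasSum.comp h1).congr fun M => ?_
  exact Finset.sum_subtype_of_mem f fun L hL => ((hmem M L).mp hL).2

theorem tendsto_wordSum {ι : Type*} [Fintype ι] {n : ℕ} {F : ℕ → List ι → ℂ} {f : List ι → ℂ}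
    (h : ∀ w, w.length = n → Filter.Tendsto (fun M => F M w) Filter.atTop (nhds (f w))) :
    Filter.Tendsto (fun M => wordSum n (F M)) Filter.atTop (nhds (wordSum n f)) := by
  induction n generalizing F f with
  | zero => exact h [] rfl
  | succ n ih =>
    exact ih fun w hw => tendsto_finsetSum _ fun i _ => h (i :: w) (by simp [hw])

theorem rowState_le {R : ℕ} (w : List (Fin R)) (i : Fin R) : rowState w i ≤ i + w.length := by
  induction w with
  | nil => exact le_rfl
  | cons j w ih =>
    rw [rowState, Pi.add_apply, List.length_cons]
    have : (Pi.single j 1 : Fin R → ℕ) i ≤ 1 := by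
      by_cases h : i = j
      · rw [h, Pi.single_eq_same]
      · rw [Pi.single_eq_of_ne h]; exact Nat.zero_le 1
    omega

theorem norm_stepValue_wordContent_le {w : List (Fin d)} (hd : 1 ≤ d) (hw : w.length ≤ d)
    (t : ℕ) : ‖stepValue wordContent t w‖ ≤ (d : ℝ) - 1 := by
  have hd' : (1 : ℝ) ≤ d := by exact_mod_cast hd
  induction w with
  | nil => rw [stepValue, norm_zero]; linarith
  | cons i w ih =>
    rw [List.length_cons] at hw
    rw [stepValue]
    split_ifs
    · have h1 : wordContent w i = (((rowState w i : ℝ) - d + 1 : ℝ) : ℂ) := by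
        rw [wordContent, addedContent]; push_cast; rfl
      have h2 : (rowState w i : ℝ) ≤ i + w.length := by exact_mod_cast rowState_le w i
      have h3 : (i : ℝ) + 1 ≤ d := by exact_mod_cast i.isLt
      have h4 : (w.length : ℝ) + 1 ≤ d := by exact_mod_cast hw
      have h5 : (0 : ℝ) ≤ rowState w i := Nat.cast_nonneg _
      rw [h1, Complex.norm_real, Real.norm_eq_abs, abs_le]
      constructor <;> linarith
    · exact ih (by omega)

theorem tsum_word_eq_wordSum {x : ℂ} (hd : 1 ≤ d) (hx : ((d : ℝ) - 1) * ‖x‖ < 1) :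
    ∑' L : Word (Finset.univ : Finset (Fin d)), (if wordProd L.1 = 1 then x ^ wordLength L.1 else 0)
      = wordSum d fun w : List (Fin d) => shapeWeight (rowState w) *
        ∏ t : Fin d, (1 - x * stepValue wordContent t w)⁻¹ := by
  have h1 : Summable fun L : Word (Finset.univ : Finset (Fin d)) =>
      if wordProd L.1 = 1 then x ^ wordLength L.1 else 0 := by
    refine Summable.of_norm_bounded (summable_pow_wordLength Finset.univ (norm_nonneg x)
      (by simpa using hx)) fun L => ?_
    split_ifs
    · rw [norm_pow]
    · rw [norm_zero]; positivity
  refine tendsto_nhds_unique (tendsto_sum_piFinset_boundedLists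
    (f := fun L => if wordProd L = 1 then x ^ wordLength L else 0) h1) ?_
  have h2 : ∀ M, (∑ L ∈ Fintype.piFinset fun t : Fin d =>
      boundedLists (Finset.univ.filter (· < t)) M, if wordProd L = 1 then x ^ wordLength L else 0) =
      wordSum d fun w : List (Fin d) => shapeWeight (rowState w) *
        ∏ t : Fin d, ∑ m ∈ Finset.range M, (x * stepValue wordContent t w) ^ m := by
    intro M
    rw [← coeff_neumannProduct_fst wordContent, coeff_one_eq_wordSum_shapeWeight le_rfl
      (neumannProduct_mem _ d x M)]
    simp only [neumannProduct_snd]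
  simp only [h2]
  refine tendsto_wordSum fun w hw => Filter.Tendsto.const_mul _ (tendsto_finsetProd _ fun t _ => ?_)
  refine (hasSum_geometric_of_norm_lt_one ?_).tendsto_sum_nat
  rw [norm_mul, mul_comm]
  exact (mul_le_mul_of_nonneg_right (norm_stepValue_wordContent_le hd hw.le t)
    (norm_nonneg x)).trans_lt hx

end Neumann

/-! ### Antisymmetrization -/

section Antisymmetrization

variable {R : ℕ}

/-- The product of `g` over the contents of the boxes of a shifted shape. -/
def contentProd (g : ℂ → ℂ) (l : Fin R → ℕ) : ℂ :=
  ∏ i, ∏ k ∈ Finset.range (l i), g ((k : ℂ) - R + 1)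

theorem contentProd_comp_perm (g : ℂ → ℂ) (l : Fin R → ℕ) (σ : Equiv.Perm (Fin R)) :
    contentProd g (l ∘ σ) = contentProd g l :=
  Equiv.prod_comp σ fun i => ∏ k ∈ Finset.range (l i), g ((k : ℂ) - R + 1)

theorem contentProd_add_single (g : ℂ → ℂ) (l : Fin R → ℕ) (i : Fin R) :
    contentProd g (l + Pi.single i 1) = contentProd g l * g (addedContent l i) := by
  rw [contentProd, contentProd, ← Finset.mul_prod_erase _ _ (Finset.mem_univ i),
    ← Finset.mul_prod_erase _ (fun i => ∏ k ∈ Finset.range (l i), g ((k : ℂ) - R + 1))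
      (Finset.mem_univ i), Pi.add_apply, Pi.single_eq_same, Finset.prod_range_succ,
    Finset.prod_congr (s₂ := Finset.univ.erase i) rfl fun j hj => by
      rw [Pi.add_apply, Pi.single_eq_of_ne (Finset.ne_of_mem_erase hj), add_zero]]
  rw [addedContent]
  ring

theorem prod_stepValue_mul_contentProd (g : ℂ → ℂ) (w : List (Fin R)) :
    (∏ t ∈ Finset.range w.length, g (stepValue wordContent t w)) *
      contentProd g (rowState ([] : List (Fin R))) =
      contentProd g (rowState w) := by
  induction w with
  | nil => rw [List.length_nil, Finset.range_zero, Finset.prod_empty, one_mul]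
  | cons i w ih =>
    have h0 : rowState (i :: w) = rowState w + Pi.single i 1 := rfl
    rw [List.length_cons, Finset.prod_range_succ, h0, contentProd_add_single, ← ih]
    have h1 : stepValue wordContent w.length (i :: w) = addedContent (rowState w) i := if_pos rfl
    have h2 : ∀ t ∈ Finset.range w.length, g (stepValue wordContent t (i :: w)) =
        g (stepValue wordContent t w) := fun t ht =>
      congrArg g (if_neg (Finset.mem_range.mp ht).ne')
    rw [h1, Finset.prod_congr rfl h2]
    ring

open MvPolynomial in
theorem wordSum_rowState (n : ℕ) (h : (Fin R → ℕ) → ℂ) :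
    wordSum n (fun w => h (rowState w)) = ∑ m ∈ Finset.piAntidiag Finset.univ n,
      (Nat.multinomial Finset.univ m : ℂ) * h (rowState ([] : List (Fin R)) + m) := by
  obtain ⟨Λ, hmon⟩ : ∃ Λ : ((Fin R → ℕ) → ℂ) → MvPolynomial (Fin R) ℂ →ₗ[ℂ] ℂ,
      ∀ (h : (Fin R → ℕ) → ℂ) (m : Fin R →₀ ℕ) (c : ℂ), Λ h (monomial m c) =
        c * h (rowState ([] : List (Fin R)) + (m : Fin R → ℕ)) := by
    refine ⟨fun h => (basisMonomials (Fin R) ℂ).constr ℂ fun m =>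
      h (rowState ([] : List (Fin R)) + (m : Fin R → ℕ)), fun h m c => ?_⟩
    have h1 : monomial m c = c • basisMonomials (Fin R) ℂ m := by
      rw [coe_basisMonomials, smul_monomial, smul_eq_mul, mul_one]
    rw [h1, map_smul, Module.Basis.constr_basis, smul_eq_mul]
  have hX : ∀ (h : (Fin R → ℕ) → ℂ) (p : MvPolynomial (Fin R) ℂ), Λ h (p * ∑ i, X i) =
      Λ (fun l => ∑ i, h (l + Pi.single i 1)) p := by
    intro h p
    induction p using MvPolynomial.induction_on' with
    | monomial m c =>
      refine Eq.trans ?_ (hmon (fun l => ∑ i, h (l + Pi.single i 1)) m c).symm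
      rw [Finset.mul_sum, map_sum, Finset.mul_sum]
      refine Finset.sum_congr rfl fun i _ => ?_
      rw [X, monomial_mul, hmon, mul_one, Finsupp.coe_add, ← add_assoc, Finsupp.single_eq_pi_single]
    | add p q hp hq => rw [add_mul, map_add, map_add, hp, hq]
  have hmain : ∀ (n : ℕ) (h : (Fin R → ℕ) → ℂ), wordSum n (fun w => h (rowState w)) =
      Λ h ((∑ i, X i) ^ n) := by
    intro n
    induction n with
    | zero =>
      intro h
      have := hmon h 0 1
      rw [Finsupp.coe_zero, add_zero, one_mul] at this
      exact this.symm
    | succ n ih =>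
      intro h
      rw [pow_succ, hX]
      exact ih fun l => ∑ i, h (l + Pi.single i 1)
  rw [hmain, Finset.sum_pow_eq_sum_piAntidiag, map_sum]
  refine Finset.sum_congr rfl fun m _ => ?_
  have h1 : (Nat.multinomial Finset.univ m : MvPolynomial (Fin R) ℂ) * ∏ i, X i ^ m i =
      monomial (Finsupp.equivFunOnFinite.symm m) (Nat.multinomial Finset.univ m : ℂ) := by
    rw [monomial_eq, map_natCast, Finsupp.prod_fintype _ _ fun i => pow_zero _]
    rfl
  rw [h1, hmon]
  rfl

theorem det_descFactorial (l : Fin R → ℕ) :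
    (Matrix.of fun i j : Fin R => ((l i).descFactorial j : ℂ)).det =
      (Matrix.vandermonde fun i => (l i : ℂ)).det := by
  rw [Matrix.det_eval_matrixOfPolynomials_eq_det_vandermonde _ (fun j => descPochhammer ℂ j)
    (fun j => descPochhammer_natDegree ℂ j) fun j => monic_descPochhammer ℂ j]
  congr 1
  ext i j
  rw [Matrix.of_apply, Matrix.of_apply, descPochhammer_eval_eq_descFactorial]

theorem sum_multinomial_eq (n : ℕ) (h : (Fin R → ℕ) → ℂ) :
    ∑ m ∈ Finset.piAntidiag Finset.univ n, (Nat.multinomial Finset.univ m : ℂ) *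
      h (rowState ([] : List (Fin R)) + m) = (n.factorial : ℂ) *
      ∑ l ∈ Finset.piAntidiag Finset.univ (n + ∑ j : Fin R, (j : ℕ)),
        h l * ∏ j, ((l j).descFactorial j : ℂ) / (l j).factorial := by
  rw [Finset.mul_sum]
  refine Finset.sum_bij_ne_zero (fun m _ _ => rowState ([] : List (Fin R)) + m) (fun m hm _ => ?_)
    (fun m _ _ m' _ _ hmm => add_left_cancel hmm) (fun l hl hne => ?_) fun m hm _ => ?_
  · rw [Finset.mem_piAntidiag] at hm ⊢
    refine ⟨?_, fun i _ => Finset.mem_univ i⟩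
    simp only [Pi.add_apply, Finset.sum_add_distrib]
    rw [hm.1, add_comm]
    rfl
  · have hle : ∀ j : Fin R, (j : ℕ) ≤ l j := by
      intro j
      by_contra! hj
      apply hne
      rw [Finset.prod_eq_zero (Finset.mem_univ j), mul_zero, mul_zero]
      rw [Nat.descFactorial_eq_zero_iff_lt.mpr hj, Nat.cast_zero, zero_div]
    have hl0 : rowState ([] : List (Fin R)) + (fun j => l j - (j : ℕ)) = l := funext fun j => by
      rw [Pi.add_apply, rowState]
      exact Nat.add_sub_cancel' (hle j)
    have hmem : (fun j => l j - (j : ℕ)) ∈ Finset.piAntidiag (Finset.univ : Finset (Fin R)) n := by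
      rw [Finset.mem_piAntidiag] at hl ⊢
      refine ⟨?_, fun i _ => Finset.mem_univ i⟩
      have h1 := hl.1
      rw [← hl0] at h1
      simp only [Pi.add_apply, Finset.sum_add_distrib, rowState] at h1
      omega
    refine ⟨_, hmem, ?_, hl0⟩
    rw [hl0]
    refine mul_ne_zero ?_ fun h0 => hne (by rw [h0, zero_mul, mul_zero])
    exact_mod_cast (Nat.multinomial_pos _ _).ne'
  · rw [Finset.mem_piAntidiag] at hm
    have h1 := Nat.multinomial_spec Finset.univ m
    rw [hm.1] at h1
    have h2 : ∏ j, (((rowState ([] : List (Fin R)) + m) j).descFactorial j : ℂ) /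
        (((rowState ([] : List (Fin R)) + m) j).factorial : ℂ) = (∏ j, ((m j).factorial : ℂ))⁻¹ := by
      rw [← Finset.prod_inv_distrib]
      refine Finset.prod_congr rfl fun j _ => ?_
      have h3 := Nat.factorial_mul_descFactorial (Nat.le_add_right (j : ℕ) (m j))
      rw [Nat.add_sub_cancel_left] at h3
      have h4 : (rowState ([] : List (Fin R)) + m) j = j + m j := rfl
      rw [h4, ← h3]
      have h5 : ((m j).factorial : ℂ) ≠ 0 := Nat.cast_ne_zero.mpr (Nat.factorial_ne_zero _)
      have h6 : (((j : ℕ) + m j).descFactorial j : ℂ) ≠ 0 := Nat.cast_ne_zero.mpr fun h0 =>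
        (Nat.descFactorial_eq_zero_iff_lt.mp h0).not_ge (Nat.le_add_right _ _)
      push_cast
      field_simp
    have h7 := prod_factorial_ne_zero m
    have h8 : (n.factorial : ℂ) = (∏ j, ((m j).factorial : ℂ)) *
        (Nat.multinomial Finset.univ m : ℂ) := by
      rw [← h1]; push_cast; rfl
    rw [h2, h8]
    field_simp

theorem factorial_mul_sum_antisymmetrize (T : Finset (Fin R → ℕ))
    (hT : ∀ (σ : Equiv.Perm (Fin R)) (l : Fin R → ℕ), l ∘ σ ∈ T ↔ l ∈ T) (g : ℂ → ℂ) :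
    (R.factorial : ℂ) * ∑ l ∈ T, shapeWeight l * contentProd g l *
        ∏ j, ((l j).descFactorial j : ℂ) / (l j).factorial =
      ∑ l ∈ T, shapeWeight l ^ 2 * contentProd g l := by
  have h1 : ∀ σ : Equiv.Perm (Fin R), ∑ l ∈ T, shapeWeight l * contentProd g l *
        ∏ j, ((l j).descFactorial j : ℂ) / (l j).factorial =
      ∑ l ∈ T, shapeWeight l * contentProd g l / (∏ j, ((l j).factorial : ℂ)) *
        ((Equiv.Perm.sign σ : ℤ) * ∏ j, ((l (σ j)).descFactorial j : ℂ)) := by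
    intro σ
    refine Finset.sum_nbij' (fun l => l ∘ ⇑(σ⁻¹)) (fun l => l ∘ σ) (fun l hl => (hT _ _).mpr hl)
      (fun l hl => (hT _ _).mpr hl) (fun l _ => by funext j; simp) (fun l _ => by funext j; simp)
      fun l _ => ?_
    have h2 : ∏ j, (((l ∘ ⇑(σ⁻¹)) j).factorial : ℂ) = ∏ j, ((l j).factorial : ℂ) :=
      Equiv.prod_comp σ⁻¹ fun j => ((l j).factorial : ℂ)
    have h3 : ((Equiv.Perm.sign σ : ℤ) : ℂ) * (Equiv.Perm.sign σ : ℤ) = 1 := by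
      norm_cast
      rw [Int.units_mul_self]
      rfl
    rw [shapeWeight_comp_perm, contentProd_comp_perm, h2, Equiv.Perm.sign_inv,
      Finset.prod_div_distrib]
    have h4 : ∀ j, (l ∘ ⇑(σ⁻¹)) (σ j) = l j := fun j => by simp
    simp only [h4]
    linear_combination (-(shapeWeight l * contentProd g l * (∏ j, ((l j).descFactorial j : ℂ)) /
      ∏ j, ((l j).factorial : ℂ))) * h3
  calc (R.factorial : ℂ) * ∑ l ∈ T, shapeWeight l * contentProd g l *
        ∏ j, ((l j).descFactorial j : ℂ) / (l j).factorial
      = ∑ σ : Equiv.Perm (Fin R), ∑ l ∈ T,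
        shapeWeight l * contentProd g l / (∏ j, ((l j).factorial : ℂ)) *
        ((Equiv.Perm.sign σ : ℤ) * ∏ j, ((l (σ j)).descFactorial j : ℂ)) := by
        rw [Finset.sum_congr rfl fun σ _ => (h1 σ).symm, Finset.sum_const, Finset.card_univ,
          Fintype.card_perm, Fintype.card_fin, nsmul_eq_mul]
    _ = _ := by
        rw [Finset.sum_comm]
        refine Finset.sum_congr rfl fun l _ => ?_
        rw [← Finset.mul_sum]
        have h4 := det_descFactorial l
        rw [Matrix.det_apply'] at h4
        simp only [Matrix.of_apply] at h4
        rw [h4]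
        have h5 : (Matrix.vandermonde fun i => (l i : ℂ)).det =
            shapeWeight l * ∏ j, ((l j).factorial : ℂ) :=
          (div_mul_cancel₀ _ (prod_factorial_ne_zero l)).symm
        have h6 := prod_factorial_ne_zero l
        rw [h5]
        field_simp

end Antisymmetrization

end StrongCoupling

namespace StrongCoupling

/-! ### Shapes of Young diagrams and the hook formula -/

section Shape

variable {R : ℕ}

/-- The shifted row lengths of a Young diagram, in increasing order. -/
def shiftedRows (R : ℕ) (Y : YoungDiagram) (j : Fin R) : ℕ := j + Y.rowLen (Fin.rev j)

theorem strictMono_shiftedRows (Y : YoungDiagram) : StrictMono (shiftedRows R Y) := by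
  intro i j hij
  have h1 : Y.rowLen (Fin.rev i) ≤ Y.rowLen (Fin.rev j) :=
    Y.rowLen_anti _ _ (by rw [Fin.val_rev, Fin.val_rev]; omega)
  have h2 : (i : ℕ) < j := hij
  rw [shiftedRows, shiftedRows]
  omega

@[to_additive]
theorem prod_cells {M : Type*} [CommMonoid M] {Y : YoungDiagram} (hY : Y.colLen 0 ≤ R)
    (f : ℕ × ℕ → M) :
    ∏ c ∈ Y.cells, f c = ∏ j : Fin R, ∏ k ∈ Finset.range (Y.rowLen (Fin.rev j)),
      f ((Fin.rev j : Fin R), k) := by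
  refine Eq.trans ?_ (Equiv.prod_comp Fin.revPerm fun j : Fin R =>
    ∏ k ∈ Finset.range (Y.rowLen j), f ((j : ℕ), k)).symm
  rw [Fin.prod_univ_eq_prod_range fun j : ℕ => ∏ k ∈ Finset.range (Y.rowLen j), f (j, k)]
  refine Finset.prod_finset_product _ _ _ fun c => ?_
  rw [Finset.mem_range, Finset.mem_range, YoungDiagram.mem_cells, ← YoungDiagram.mem_iff_lt_rowLen]
  refine ⟨fun h => ⟨?_, h⟩, fun h => h.2⟩
  have h1 : (c.1, 0) ∈ Y := Y.up_left_mem le_rfl (Nat.zero_le c.2) h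
  exact (YoungDiagram.mem_iff_lt_colLen.mp h1).trans_le hY

theorem contentProd_shiftedRows (g : ℂ → ℂ) {Y : YoungDiagram} (hY : Y.colLen 0 ≤ R) :
    contentProd g (shiftedRows R Y) = contentProd g (rowState ([] : List (Fin R))) *
      ∏ c ∈ Y.cells, g (content c) := by
  rw [prod_cells hY, contentProd, contentProd, ← Finset.prod_mul_distrib]
  refine Finset.prod_congr rfl fun j _ => ?_
  rw [shiftedRows, Finset.prod_range_add]
  congr 1
  refine Finset.prod_congr rfl fun k _ => ?_
  rw [content, Fin.val_rev]
  congr 1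
  push_cast [Nat.cast_sub (Nat.succ_le_of_lt j.isLt)]
  ring

theorem prod_hookLength_row {Y : YoungDiagram} (hY : Y.colLen 0 ≤ R) (j : Fin R) :
    (∏ k ∈ Finset.range (Y.rowLen (Fin.rev j)), hookLength Y ((Fin.rev j : Fin R), k)) *
      ∏ i ∈ Finset.Iio j, (shiftedRows R Y j - shiftedRows R Y i) =
      (shiftedRows R Y j).factorial := by
  set l := shiftedRows R Y with hl
  set e : ℕ → ℕ := fun k => R - Y.colLen k + k with he
  have hcol : ∀ k, Y.colLen k ≤ R := fun k => (Y.colLen_anti 0 k (Nat.zero_le k)).trans hY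
  have hrev : ∀ i : Fin R, (Fin.rev i : ℕ) + i + 1 = R := fun i => by
    rw [Fin.val_rev]; omega
  have hlt : ∀ s k, k < Y.rowLen s ↔ s < Y.colLen k := fun s k => by
    rw [← YoungDiagram.mem_iff_lt_rowLen, ← YoungDiagram.mem_iff_lt_colLen]
  have hli : ∀ i, l i = i + Y.rowLen (Fin.rev i) := fun i => rfl
  have hinje : Set.InjOn e (Finset.range (Y.rowLen (Fin.rev j))) := by
    have hmono : StrictMono e := fun k k' hk => by
      have h1 := Y.colLen_anti k k' hk.le
      have h2 := hcol k
      simp only [he]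
      omega
    exact hmono.injective.injOn
  have hdisj : Disjoint ((Finset.range (Y.rowLen (Fin.rev j))).image e)
      ((Finset.Iio j).image l) := by
    rw [Finset.disjoint_left]
    intro m hm hm'
    obtain ⟨k, hk, rfl⟩ := Finset.mem_image.mp hm
    obtain ⟨i, hi, hik⟩ := Finset.mem_image.mp hm'
    rw [hli] at hik
    have h1 := hcol k
    have h2 := hrev i
    have h3 := hlt (Fin.rev i) k
    simp only [he] at hik
    by_cases h : k < Y.rowLen (Fin.rev i)
    · have := h3.mp h
      omega
    · have := mt h3.mpr h
      omega
  have hunion : (Finset.range (Y.rowLen (Fin.rev j))).image e ∪ (Finset.Iio j).image l =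
      Finset.range (l j) := by
    refine Finset.eq_of_subset_of_card_le (fun m hm => ?_) ?_
    · rw [Finset.mem_range]
      rcases Finset.mem_union.mp hm with hm | hm
      · obtain ⟨k, hk, rfl⟩ := Finset.mem_image.mp hm
        have h1 := (hlt _ k).mp (Finset.mem_range.mp hk)
        have h2 := hrev j
        have h3 := Finset.mem_range.mp hk
        have h4 := hcol k
        rw [hli]
        simp only [he]
        omega
      · obtain ⟨i, hi, rfl⟩ := Finset.mem_image.mp hm
        exact strictMono_shiftedRows Y (Finset.mem_Iio.mp hi)
    · rw [Finset.card_union_of_disjoint hdisj, Finset.card_image_of_injOn hinje,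
        Finset.card_image_of_injective _ (strictMono_shiftedRows Y).injective, Finset.card_range,
        Finset.card_range, Fin.card_Iio, hli, add_comm]
  rw [← Nat.descFactorial_self, Nat.descFactorial_eq_prod_range, ← hunion,
    Finset.prod_union hdisj, Finset.prod_image hinje,
    Finset.prod_image (strictMono_shiftedRows Y).injective.injOn]
  congr 1
  refine Finset.prod_congr rfl fun k hk => ?_
  have h1 := (hlt _ k).mp (Finset.mem_range.mp hk)
  have h2 := hrev j
  have h3 := Finset.mem_range.mp hk
  have h4 := hcol k
  rw [hookLength, hli]
  simp only [he]
  omega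

/-- The hook formula. -/
theorem shapeWeight_shiftedRows {Y : YoungDiagram} (hY : Y.colLen 0 ≤ R) :
    shapeWeight (shiftedRows R Y) = ∏ c ∈ Y.cells, (hookLength Y c : ℂ)⁻¹ := by
  rw [shapeWeight, Finset.prod_inv_distrib, prod_cells hY, Matrix.det_vandermonde]
  have h1 : ∏ i : Fin R, ∏ j ∈ Finset.Ioi i,
      ((shiftedRows R Y j : ℂ) - (shiftedRows R Y i : ℂ)) =
      ∏ j : Fin R, ∏ i ∈ Finset.Iio j,
        ((shiftedRows R Y j : ℂ) - (shiftedRows R Y i : ℂ)) := by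
    refine Finset.prod_comm' fun i j => ?_
    simp
  have h2 : ∀ j : Fin R, ((shiftedRows R Y j).factorial : ℂ) =
      (∏ k ∈ Finset.range (Y.rowLen (Fin.rev j)), (hookLength Y ((Fin.rev j : Fin R), k) : ℂ)) *
      ∏ i ∈ Finset.Iio j, ((shiftedRows R Y j : ℂ) - (shiftedRows R Y i : ℂ)) := by
    intro j
    rw [← prod_hookLength_row hY j, Nat.cast_mul, Nat.cast_prod, Nat.cast_prod]
    congr 1
    refine Finset.prod_congr rfl fun i hi => ?_
    rw [Nat.cast_sub (strictMono_shiftedRows Y (Finset.mem_Iio.mp hi)).le]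
  have h3 := prod_factorial_ne_zero (shiftedRows R Y)
  rw [h1]
  simp only [h2, Finset.prod_mul_distrib] at h3 ⊢
  rw [div_eq_iff h3, inv_mul_cancel_left₀ (left_ne_zero_of_mul h3)]

end Shape

section Partitions

variable {d : ℕ}

theorem colLen_diagram (p : Nat.Partition d) : (diagram p).colLen 0 = p.parts.card := by
  rw [← YoungDiagram.length_rowLens, diagram, YoungDiagram.rowLens_ofRowLens_eq_self,
    Multiset.length_sort]
  exact fun x hx => p.parts_pos ((Multiset.mem_sort (r := (· ≥ ·))).mp hx)

theorem card_parts_le (p : Nat.Partition d) : p.parts.card ≤ d := by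
  have h := Multiset.card_nsmul_le_sum (s := p.parts) (a := 1) fun x hx => p.parts_pos hx
  rwa [p.parts_sum, smul_eq_mul, mul_one] at h

theorem map_rowLen_diagram (p : Nat.Partition d) :
    (Finset.univ : Finset (Fin d)).val.map (fun j : Fin d => (diagram p).rowLen j) =
      p.parts + Multiset.replicate (d - p.parts.card) 0 := by
  have h1 : (Finset.univ : Finset (Fin d)).val.map (fun j : Fin d => (diagram p).rowLen j) =
      (Multiset.range d).map (diagram p).rowLen := by
    have h0 : List.ofFn (fun j : Fin d => (diagram p).rowLen j) =
        (List.range d).map (diagram p).rowLen := List.ext_getElem (by simp) (by simp)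
    rw [Fin.univ_val_map, h0]
    rfl
  have h2 : (Multiset.range p.parts.card).map (diagram p).rowLen = p.parts := by
    have h3 : (diagram p).rowLens = p.parts.sort (· ≥ ·) :=
      YoungDiagram.rowLens_ofRowLens_eq_self fun x hx =>
        p.parts_pos ((Multiset.mem_sort (r := (· ≥ ·))).mp hx)
    have h4 := congrArg (fun l : List ℕ => (l : Multiset ℕ)) h3
    simp only [Multiset.sort_eq] at h4
    rw [← colLen_diagram]
    exact h4
  obtain ⟨m, hm⟩ := Nat.exists_eq_add_of_le (card_parts_le p)
  rw [h1]
  have h5 : Multiset.range (p.parts.card + m) =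
      Multiset.range p.parts.card + (Multiset.range m).map (p.parts.card + ·) :=
    Multiset.range_add _ _
  have h6 : (Multiset.range d).map (diagram p).rowLen =
      (Multiset.range (p.parts.card + m)).map (diagram p).rowLen := by rw [← hm]
  rw [h6, h5, Multiset.map_add, h2, Nat.sub_eq_of_eq_add' hm, Multiset.map_map]
  congr 1
  rw [Multiset.eq_replicate]
  refine ⟨by simp, fun b hb => ?_⟩
  obtain ⟨k, -, rfl⟩ := Multiset.mem_map.mp hb
  by_contra h0
  have h7 : (p.parts.card + k, 0) ∈ diagram p :=
    YoungDiagram.mem_iff_lt_rowLen.mpr (Nat.pos_of_ne_zero h0)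
  have h8 := YoungDiagram.mem_iff_lt_colLen.mp h7
  rw [colLen_diagram] at h8
  omega

theorem parts_eq_filter (p : Nat.Partition d) :
    p.parts = ((Finset.univ : Finset (Fin d)).val.map fun j : Fin d => (diagram p).rowLen j).filter
      (· ≠ 0) := by
  rw [map_rowLen_diagram, Multiset.filter_add,
    Multiset.filter_eq_self.mpr fun x hx => (p.parts_pos hx).ne',
    Multiset.filter_eq_nil.mpr fun x hx h => h (Multiset.eq_of_mem_replicate hx), add_zero]

theorem shiftedRows_diagram_injective :
    Function.Injective fun p : Nat.Partition d => shiftedRows d (diagram p) := by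
  intro p q h
  refine Nat.Partition.ext ?_
  rw [parts_eq_filter p, parts_eq_filter q]
  congr 2
  funext j
  have h1 := congrFun h (Fin.rev j)
  simp only [shiftedRows, Fin.rev_rev] at h1
  exact Nat.add_left_cancel h1

theorem sum_shiftedRows_diagram (p : Nat.Partition d) :
    ∑ j, shiftedRows d (diagram p) j = d + ∑ j : Fin d, (j : ℕ) := by
  have h1 : ∑ j : Fin d, (diagram p).rowLen j = d := by
    have h2 := congrArg Multiset.sum (map_rowLen_diagram p)
    rw [Multiset.sum_add, p.parts_sum, Multiset.sum_replicate, smul_zero, add_zero] at h2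
    exact h2
  have h3 := Equiv.sum_comp Fin.revPerm fun j : Fin d => (diagram p).rowLen j
  simp only [shiftedRows, Finset.sum_add_distrib]
  rw [add_comm]
  congr 1
  exact h3.trans h1

theorem eq_of_monotone_of_map_eq {f g : Fin d → ℕ} (hf : Monotone f) (hg : Monotone g)
    (h : (Finset.univ : Finset (Fin d)).val.map f = (Finset.univ : Finset (Fin d)).val.map g) :
    f = g := by
  rw [Fin.univ_val_map, Fin.univ_val_map, Multiset.coe_eq_coe] at h
  exact List.ofFn_injective (h.eq_of_sortedLE (List.sortedLE_ofFn_iff.mpr hf)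
    (List.sortedLE_ofFn_iff.mpr hg))

theorem exists_shiftedRows_diagram_eq {l : Fin d → ℕ} (hl : StrictMono l)
    (hsum : ∑ j, l j = d + ∑ j : Fin d, (j : ℕ)) :
    ∃ p : Nat.Partition d, shiftedRows d (diagram p) = l := by
  have hle : ∀ (i j : Fin d), i ≤ j → (j : ℕ) - i ≤ l j - l i ∧ l i ≤ l j := by
    have key : ∀ (n : ℕ) (i j : Fin d), (j : ℕ) = i + n → (j : ℕ) + l i ≤ l j + i := by
      intro n
      induction n with
      | zero =>
        intro i j h
        have : i = j := Fin.ext (by omega)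
        rw [this]; omega
      | succ n ih =>
        intro i j h
        have hj := j.isLt
        have h1 := ih i ⟨i + n, by omega⟩ rfl
        have h2 : l ⟨i + n, by omega⟩ < l j := hl (Fin.lt_def.mpr (by simp only; omega))
        simp only at h1
        omega
    intro i j hij
    have := key (j - i) i j (by have : (i : ℕ) ≤ j := hij; omega)
    have := hl.monotone hij
    omega
  have hge : ∀ j : Fin d, (j : ℕ) ≤ l j := by
    intro j
    have := (hle ⟨0, j.pos⟩ j (Fin.le_def.mpr (Nat.zero_le _))).1
    simp only at this
    omega
  set μ : Fin d → ℕ := fun j => l j - j with hμ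
  have hμmono : Monotone μ := by
    intro i j hij
    have h1 := hle i j hij
    have h2 := hge i
    have h3 := hge j
    have h4 : (i : ℕ) ≤ j := hij
    simp only [hμ]
    omega
  have hlμ : ∀ j, l j = j + μ j := fun j => by
    have := hge j
    simp only [hμ]
    omega
  have hμsum : ((Finset.univ : Finset (Fin d)).val.map μ).sum = d := by
    have h1 : ∑ j, l j = (∑ j : Fin d, (j : ℕ)) + ∑ j, μ j := by
      rw [← Finset.sum_add_distrib]
      exact Finset.sum_congr rfl fun j _ => hlμ j
    have h2 : ((Finset.univ : Finset (Fin d)).val.map μ).sum = ∑ j, μ j := rfl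
    omega
  refine ⟨Nat.Partition.ofSums d _ hμsum, funext fun j => ?_⟩
  set p := Nat.Partition.ofSums d _ hμsum with hp
  have hparts : p.parts = ((Finset.univ : Finset (Fin d)).val.map μ).filter (· ≠ 0) := rfl
  have hfin : (fun j : Fin d => (diagram p).rowLen (Fin.rev j)) = μ := by
    refine eq_of_monotone_of_map_eq (fun i j hij => (diagram p).rowLen_anti _ _ ?_) hμmono ?_
    · have : (i : ℕ) ≤ j := hij
      rw [Fin.val_rev, Fin.val_rev]; omega
    · have h1 : (Finset.univ : Finset (Fin d)).val.map
          (fun j : Fin d => (diagram p).rowLen (Fin.rev j)) =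
          (Finset.univ : Finset (Fin d)).val.map (fun j : Fin d => (diagram p).rowLen j) := by
        have h2 : (Finset.univ : Finset (Fin d)).val.map Fin.rev =
            (Finset.univ : Finset (Fin d)).val := by
          have h3 := congrArg Finset.val (Finset.map_univ_equiv (Fin.revPerm (n := d)))
          rwa [Finset.map_val] at h3
        nth_rewrite 2 [← h2]
        rw [Multiset.map_map]
        rfl
      rw [h1, map_rowLen_diagram, hparts]
      nth_rewrite 3 [← Multiset.filter_add_not (· ≠ 0) ((Finset.univ : Finset (Fin d)).val.map μ)]
      congr 1
      symm
      rw [Multiset.eq_replicate]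
      refine ⟨?_, fun b hb => by simpa using (Multiset.mem_filter.mp hb).2⟩
      have h4 := congrArg Multiset.card (Multiset.filter_add_not (· ≠ 0)
        ((Finset.univ : Finset (Fin d)).val.map μ))
      rw [Multiset.card_add, Multiset.card_map, Finset.card_val, Finset.card_univ,
        Fintype.card_fin] at h4
      omega
  rw [shiftedRows, hlμ, ← hfin]

/-- A sum over distinct shifted rows is a sum over partitions. -/
theorem sum_piAntidiag_eq_sum_partition (f : (Fin d → ℕ) → ℂ)
    (hf0 : ∀ l, ¬ Function.Injective l → f l = 0)
    (hfσ : ∀ l (σ : Equiv.Perm (Fin d)), f (l ∘ σ) = f l) :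
    ∑ l ∈ Finset.piAntidiag Finset.univ (d + ∑ j : Fin d, (j : ℕ)), f l =
      d.factorial * ∑ p : Nat.Partition d, f (shiftedRows d (diagram p)) := by
  have h1 : ∑ z : Nat.Partition d × Equiv.Perm (Fin d), f (shiftedRows d (diagram z.1) ∘ z.2) =
      d.factorial * ∑ p : Nat.Partition d, f (shiftedRows d (diagram p)) := by
    simp only [hfσ]
    rw [Fintype.sum_prod_type]
    simp only [Finset.sum_const, Finset.card_univ, Fintype.card_perm, Fintype.card_fin,
      nsmul_eq_mul]
    rw [Finset.mul_sum]
  rw [← h1]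
  symm
  refine Finset.sum_bij_ne_zero (fun z _ _ => shiftedRows d (diagram z.1) ∘ z.2)
    (fun z _ _ => ?_) (fun z _ _ z' _ _ h => ?_) (fun l hl hne => ?_) fun _ _ _ => rfl
  · rw [Finset.mem_piAntidiag]
    refine ⟨?_, fun i _ => Finset.mem_univ i⟩
    rw [← sum_shiftedRows_diagram z.1]
    exact Equiv.sum_comp z.2 _
  · obtain ⟨p, σ⟩ := z
    obtain ⟨q, τ⟩ := z'
    dsimp only at h
    have h2 : shiftedRows d (diagram p) = shiftedRows d (diagram q) := by
      refine ((strictMono_shiftedRows _).range_inj (strictMono_shiftedRows _)).mp ?_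
      rw [← σ.surjective.range_comp, h, τ.surjective.range_comp]
    rw [h2] at h
    have h3 : σ = τ := Equiv.ext fun j =>
      (strictMono_shiftedRows (diagram q)).injective (congrFun h j)
    rw [shiftedRows_diagram_injective h2, h3]
  · have hinj : Function.Injective l := by
      by_contra h
      exact hne (hf0 l h)
    have hmono : StrictMono (l ∘ Tuple.sort l) :=
      (Tuple.monotone_sort l).strictMono_of_injective (hinj.comp (Tuple.sort l).injective)
    rw [Finset.mem_piAntidiag] at hl
    obtain ⟨p, hp⟩ := exists_shiftedRows_diagram_eq hmono (by
      rw [← hl.1]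
      exact Equiv.sum_comp (Tuple.sort l) l)
    have h4 : shiftedRows d (diagram p) ∘ ⇑(Tuple.sort l)⁻¹ = l := by
      rw [hp]
      funext j
      simp
    exact ⟨(p, (Tuple.sort l)⁻¹), Finset.mem_univ _, by rw [h4]; exact hne, h4⟩

theorem tsum_word_eq_sum_partition {x : ℂ} (hd : 1 ≤ d) (hx : ((d : ℝ) - 1) * ‖x‖ < 1) :
    ∑' L : Word (Finset.univ : Finset (Fin d)), (if wordProd L.1 = 1 then x ^ wordLength L.1 else 0)
      = d.factorial * ∑ p : Nat.Partition d, ∏ c ∈ (diagram p).cells,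
        ((hookLength (diagram p) c : ℂ)⁻¹ ^ 2 * (1 - x * content c)⁻¹) := by
  set g : ℂ → ℂ := fun c => (1 - x * c)⁻¹ with hg
  have hne : contentProd g (rowState ([] : List (Fin d))) ≠ 0 := by
    refine Finset.prod_ne_zero_iff.mpr fun i _ => Finset.prod_ne_zero_iff.mpr fun k hk => ?_
    refine inv_ne_zero fun h0 => ?_
    have h1 : ‖x * ((k : ℂ) - d + 1)‖ < 1 := by
      have hk' : k + 1 ≤ d := by
        have := Finset.mem_range.mp hk
        have hi : rowState ([] : List (Fin d)) i = i := rfl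
        have := i.isLt
        omega
      have h2 : ‖((k : ℂ) - d + 1)‖ ≤ (d : ℝ) - 1 := by
        have h3 : ((k : ℂ) - d + 1) = (((k : ℝ) - d + 1 : ℝ) : ℂ) := by push_cast; rfl
        have h4 : (k : ℝ) + 1 ≤ d := by exact_mod_cast hk'
        have h5 : (0 : ℝ) ≤ k := Nat.cast_nonneg k
        rw [h3, Complex.norm_real, Real.norm_eq_abs, abs_le]
        constructor <;> linarith
      rw [norm_mul, mul_comm]
      exact (mul_le_mul_of_nonneg_right h2 (norm_nonneg x)).trans_lt hx
    rw [← sub_eq_zero.mp h0, norm_one] at h1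
    exact h1.false
  have hfac : (d.factorial : ℂ) ≠ 0 := Nat.cast_ne_zero.mpr (Nat.factorial_ne_zero d)
  refine mul_right_cancel₀ hne (mul_left_cancel₀ hfac ?_)
  rw [tsum_word_eq_wordSum hd hx, mul_comm (wordSum _ _), ← wordSum_mul_left]
  have h1 : wordSum d (fun w : List (Fin d) => contentProd g (rowState ([] : List (Fin d))) *
      (shapeWeight (rowState w) * ∏ t : Fin d, (1 - x * stepValue wordContent t w)⁻¹)) =
      wordSum d fun w : List (Fin d) => shapeWeight (rowState w) * contentProd g (rowState w) := by
    refine wordSum_congr fun w hw => ?_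
    rw [← prod_stepValue_mul_contentProd g w, hw,
      ← Fin.prod_univ_eq_prod_range fun t => g (stepValue wordContent t w)]
    ring
  rw [h1, wordSum_rowState d fun l => shapeWeight l * contentProd g l,
    sum_multinomial_eq d fun l => shapeWeight l * contentProd g l, mul_left_comm,
    factorial_mul_sum_antisymmetrize _ (fun σ l => ?_) g,
    sum_piAntidiag_eq_sum_partition]
  · rw [mul_assoc]
    congr 2
    rw [Finset.sum_mul]
    refine Finset.sum_congr rfl fun p _ => ?_
    have hcol : (diagram p).colLen 0 ≤ d := by
      rw [colLen_diagram]; exact card_parts_le p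
    rw [shapeWeight_shiftedRows hcol, contentProd_shiftedRows g hcol, Finset.prod_mul_distrib,
      Finset.prod_pow]
    ring
  · intro l hl
    have : shapeWeight l = 0 := by
      by_contra h
      exact hl (shapeWeight_ne_zero_iff.mp h)
    rw [this, zero_pow two_ne_zero, zero_mul]
  · intro l σ
    have h3 : ((Equiv.Perm.sign σ : ℤ) : ℂ) ^ 2 = 1 := by
      norm_cast
      rw [Int.units_sq]
      rfl
    rw [shapeWeight_comp_perm, contentProd_comp_perm, mul_pow, h3, one_mul]
  · rw [Finset.mem_piAntidiag, Finset.mem_piAntidiag]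
    have h2 : ∑ j, (l ∘ σ) j = ∑ j, l j := Equiv.sum_comp σ l
    simp only [Finset.mem_univ, implies_true, and_true]
    have h2' : Finset.univ.sum (l ∘ σ) = Finset.univ.sum l := h2
    rw [h2']

theorem walkSum_unitPowerSum_univ {N : ℕ} (hN : N ≠ 0) (hd : 1 ≤ d) (hdN : d ≤ N) :
    walkSum (unitPowerSum N) (unitPowerSum N) (-1 / N) (Finset.univ : Finset (Fin d)) =
      fieldlessCoeff N d := by
  have hx := card_sub_one_mul_norm_lt_one hdN
  have hN' : (N : ℂ) ≠ 0 := Nat.cast_ne_zero.mpr hN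
  have hcard : (Finset.univ : Finset (Fin d)).card = d := Finset.card_fin d
  rw [walkSum_unitPowerSum _ (by rwa [hcard]), hcard, fieldlessCoeff,
    Finset.filter_true_of_mem fun p _ => (card_parts_le p).trans hdN]
  have h1 : ∀ L : Word (Finset.univ : Finset (Fin d)), (-1 / N : ℂ) ^ wordLength L.1 *
      cycleWeight (unitPowerSum N) Finset.univ (wordProd L.1) =
      (N : ℂ) ^ d * if wordProd L.1 = 1 then (-1 / N : ℂ) ^ wordLength L.1 else 0 := by
    intro L
    rw [cycleWeight_unitPowerSum, hcard]
    split_ifs <;> ring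
  simp only [h1]
  rw [tsum_mul_left, tsum_word_eq_sum_partition hd hx]
  have h2 : ∀ p : Nat.Partition d, (∏ c ∈ (diagram p).cells,
      ((hookLength (diagram p) c : ℂ)⁻¹ ^ 2 * (1 - -1 / (N : ℂ) * content c)⁻¹)) =
      ∏ c ∈ (diagram p).cells,
        1 / ((hookLength (diagram p) c : ℂ) ^ 2 * (1 + (content c : ℂ) / (N : ℂ))) := fun p =>
    Finset.prod_congr rfl fun c _ => by
      rw [one_div, mul_inv, inv_pow]
      congr 2
      ring
  simp only [h2]
  ring

end Partitions

end StrongCoupling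

namespace StrongCoupling
open MeasureTheory

variable {d N : ℕ}

/-! ### The fieldless series -/

theorem card_cells_diagram (p : Nat.Partition d) : (diagram p).cells.card = d := by
  have hcol : (diagram p).colLen 0 ≤ d := by rw [colLen_diagram]; exact card_parts_le p
  rw [Finset.card_eq_sum_ones, sum_cells hcol]
  have h := sum_shiftedRows_diagram p
  simp only [shiftedRows, Finset.sum_add_distrib] at h
  simp only [Finset.sum_const, Finset.card_range, smul_eq_mul, mul_one]
  omega

theorem card_partition_le (n : ℕ) : Fintype.card (Nat.Partition n) ≤ 2 ^ n :=
  (Fintype.card_le_of_surjective _ Nat.Partition.ofComposition_surj).trans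
    ((composition_card n).le.trans (Nat.pow_le_pow_right two_pos (Nat.sub_le n 1)))

theorem norm_fieldlessCoeff_le (hN : N ≠ 0) (n : ℕ) :
    ‖fieldlessCoeff N n‖ ≤ n.factorial * (2 * (N : ℝ) ^ 3) ^ n := by
  have hN' : (0 : ℝ) < N := Nat.cast_pos.mpr (Nat.pos_of_ne_zero hN)
  have hcell : ∀ p ∈ Finset.univ.filter fun p : Nat.Partition n => p.parts.card ≤ N,
      ‖∏ c ∈ (diagram p).cells, 1 / ((hookLength (diagram p) c : ℂ) ^ 2 *
        (1 + (content c : ℂ) / (N : ℂ)))‖ ≤ (N : ℝ) ^ n := by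
    intro p hp
    have hp : p.parts.card ≤ N := (Finset.mem_filter.mp hp).2
    rw [norm_prod]
    refine (Finset.prod_le_prod (g := fun _ => (N : ℝ)) (fun c _ => norm_nonneg _)
      fun c hc => ?_).trans ?_
    · have h1 : c.1 < N := by
        have h2 : (c.1, 0) ∈ diagram p := (diagram p).up_left_mem le_rfl (Nat.zero_le c.2)
          (by simpa using hc)
        have h3 := YoungDiagram.mem_iff_lt_colLen.mp h2
        rw [colLen_diagram] at h3
        omega
      have h4 : (1 : ℝ) ≤ hookLength (diagram p) c := by
        have : 1 ≤ hookLength (diagram p) c := Nat.le_add_left 1 _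
        exact_mod_cast this
      have h5 : (1 + (content c : ℂ) / (N : ℂ)) = ((((N : ℝ) + content c) / N : ℝ) : ℂ) := by
        push_cast
        field_simp
      have h6 : (1 : ℝ) ≤ (N : ℝ) + content c := by
        have : (1 : ℤ) ≤ (N : ℤ) + content c := by rw [content]; omega
        exact_mod_cast this
      rw [norm_div, norm_one, norm_mul, norm_pow, Complex.norm_natCast, h5, Complex.norm_real,
        Real.norm_of_nonneg (by positivity), div_le_iff₀ (by positivity)]
      have h7 : (1 : ℝ) ≤ (hookLength (diagram p) c : ℝ) ^ 2 := one_le_pow₀ h4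
      have h8 : (N : ℝ) * ((hookLength (diagram p) c : ℝ) ^ 2 * (((N : ℝ) + content c) / N)) =
          (hookLength (diagram p) c : ℝ) ^ 2 * ((N : ℝ) + content c) := by field_simp
      rw [h8]
      nlinarith
    · rw [Finset.prod_const, card_cells_diagram]
  rw [fieldlessCoeff, norm_mul, norm_mul, norm_pow, Complex.norm_natCast, Complex.norm_natCast,
    mul_assoc]
  refine mul_le_mul_of_nonneg_left ?_ (Nat.cast_nonneg _)
  have h1 := (norm_sum_le _ _).trans (Finset.sum_le_sum hcell)
  rw [Finset.sum_const, nsmul_eq_mul] at h1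
  have h2 : ((Finset.univ.filter fun p : Nat.Partition n => p.parts.card ≤ N).card : ℝ) ≤
      2 ^ n := by
    exact_mod_cast (Finset.card_le_univ _).trans (card_partition_le n)
  calc (N : ℝ) ^ (2 * n) * _ ≤ (N : ℝ) ^ (2 * n) * (2 ^ n * (N : ℝ) ^ n) :=
        mul_le_mul_of_nonneg_left (h1.trans (mul_le_mul_of_nonneg_right h2 (by positivity)))
          (by positivity)
    _ = _ := by rw [mul_pow, ← pow_mul]; ring

theorem hasMaclaurin_fieldlessSeries (hN : N ≠ 0) :
    HasMaclaurin (fieldlessSeries N) fun n => if n = 0 then 1 else fieldlessCoeff N n := by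
  have hev : ∀ᶠ z : ℂ in nhds 0, ‖z‖ * (2 * (N : ℝ) ^ 3) < 1 := by
    have : Filter.Tendsto (fun z : ℂ => ‖z‖ * (2 * (N : ℝ) ^ 3)) (nhds 0) (nhds 0) := by
      have h := (continuous_norm.mul continuous_const).tendsto (0 : ℂ)
        (f := fun z : ℂ => ‖z‖ * (2 * (N : ℝ) ^ 3))
      simpa using h
    exact this.eventually_lt_const one_pos
  filter_upwards [hev] with z hz
  have hs : Summable fun n : ℕ => z ^ n / (n.factorial : ℂ) * fieldlessCoeff N n := by
    refine Summable.of_norm_bounded (summable_geometric_of_lt_one (by positivity) hz) fun n => ?_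
    rw [norm_mul, norm_div, norm_pow, Complex.norm_natCast]
    have h0 : (0 : ℝ) < n.factorial := Nat.cast_pos.mpr n.factorial_pos
    calc ‖z‖ ^ n / n.factorial * ‖fieldlessCoeff N n‖
        ≤ ‖z‖ ^ n / n.factorial * (n.factorial * (2 * (N : ℝ) ^ 3) ^ n) :=
          mul_le_mul_of_nonneg_left (norm_fieldlessCoeff_le hN n) (by positivity)
      _ = _ := by
          rw [div_mul_eq_mul_div, mul_left_comm, mul_div_cancel_left₀ _ h0.ne', mul_pow ‖z‖]
  have hs' := ((summable_nat_add_iff 1).mpr hs).hasSum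
  have h := (hasSum_nat_add_iff (f := fun n : ℕ => z ^ n / (n.factorial : ℂ) *
    if n = 0 then 1 else fieldlessCoeff N n) 1).mp (hs'.congr_fun fun n => by
      rw [if_neg (Nat.succ_ne_zero n)])
  rw [Finset.sum_range_one] at h
  simp only [pow_zero, Nat.factorial_zero, Nat.cast_one, div_one, if_true, mul_one] at h
  rw [fieldlessSeries, add_comm]
  exact h

theorem walkSum_unitPowerSum_eq_fieldlessCoeff (hN : N ≠ 0) (hdN : d ≤ N)
    (S : Finset (Fin d)) : walkSum (unitPowerSum N) (unitPowerSum N) (-1 / N) S =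
      if S.card = 0 then 1 else fieldlessCoeff N S.card := by
  have hcard : S.card ≤ d := by simpa using Finset.card_le_univ S
  have hi : Function.Injective fun k : Fin d => Fin.castLE hdN k := Fin.castLE_injective hdN
  have h1 := pow_mul_moment_of_injective hN (hcard.trans hdN) hi
  rw [← h1]
  split_ifs with h0
  · rw [Finset.card_eq_zero] at h0
    subst h0
    simp [moment, entryMonomial]
  · set e := S.orderEmbOfFin rfl with he
    have h2 := pow_mul_moment_of_injective hN (S := (Finset.univ : Finset (Fin S.card)))
      (by rw [Finset.card_fin]; exact hcard.trans hdN) (hi.comp e.injective)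
    rw [walkSum_unitPowerSum_univ hN (Nat.one_le_iff_ne_zero.mpr h0) (hcard.trans hdN),
      Finset.card_fin] at h2
    rw [← h2]
    congr 1
    have h3 : ∀ f : Fin d → ℂ, ∏ k ∈ S, f k = ∏ k : Fin S.card, f (e k) := by
      intro f
      have h := Finset.prod_map Finset.univ e.toEmbedding f
      rwa [he, Finset.map_orderEmbOfFin_univ] at h
    simp only [moment, entryMonomial, h3]
    rfl

/-! ### Strong coupling coefficients as sums over connected walks -/

/-- The power sums recorded by the starting point of a walk. -/
noncomputable def startPowerSum (N : ℕ) : (m : Fin 3) → PhaseSpace m N → ℕ → ℂ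
  | 0, _ => unitPowerSum N
  | 1, x => fun k => ∑ j, x ⟨0, by decide⟩ j ^ k
  | 2, x => fun k => ∑ j, x ⟨0, by decide⟩ j ^ k

/-- The power sums recorded by the end point of a walk. -/
noncomputable def finishPowerSum (N : ℕ) : (m : Fin 3) → PhaseSpace m N → ℕ → ℂ
  | 0, _ => unitPowerSum N
  | 1, _ => unitPowerSum N
  | 2, x => fun k => ∑ j, x ⟨1, by decide⟩ j ^ k

theorem exists_hasMaclaurin_partitionFunction (hN : N ≠ 0) (m : Fin 3) (x : PhaseSpace m N) :
    ∃ c : ℕ → ℂ, HasMaclaurin (partitionFunction N m x) c ∧ c 0 = 1 ∧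
      ∀ d ≤ N, ∀ S : Finset (Fin d),
        walkSum (startPowerSum N m x) (finishPowerSum N m x) (-1 / N) S = c S.card := by
  match m, x with
  | 0, x =>
    exact ⟨_, hasMaclaurin_fieldlessSeries hN, if_pos rfl, fun d hd S =>
      walkSum_unitPowerSum_eq_fieldlessCoeff hN hd S⟩
  | 1, x =>
    refine ⟨_, hasMaclaurin_bgw _, by simp, fun d hd S => ?_⟩
    have hcard : S.card ≤ d := by simpa using Finset.card_le_univ S
    have h := integral_trace_pow_mul hN (x ⟨0, by decide⟩) (hcard.trans hd)
    have h0 : (S.card.factorial : ℂ) ≠ 0 := Nat.cast_ne_zero.mpr (Nat.factorial_ne_zero _)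
    rw [div_mul_eq_mul_div, h, mul_div_cancel_left₀ _ h0]
    rfl
  | 2, x =>
    refine ⟨_, hasMaclaurin_hciz _ _, by simp, fun d hd S => ?_⟩
    have hcard : S.card ≤ d := by simpa using Finset.card_le_univ S
    exact (integral_trace_conj_pow hN (x ⟨0, by decide⟩) (x ⟨1, by decide⟩)
      (hcard.trans hd)).symm

theorem analyticAt_freeEnergy (hN : N ≠ 0) (m : Fin 3) (x : PhaseSpace m N) :
    AnalyticAt ℂ (freeEnergy N m x) 0 := by
  obtain ⟨c, hc, h0, -⟩ := exists_hasMaclaurin_partitionFunction hN m x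
  exact hc.analyticAt_log h0

theorem strongCouplingCoeff_eq_connectedSum (hd : 1 ≤ d) (hdN : d ≤ N) (m : Fin 3)
    (x : PhaseSpace m N) : strongCouplingCoeff N d m x =
      connectedSum (startPowerSum N m x) (finishPowerSum N m x) (-1 / N)
        (Finset.univ : Finset (Fin d)) := by
  obtain ⟨c, hc, h0, hS⟩ := exists_hasMaclaurin_partitionFunction (by omega : N ≠ 0) m x
  have h := iteratedDeriv_log_eq_connectedSum hc h0 (card_sub_one_mul_norm_lt_one hdN)
    (hS d hdN) Finset.univ ⟨⟨0, hd⟩, Finset.mem_univ _⟩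
  rwa [Finset.card_fin] at h

end StrongCoupling

namespace StrongCoupling

variable {d N : ℕ}

/-! ### Grouping connected walks by genus and ramification -/

/-- The cycle type of a permutation of `d` points, as a partition of `d`. -/
def cycleTypePartition (σ : Equiv.Perm (Fin d)) : Nat.Partition d where
  parts := σ.partition.parts
  parts_pos := σ.partition.parts_pos
  parts_sum := σ.partition.parts_sum.trans (Fintype.card_fin d)

theorem parts_cycleTypePartition (σ : Equiv.Perm (Fin d)) :
    (cycleTypePartition σ).parts = σ.partition.parts :=
  rfl

theorem one_le_card_parts (hd : 1 ≤ d) (α : Nat.Partition d) : 1 ≤ α.parts.card := by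
  refine Multiset.card_pos.mpr fun h => ?_
  have := α.parts_sum
  rw [h, Multiset.sum_zero] at this
  omega

theorem hasSum_connectedSum (hd : 1 ≤ d) (q q' : ℕ → ℂ) {x : ℂ} (hx : ((d : ℝ) - 1) * ‖x‖ < 1) :
    HasSum (fun g : ℕ => ∑ α : Nat.Partition d, ∑ β : Nat.Partition d,
      (hurwitzDouble g α β : ℂ) * (x ^ (2 * g + α.parts.card + β.parts.card - 2) *
        ((α.parts.map q).prod * (β.parts.map q').prod)))
      (connectedSum q q' x (Finset.univ : Finset (Fin d))) := by
  classical
  have hs : Summable fun ω : Walk (Finset.univ : Finset (Fin d)) => walkWeight q q' x ω :=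
    (summable_norm_walkWeight q q' (by rwa [Finset.card_fin])).of_norm
  set s : Set (Walk (Finset.univ : Finset (Fin d))) :=
    {ω | IsConnectedOn ω.1 ω.2.1 Finset.univ} with hsdef
  have h1 : HasSum (fun ω : s => walkWeight q q' x ω.1)
      (connectedSum q q' x (Finset.univ : Finset (Fin d))) := by
    have h : ∑' ω : s, walkWeight q q' x ω.1 =
        connectedSum q q' x (Finset.univ : Finset (Fin d)) := by
      unfold connectedSum
      refine (tsum_subtype s fun ω => walkWeight q q' x ω).trans (tsum_congr fun ω => ?_)
      simp only [Set.indicator_apply, hsdef, Set.mem_ofPred_eq]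
    rw [← h]
    exact (hs.subtype s).hasSum
  choose genus hgenus using fun ω : s => exists_genus ω.1 ω.2
  let type : s → ℕ × (Nat.Partition d × Nat.Partition d) := fun ω =>
    (genus ω, (cycleTypePartition ω.1.1, cycleTypePartition ω.1.finish))
  have h2 := h1.tsum_fiberwise type
  refine HasSum.prod_fiberwise (f := fun p : ℕ × (Nat.Partition d × Nat.Partition d) =>
    (hurwitzDouble p.1 p.2.1 p.2.2 : ℂ) *
      (x ^ (2 * p.1 + p.2.1.parts.card + p.2.2.parts.card - 2) *
        ((p.2.1.parts.map q).prod * (p.2.2.parts.map q').prod))) ?_ fun g => ?_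
  · refine h2.congr_fun fun p => ?_
    obtain ⟨g, α, β⟩ := p
    have hα := one_le_card_parts hd α
    have hβ := one_le_card_parts hd β
    have h3 : ∀ ω : type ⁻¹' {(g, (α, β))}, walkWeight q q' x ω.1.1 =
        x ^ (2 * g + α.parts.card + β.parts.card - 2) *
          ((α.parts.map q).prod * (β.parts.map q').prod) := by
      rintro ⟨ω, hω⟩
      obtain ⟨rfl, h⟩ := Prod.mk.inj (show type ω = _ from hω)
      obtain ⟨rfl, rfl⟩ := Prod.mk.inj h
      rw [walkWeight, cycleWeight_univ, cycleWeight_univ]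
      have h4 : 2 * genus ω + (cycleTypePartition (ω.1.1 : Equiv.Perm (Fin d))).parts.card +
          (cycleTypePartition ω.1.finish).parts.card - 2 = wordLength ω.1.2.1 := by
        rw [parts_cycleTypePartition, parts_cycleTypePartition, ← hgenus ω, Nat.add_sub_cancel]
      rw [h4, parts_cycleTypePartition, parts_cycleTypePartition]
    rw [tsum_congr h3, tsum_const, nsmul_eq_mul]
    congr 2
    rw [hurwitzDouble, connectedWalkCount_eq_card]
    refine Nat.card_congr ⟨fun ω => ⟨⟨ω.1, ω.2.1⟩, ?_⟩, fun ω => ⟨ω.1.1, ω.1.2, ?_⟩,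
      fun ω => rfl, fun ω => rfl⟩
    · obtain ⟨ω, hc, hr, hstart, hfinish⟩ := ω
      have hg := hgenus ⟨ω, hc⟩
      dsimp only at hr hstart hfinish hg
      refine Prod.ext ?_ (Prod.ext (Nat.Partition.ext hstart) (Nat.Partition.ext hfinish))
      change genus ⟨ω, hc⟩ = g
      simp only [hstart, hfinish] at hg
      omega
    · obtain ⟨⟨ω, hc⟩, hω⟩ := ω
      obtain ⟨hg', h⟩ := Prod.mk.inj (show type ⟨ω, hc⟩ = _ from hω)
      obtain ⟨hstart, hfinish⟩ := Prod.mk.inj h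
      have hg := hgenus ⟨ω, hc⟩
      have hstart := congrArg Nat.Partition.parts hstart
      have hfinish := congrArg Nat.Partition.parts hfinish
      simp only [parts_cycleTypePartition] at hstart hfinish
      refine ⟨?_, hstart, hfinish⟩
      simp only [hstart, hfinish, hg'] at hg
      dsimp only at hg ⊢
      omega
  · have h := hasSum_fintype fun p : Nat.Partition d × Nat.Partition d =>
      (hurwitzDouble g p.1 p.2 : ℂ) *
      (x ^ (2 * g + p.1.parts.card + p.2.parts.card - 2) *
        ((p.1.parts.map q).prod * (p.2.parts.map q').prod))
    rwa [Fintype.sum_prod_type] at h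

theorem div_natCast_pow_genus {c : ℂ} (hc : c ^ 2 = 1) (hN : N ≠ 0) (g : ℕ) {a b : ℕ}
    (ha : 1 ≤ a) (hb : 1 ≤ b) : (c / N : ℂ) ^ (2 * g + a + b - 2) =
      c ^ (a + b) * (N : ℂ) ^ (2 - 2 * (g : ℤ)) / ((N : ℂ) ^ a * (N : ℂ) ^ b) := by
  have hN' : (N : ℂ) ≠ 0 := Nat.cast_ne_zero.mpr hN
  have hc0 : c ≠ 0 := by rintro rfl; norm_num at hc
  have h : ∀ y : ℂ, y ≠ 0 → y ^ (2 * g + a + b - 2) = (y ^ 2) ^ g * (y ^ a * y ^ b) / y ^ 2 := by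
    intro y hy
    rw [eq_div_iff (pow_ne_zero 2 hy), ← pow_add, ← pow_mul, ← pow_add, ← pow_add]
    congr 1
    omega
  rw [h _ (div_ne_zero hc0 hN'), zpow_sub₀ hN', zpow_mul]
  simp only [div_pow, hc, zpow_natCast]
  norm_cast
  field_simp
  push_cast
  ring

theorem prod_map_unitPowerSum (β : Nat.Partition d) : (β.parts.map (unitPowerSum N)).prod =
    if β = onesPartition d then (N : ℂ) ^ d else 0 := by
  split_ifs with h
  · subst h
    simp [onesPartition, unitPowerSum]
  · have h1 : ∃ k ∈ β.parts, k ≠ 1 := by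
      by_contra! hall
      have h2 := Multiset.eq_replicate_card.mpr hall
      have h3 := β.parts_sum
      rw [h2, Multiset.sum_replicate, smul_eq_mul, mul_one] at h3
      refine h (Nat.Partition.ext ?_)
      rw [h2, h3]
      rfl
    obtain ⟨k, hk, hk1⟩ := h1
    exact Multiset.prod_eq_zero (Multiset.mem_map.mpr ⟨k, hk, if_neg hk1⟩)

theorem card_parts_onesPartition (d : ℕ) : (onesPartition d).parts.card = d :=
  Multiset.card_replicate d 1

theorem sum_hurwitzDouble_eq_genusCoeff (hd : 1 ≤ d) (hN : N ≠ 0) (g : ℕ) (m : Fin 3)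
    (x : PhaseSpace m N) :
    ∑ α : Nat.Partition d, ∑ β : Nat.Partition d, (hurwitzDouble g α β : ℂ) *
      ((-1 / N : ℂ) ^ (2 * g + α.parts.card + β.parts.card - 2) *
        ((α.parts.map (startPowerSum N m x)).prod * (β.parts.map (finishPowerSum N m x)).prod)) =
      (N : ℂ) ^ (2 - 2 * (g : ℤ)) * genusCoeff N g d m x := by
  have hN' : (N : ℂ) ≠ 0 := Nat.cast_ne_zero.mpr hN
  have hpow := fun α β : Nat.Partition d => div_natCast_pow_genus (c := -1) (by norm_num) hN g
    (one_le_card_parts hd α) (one_le_card_parts hd β)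
  simp only [hpow]
  match m, x with
  | 0, x =>
    simp only [startPowerSum, finishPowerSum, prod_map_unitPowerSum, mul_ite, ite_mul, mul_zero,
      zero_mul, Finset.sum_ite_eq', Finset.mem_univ, if_true, card_parts_onesPartition,
      genusCoeff, hurwitzSimple, hurwitzSingle]
    rw [Even.neg_one_pow ⟨d, rfl⟩]
    field_simp
  | 1, x =>
    simp only [startPowerSum, finishPowerSum, prod_map_unitPowerSum, mul_ite, mul_zero,
      Finset.sum_ite_eq', Finset.mem_univ, if_true, card_parts_onesPartition,
      genusCoeff, hurwitzSingle, Finset.mul_sum]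
    refine Finset.sum_congr rfl fun α _ => ?_
    rw [newton]
    field_simp
  | 2, x =>
    simp only [startPowerSum, finishPowerSum, genusCoeff, Finset.mul_sum]
    refine Finset.sum_congr rfl fun α _ => Finset.sum_congr rfl fun β _ => ?_
    rw [newton, newton]
    field_simp

theorem hasSum_genusCoeff (hd : 1 ≤ d) (hdN : d ≤ N) (m : Fin 3) (x : PhaseSpace m N) :
    HasSum (fun g : ℕ => (N : ℂ) ^ (2 - 2 * (g : ℤ)) * genusCoeff N g d m x)
      (strongCouplingCoeff N d m x) := by
  rw [strongCouplingCoeff_eq_connectedSum hd hdN]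
  exact (hasSum_connectedSum hd _ _ (card_sub_one_mul_norm_lt_one hdN)).congr_fun fun g =>
    (sum_hurwitzDouble_eq_genusCoeff hd (by omega) g m x).symm

/-! ### Bounds uniform over the polydisc -/

/-- The number of connected monotone walks of genus `g` in `S(d)`. -/
noncomputable def hurwitzTotal (d g : ℕ) : ℝ :=
  ∑ α : Nat.Partition d, ∑ β : Nat.Partition d, (hurwitzDouble g α β : ℝ)

theorem hurwitzTotal_nonneg (d g : ℕ) : 0 ≤ hurwitzTotal d g :=
  Finset.sum_nonneg fun _ _ => Finset.sum_nonneg fun _ _ => Nat.cast_nonneg _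

theorem summable_hurwitzTotal (hd : 1 ≤ d) (hdN : d ≤ N) :
    Summable fun g : ℕ => (N : ℝ) ^ (2 - 2 * (g : ℤ)) * hurwitzTotal d g := by
  have hN : N ≠ 0 := by omega
  have hN' : (N : ℂ) ≠ 0 := Nat.cast_ne_zero.mpr hN
  have hx : ((d : ℝ) - 1) * ‖(1 / N : ℂ)‖ < 1 := by
    have h := card_sub_one_mul_norm_lt_one hdN
    rwa [neg_div, norm_neg] at h
  have h := (hasSum_connectedSum hd (fun _ => (N : ℂ)) (fun _ => (N : ℂ)) hx).summable
  rw [← Complex.summable_ofReal]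
  refine h.congr fun g => ?_
  rw [hurwitzTotal]
  push_cast
  rw [Finset.mul_sum]
  refine Finset.sum_congr rfl fun α _ => ?_
  rw [Finset.mul_sum]
  refine Finset.sum_congr rfl fun β _ => ?_
  rw [div_natCast_pow_genus (one_pow 2) hN g (one_le_card_parts hd α) (one_le_card_parts hd β),
    Multiset.map_const', Multiset.map_const', Multiset.prod_replicate, Multiset.prod_replicate,
    one_pow]
  field_simp

theorem norm_newton_div_le (hN : N ≠ 0) (α : Nat.Partition d) {a : Fin N → ℂ}
    (ha : ∀ j, ‖a j‖ ≤ 1) : ‖newton α a / (N : ℂ) ^ α.parts.card‖ ≤ 1 := by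
  have hN' : (0 : ℝ) < N := Nat.cast_pos.mpr (Nat.pos_of_ne_zero hN)
  rw [norm_div, norm_pow, Complex.norm_natCast, div_le_one (by positivity), newton]
  have hk : ∀ k : ℕ, ‖∑ j, a j ^ k‖ ≤ N := fun k => by
    refine (norm_sum_le _ _).trans ((Finset.sum_le_sum (g := fun _ => (1 : ℝ)) fun j _ => ?_).trans
      (by simp))
    rw [norm_pow]
    exact pow_le_one₀ (norm_nonneg _) (ha j)
  induction α.parts using Multiset.induction_on with
  | empty => simp
  | cons k s ih =>
    rw [Multiset.map_cons, Multiset.prod_cons, norm_mul, Multiset.card_cons, pow_succ']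
    exact mul_le_mul (hk k) ih (norm_nonneg _) hN'.le

theorem norm_genusCoeff_le (hN : N ≠ 0) (g : ℕ) (m : Fin 3) {x : PhaseSpace m N}
    (hx : ∀ i j, ‖x i j‖ ≤ 1) : ‖genusCoeff N g d m x‖ ≤ hurwitzTotal d g := by
  have hsingle : ∀ α : Nat.Partition d, (hurwitzSingle g α : ℝ) ≤
      ∑ β : Nat.Partition d, (hurwitzDouble g α β : ℝ) := fun α =>
    Finset.single_le_sum (f := fun β : Nat.Partition d => (hurwitzDouble g α β : ℝ))
      (fun _ _ => Nat.cast_nonneg _) (Finset.mem_univ (onesPartition d))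
  match m, x, hx with
  | 0, x, _ =>
    rw [genusCoeff, Complex.norm_natCast, hurwitzSimple]
    exact (hsingle _).trans (Finset.single_le_sum
      (f := fun α : Nat.Partition d => ∑ β : Nat.Partition d, (hurwitzDouble g α β : ℝ))
      (fun _ _ => Finset.sum_nonneg fun _ _ => Nat.cast_nonneg _) (Finset.mem_univ _))
  | 1, x, hx =>
    rw [genusCoeff]
    refine (norm_sum_le _ _).trans (Finset.sum_le_sum fun α _ => ?_)
    rw [norm_mul, norm_mul, norm_pow, norm_neg, norm_one, one_pow, mul_one, Complex.norm_natCast]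
    exact (mul_le_of_le_one_left (Nat.cast_nonneg _) (norm_newton_div_le hN α (hx _))).trans
      (hsingle α)
  | 2, x, hx =>
    rw [genusCoeff]
    refine (norm_sum_le _ _).trans (Finset.sum_le_sum fun α _ =>
      (norm_sum_le _ _).trans (Finset.sum_le_sum fun β _ => ?_))
    rw [norm_mul, norm_mul, norm_mul, norm_pow, norm_neg, norm_one, one_pow, mul_one,
      Complex.norm_natCast]
    exact mul_le_of_le_one_left (Nat.cast_nonneg _) (mul_le_one₀ (norm_newton_div_le hN α (hx _))
      (norm_nonneg _) (norm_newton_div_le hN β (hx _)))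

theorem norm_zpow_mul_genusCoeff_le (hN : N ≠ 0) (g : ℕ) (m : Fin 3) {x : PhaseSpace m N}
    (hx : ∀ i j, ‖x i j‖ ≤ 1) : ‖(N : ℂ) ^ (2 - 2 * (g : ℤ)) * genusCoeff N g d m x‖ ≤
      (N : ℝ) ^ (2 - 2 * (g : ℤ)) * hurwitzTotal d g := by
  rw [norm_mul, norm_zpow, Complex.norm_natCast]
  exact mul_le_mul_of_nonneg_left (norm_genusCoeff_le hN g m hx) (zpow_nonneg (Nat.cast_nonneg _) _)

theorem polydiscNorm_le_ofReal {m : Fin 3} {f : PhaseSpace m N → ℂ} {C : ℝ}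
    (h : ∀ x : PhaseSpace m N, (∀ i j, ‖x i j‖ ≤ 1) → ‖f x‖ ≤ C) :
    polydiscNorm f ≤ ENNReal.ofReal C := by
  refine iSup_le fun x => ?_
  rw [← ofReal_norm]
  exact ENNReal.ofReal_le_ofReal (h x.1 x.2)

theorem tsum_polydiscNorm_lt_top (hd : 1 ≤ d) (hdN : d ≤ N) (m : Fin 3) :
    ∑' g : ℕ, polydiscNorm (fun x : PhaseSpace m N =>
      (N : ℂ) ^ (2 - 2 * (g : ℤ)) * genusCoeff N g d m x) < ⊤ := by
  have hN : N ≠ 0 := by omega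
  refine (ENNReal.tsum_le_tsum fun g => polydiscNorm_le_ofReal fun x hx =>
    norm_zpow_mul_genusCoeff_le hN g m hx).trans_lt ?_
  rw [← ENNReal.ofReal_tsum_of_nonneg (fun g => mul_nonneg (zpow_nonneg (Nat.cast_nonneg _) _)
    (hurwitzTotal_nonneg d g)) (summable_hurwitzTotal hd hdN)]
  exact ENNReal.ofReal_lt_top

theorem summable_hurwitzTotal_shift (hd : 1 ≤ d) (k : ℕ) :
    Summable fun j : ℕ => (d : ℝ) ^ (-(2 * (j : ℤ))) * hurwitzTotal d (j + (k + 1)) := by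
  have hd' : (d : ℝ) ≠ 0 := by
    have : d ≠ 0 := by omega
    exact_mod_cast this
  refine (((summable_nat_add_iff (k + 1)).mpr (summable_hurwitzTotal hd le_rfl)).mul_left
    ((d : ℝ) ^ (2 * (k : ℤ)))).congr fun j => ?_
  rw [← mul_assoc, ← zpow_add₀ hd']
  congr 2
  push_cast
  ring

theorem norm_strongCouplingCoeff_sub_le (hd : 1 ≤ d) (hdN : d ≤ N) (m : Fin 3) (k : ℕ)
    {x : PhaseSpace m N} (hx : ∀ i j, ‖x i j‖ ≤ 1) :
    ‖strongCouplingCoeff N d m x -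
      ∑ g ∈ Finset.range (k + 1), (N : ℂ) ^ (2 - 2 * (g : ℤ)) * genusCoeff N g d m x‖ ≤
      (N : ℝ) ^ (-(2 * (k : ℤ))) *
        ∑' j : ℕ, (d : ℝ) ^ (-(2 * (j : ℤ))) * hurwitzTotal d (j + (k + 1)) := by
  have hN : N ≠ 0 := by omega
  have hN' : (0 : ℝ) < N := Nat.cast_pos.mpr (Nat.pos_of_ne_zero hN)
  have hd' : (0 : ℝ) < d := Nat.cast_pos.mpr hd
  have h := (hasSum_nat_add_iff' (k + 1)).mpr (hasSum_genusCoeff hd hdN m x)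
  rw [← h.tsum_eq, ← tsum_mul_left]
  refine tsum_of_norm_bounded ((summable_hurwitzTotal_shift hd k).mul_left _).hasSum fun j => ?_
  refine (norm_zpow_mul_genusCoeff_le hN (j + (k + 1)) m hx).trans ?_
  rw [← mul_assoc]
  refine mul_le_mul_of_nonneg_right ?_ (hurwitzTotal_nonneg d _)
  have h1 : (2 - 2 * ((j + (k + 1) : ℕ) : ℤ)) = -(2 * (k : ℤ)) + -(2 * (j : ℤ)) := by
    push_cast
    ring
  rw [h1, zpow_add₀ hN'.ne']
  refine mul_le_mul_of_nonneg_left ?_ (zpow_nonneg hN'.le _)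
  rw [zpow_neg, zpow_neg]
  refine inv_anti₀ (zpow_pos hd' _) ?_
  exact_mod_cast pow_le_pow_left₀ hd'.le (Nat.cast_le.mpr hdN) (2 * j)

theorem tendsto_polydiscNorm_remainder (hd : 1 ≤ d) (m : Fin 3) (k : ℕ) : Filter.Tendsto
    (fun N : ℕ => ENNReal.ofReal ((N : ℝ) ^ (2 * (k : ℤ) - 2)) *
      polydiscNorm (fun x : PhaseSpace m N => strongCouplingCoeff N d m x -
        ∑ g ∈ Finset.range (k + 1), (N : ℂ) ^ (2 - 2 * (g : ℤ)) * genusCoeff N g d m x))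
    Filter.atTop (nhds 0) := by
  set C : ℝ := ∑' j : ℕ, (d : ℝ) ^ (-(2 * (j : ℤ))) * hurwitzTotal d (j + (k + 1))
  have hC : Filter.Tendsto (fun N : ℕ => ENNReal.ofReal (C / (N : ℝ) ^ 2)) Filter.atTop
      (nhds 0) := by
    have h := (tendsto_const_nhds (x := C)).div_atTop
      ((Filter.tendsto_pow_atTop (two_ne_zero)).comp (tendsto_natCast_atTop_atTop (R := ℝ)))
    simpa using ENNReal.tendsto_ofReal h
  refine tendsto_of_tendsto_of_tendsto_of_le_of_le' tendsto_const_nhds hC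
    (Filter.Eventually.of_forall fun _ => zero_le) ?_
  filter_upwards [Filter.eventually_ge_atTop d] with N hdN
  have hN' : (0 : ℝ) < N := Nat.cast_pos.mpr (hd.trans hdN)
  refine (mul_le_mul_right (polydiscNorm_le_ofReal fun x hx =>
    norm_strongCouplingCoeff_sub_le hd hdN m k hx) _).trans_eq ?_
  rw [← ENNReal.ofReal_mul (zpow_nonneg hN'.le _), ← mul_assoc, ← zpow_add₀ hN'.ne']
  congr 1
  have h1 : (2 * (k : ℤ) - 2 + -(2 * (k : ℤ))) = -2 := by ring
  rw [h1, zpow_neg, div_eq_inv_mul]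
  norm_cast

end StrongCoupling

open StrongCoupling
theorem mainTheorem4 (m : Fin 3) (d : ℕ) (hd : 1 ≤ d) :
    -- the free energy is analytic near `z = 0`, so that its coefficients make sense
    (∀ (N : ℕ), 1 ≤ N → ∀ x : PhaseSpace m N, AnalyticAt ℂ (freeEnergy N m x) 0) ∧
    -- in the stable range `d ≤ N` the genus expansion converges absolutely to `F_N^d`
    (∀ (N : ℕ), d ≤ N →
      (∑' g : ℕ, polydiscNorm (fun x : PhaseSpace m N =>
          (N : ℂ) ^ (2 - 2 * (g : ℤ)) * genusCoeff N g d m x)) < ⊤ ∧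
      ∀ x : PhaseSpace m N,
        HasSum (fun g : ℕ => (N : ℂ) ^ (2 - 2 * (g : ℤ)) * genusCoeff N g d m x)
          (strongCouplingCoeff N d m x)) ∧
    -- the large `N` expansion
    (∀ k : ℕ, Filter.Tendsto
      (fun N : ℕ => ENNReal.ofReal ((N : ℝ) ^ (2 * (k : ℤ) - 2)) *
        polydiscNorm (fun x : PhaseSpace m N =>
          strongCouplingCoeff N d m x -
            ∑ g ∈ Finset.range (k + 1), (N : ℂ) ^ (2 - 2 * (g : ℤ)) * genusCoeff N g d m x))
      Filter.atTop (nhds 0)) :=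
  ⟨fun _ hN x => analyticAt_freeEnergy (Nat.one_le_iff_ne_zero.mp hN) m x,
    fun _ hdN => ⟨tsum_polydiscNorm_lt_top hd hdN m, hasSum_genusCoeff hd hdN m⟩,
    tendsto_polydiscNorm_remainder hd m⟩
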